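/- Let $\mathfrak n$ be a real Lie algebra with basis $Z_1,\dots,Z_r,Y_1,\dots,Y_d,X_1,\dots,X_d$ ($d\ge 1$) such that $[\mathfrak n,\mathfrak n]\subseteq\mathfrak z(\mathfrak n)$, the centre $\mathfrak z(\mathfrak n)$ is spanned by the $Z_k$, $[Y_i,Y_j]=[X_i,X_j]=0$ for all $i,j$, and some linear functional $f$ on $\mathfrak n$ satisfies $\{u\in\mathfrak n: f([u,v])=0\ \forall v\in\mathfrak n\}=\mathfrak z(\mathfrak n)$. Let $N=\exp\mathfrak n$ be the connected, simply connected Lie group of $\mathfrak n$, with coordinates $\exp(\sum z_kZ_k)\exp(\sum y_jY_j)\exp(\sum x_iX_i)$ and Lebesgue measure in $(z,y,x)$ as Haar measure, and let $L$ be its left regular representation on $L^2(N)$. Identify $\lambda\in\mathbb R^r$ with the functional on $\mathfrak n$ that satisfies $\lambda(Z_k)=\lambda_k$ and vanishes on all $Y_j,X_i$. Let $B(\lambda)=-(\lambda([X_i,Y_j]))_{1\le i,j\le d}$, let $V(\lambda)$ be the $2d\times 2d$ matrix of the form $(u,v)\mapsto\lambda([u,v])$ on the vectors $Y_1,\dots,Y_d,X_1,\dots,X_d$,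 let $\Sigma=\{\lambda\in\mathbb R^r:\det V(\lambda)\ne0\}$ and $d\mu(\lambda)=|\det B(\lambda)|\,d\lambda$. Let $\pi_\lambda$ act on $L^2(\mathbb R^d)$ by $$\pi_\lambda\big(\exp(\textstyle\sum z_kZ_k)\exp(\sum y_jY_j)\exp(\sum x_iX_i)\big)F(t)=e^{2\pi i\langle\lambda,z\rangle}e^{2\pi i\langle t,B(\lambda)y\rangle}F(t-x).$$ The Plancherel transform $\mathcal P$ is the extension to $L^2(N)$, with values in the $\mu$-square-integrable measurable fields of Hilbert–Schmidt operators on $L^2(\mathbb R^d)$, of the Fourier transform $f\mapsto\big(\int_N f(g)\pi_\lambda(g)\,dg\big)_\lambda$ on $L^1(N)\cap L^2(N)$. Let $a\in(0,\infty)^r$, $q,b\in(0,\infty)^d$, let $$\Gamma_{a,q,b}=\Big\{\exp\big(\textstyle\sum_k\tfrac{m_k}{a_k}Z_k\big)\exp\big(\sum_j\tfrac{k_j}{q_j}Y_j\big)\exp\big(\sum_i\tfrac{n_i}{b_i}X_i\big): m\in\mathbb Z^r,\ k,n\in\mathbb Z^d\Big\},$$ and let $\mathbf I\subseteq\{\lambda\in\Sigma:0\le\lambda_k\le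 a_k\text{ for all }k\}$. Let $\mathcal K$ be a closed left-invariant subspace of $L^2(N)$, and suppose that there is $\phi\in\mathcal K$ such that $\{L(\gamma)\phi\}_{\gamma\in\Gamma_{a,q,b}}$ is a Parseval frame of $\mathcal K$. Then there is a measurable field $(P_\lambda)$ of orthogonal projections of $L^2(\mathbb R^d)$ such that $$\mathcal K=\mathcal P^{-1}\Big(\int_\Sigma^{\oplus}L^2(\mathbb R^d)\otimes P_\lambda(L^2(\mathbb R^d))\,d\mu(\lambda)\Big)=\{f\in L^2(N):\mathcal P f(\lambda)P_\lambda=\mathcal P f(\lambda)\text{ for }\mu\text{-a.e. }\lambda\},$$ and for every such field, with the multiplicity function $m(\lambda)=\operatorname{rank}P_\lambda\in\{0,1,2,\dots,\infty\}$, one has for almost every $\lambda\in\mathbf I$ $$|\det B(\lambda)|\,m(\lambda)\le\prod_{i=1}^d b_iq_i .$$ -/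

import Mathlib

open MeasureTheory Filter Topology
open scoped ENNReal Matrix

noncomputable section

namespace NilpotentFrames

/-! ### The class of Lie algebras -/

section LieAlgebraPart

variable {r d : ℕ} {𝔫 : Type*} [LieRing 𝔫] [LieAlgebra ℝ 𝔫]

/-- The basis vectors `Z₁, …, Z_r` (with `r = n - 2d`). -/
def vecZ (β : Module.Basis (Fin r ⊕ Fin d ⊕ Fin d) ℝ 𝔫) (k : Fin r) : 𝔫 := β (Sum.inl k)

/-- The basis vectors `Y₁, …, Y_d`. -/
def vecY (β : Module.Basis (Fin r ⊕ Fin d ⊕ Fin d) ℝ 𝔫) (j : Fin d) : 𝔫 :=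
  β (Sum.inr (Sum.inl j))

/-- The basis vectors `X₁, …, X_d`. -/
def vecX (β : Module.Basis (Fin r ⊕ Fin d ⊕ Fin d) ℝ 𝔫) (i : Fin d) : 𝔫 :=
  β (Sum.inr (Sum.inr i))

/-- `𝔫 = 𝔷 ⊕ span Y ⊕ span X` is two-step nilpotent with centre `𝔷 = span Z`, both
`𝔭 = 𝔷 ⊕ span Y` and `𝔪 = span X` are commutative, and some (equivalently, the generic) linear
functional has the centre as its radical, that is, the simply connected group is
square-integrable modulo its centre. -/
structure IsAdmissibleBasis (β : Module.Basis (Fin r ⊕ Fin d ⊕ Fin d) ℝ 𝔫) : Prop where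
  center_eq : (LieAlgebra.center ℝ 𝔫).toSubmodule = Submodule.span ℝ (Set.range (vecZ β))
  lie_mem_center : ∀ u v : 𝔫, ⁅u, v⁆ ∈ LieAlgebra.center ℝ 𝔫
  lie_Y_Y : ∀ i j, ⁅vecY β i, vecY β j⁆ = 0
  lie_X_X : ∀ i j, ⁅vecX β i, vecX β j⁆ = 0
  exists_radical_eq_center :
    ∃ f : Module.Dual ℝ 𝔫, ∀ u : 𝔫, (∀ v, f ⁅u, v⁆ = 0) → u ∈ LieAlgebra.center ℝ 𝔫

/-- The linear functional on `𝔫` with coordinates `l` in the dual basis of `Z₁, …, Z_r`, vanishing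
on all `Y_j` and `X_i`; this identifies `ℝ^r` with `𝔷*`. -/
def functional (β : Module.Basis (Fin r ⊕ Fin d ⊕ Fin d) ℝ 𝔫) (l : Fin r → ℝ) :
    Module.Dual ℝ 𝔫 :=
  β.constr ℝ (Sum.elim l 0)

/-- The skew-symmetric matrix `V(l)` of `(u, v) ↦ l[u, v]` on the non-central basis vectors. -/
def matV (β : Module.Basis (Fin r ⊕ Fin d ⊕ Fin d) ℝ 𝔫) (l : Fin r → ℝ) :
    Matrix (Fin d ⊕ Fin d) (Fin d ⊕ Fin d) ℝ :=
  Matrix.of fun s t => functional β l ⁅β (Sum.inr s), β (Sum.inr t)⁆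

/-- The matrix `B(l) = -(l[X_i, Y_j])_{i,j}`. -/
def matB (β : Module.Basis (Fin r ⊕ Fin d ⊕ Fin d) ℝ 𝔫) (l : Fin r → ℝ) :
    Matrix (Fin d) (Fin d) ℝ :=
  Matrix.of fun i j => -functional β l ⁅vecX β i, vecY β j⁆

/-- The cross-section `Σ ⊆ 𝔷* = ℝ^r` of the generic coadjoint orbits. -/
def crossSection (β : Module.Basis (Fin r ⊕ Fin d ⊕ Fin d) ℝ 𝔫) : Set (Fin r → ℝ) :=
  {l | (matV β l).det ≠ 0}

/-- The Plancherel measure `|det B(l)| dl`. -/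
def plancherelMeasure (β : Module.Basis (Fin r ⊕ Fin d ⊕ Fin d) ℝ 𝔫) : Measure (Fin r → ℝ) :=
  (volume : Measure (Fin r → ℝ)).withDensity fun l => ENNReal.ofReal |(matB β l).det|

/-- The `Z`-coordinates of `[∑ xᵢ Xᵢ, ∑ yⱼ Yⱼ]`. -/
def bracketXY (β : Module.Basis (Fin r ⊕ Fin d ⊕ Fin d) ℝ 𝔫) (x y : Fin d → ℝ) : Fin r → ℝ :=
  fun k => ∑ i, ∑ j, x i * y j * β.repr ⁅vecX β i, vecY β j⁆ (Sum.inl k)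

/-! ### The group -/

/-- The simply connected group `N = exp 𝔫` in the coordinates `(z, y, x) ↔ exp z · exp y · exp x`,
with `z ∈ span Z`, `y ∈ span Y`, `x ∈ span X`. -/
def NilGroup (_β : Module.Basis (Fin r ⊕ Fin d ⊕ Fin d) ℝ 𝔫) : Type :=
  (Fin r → ℝ) × (Fin d → ℝ) × (Fin d → ℝ)

variable {β : Module.Basis (Fin r ⊕ Fin d ⊕ Fin d) ℝ 𝔫}

/-- `N` carries Lebesgue measure in these coordinates, which is a Haar measure. -/
instance : MeasureSpace (NilGroup β) :=
  inferInstanceAs (MeasureSpace ((Fin r → ℝ) × (Fin d → ℝ) × (Fin d → ℝ)))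

/-- The central coordinates of a group element. -/
def NilGroup.z (g : NilGroup β) : Fin r → ℝ := g.1

/-- The `Y`-coordinates of a group element. -/
def NilGroup.y (g : NilGroup β) : Fin d → ℝ := g.2.1

/-- The `X`-coordinates of a group element. -/
def NilGroup.x (g : NilGroup β) : Fin d → ℝ := g.2.2

/-- The group element `exp z · exp y · exp x`. -/
def NilGroup.mk (z : Fin r → ℝ) (y x : Fin d → ℝ) : NilGroup β := (z, y, x)

theorem NilGroup.ext' {g h : NilGroup β} (hz : g.z = h.z) (hy : g.y = h.y) (hx : g.x = h.x) :
    g = h :=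
  Prod.ext hz (Prod.ext hy hx)

instance : Mul (NilGroup β) :=
  ⟨fun g h => NilGroup.mk (g.z + h.z + bracketXY β g.x h.y) (g.y + h.y) (g.x + h.x)⟩

instance : One (NilGroup β) := ⟨NilGroup.mk 0 0 0⟩

instance : Inv (NilGroup β) :=
  ⟨fun g => NilGroup.mk (-g.z + bracketXY β g.x g.y) (-g.y) (-g.x)⟩

theorem NilGroup.mul_def (g h : NilGroup β) :
    g * h = NilGroup.mk (g.z + h.z + bracketXY β g.x h.y) (g.y + h.y) (g.x + h.x) := rfl

theorem NilGroup.one_def : (1 : NilGroup β) = NilGroup.mk 0 0 0 := rfl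

theorem NilGroup.inv_def (g : NilGroup β) :
    g⁻¹ = NilGroup.mk (-g.z + bracketXY β g.x g.y) (-g.y) (-g.x) := rfl

theorem bracketXY_add_left (x x' y : Fin d → ℝ) :
    bracketXY β (x + x') y = bracketXY β x y + bracketXY β x' y := by
  funext k
  simp [bracketXY, add_mul, Finset.sum_add_distrib]

theorem bracketXY_add_right (x y y' : Fin d → ℝ) :
    bracketXY β x (y + y') = bracketXY β x y + bracketXY β x y' := by
  funext k
  simp [bracketXY, mul_add, add_mul, Finset.sum_add_distrib]

theorem bracketXY_neg_left (x y : Fin d → ℝ) :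
    bracketXY β (-x) y = -bracketXY β x y := by
  funext k
  simp [bracketXY]

instance : Group (NilGroup β) :=
  Group.ofLeftAxioms
    (fun g h k => NilGroup.ext'
      (by
        change g.z + h.z + bracketXY β g.x h.y + k.z + bracketXY β (g.x + h.x) k.y =
          g.z + (h.z + k.z + bracketXY β h.x k.y) + bracketXY β g.x (h.y + k.y)
        rw [bracketXY_add_left, bracketXY_add_right]
        abel)
      (add_assoc _ _ _) (add_assoc _ _ _))
    (fun g => NilGroup.ext'
      (by
        change 0 + g.z + bracketXY β 0 g.y = g.z
        funext k
        simp [bracketXY])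
      (zero_add _) (zero_add _))
    (fun g => NilGroup.ext'
      (by
        change -g.z + bracketXY β g.x g.y + g.z + bracketXY β (-g.x) g.y = 0
        rw [bracketXY_neg_left]
        abel)
      (neg_add_cancel g.y) (neg_add_cancel g.x))

/-- The exponential map: `exp(z + y + x) = exp(z + ½[x, y]) · exp y · exp x`. -/
def nilExp (β : Module.Basis (Fin r ⊕ Fin d ⊕ Fin d) ℝ 𝔫) (u : 𝔫) : NilGroup β :=
  NilGroup.mk
    ((fun k => β.repr u (Sum.inl k)) +
      (1 / 2 : ℝ) • bracketXY β (fun i => β.repr u (Sum.inr (Sum.inr i)))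
        (fun j => β.repr u (Sum.inr (Sum.inl j))))
    (fun j => β.repr u (Sum.inr (Sum.inl j)))
    (fun i => β.repr u (Sum.inr (Sum.inr i)))

/-- Left translation is measure preserving, so Lebesgue measure is a left Haar measure. -/
theorem measurePreserving_mul_left (g : NilGroup β) :
    MeasurePreserving (fun h : NilGroup β => g * h) volume volume := by
  have hB : Measurable fun w : (Fin d → ℝ) × (Fin d → ℝ) => bracketXY β g.x w.1 := by
    unfold bracketXY
    fun_prop
  -- first with the coordinates in the order `((y, x), z)`
  have h0 : MeasurePreserving (fun w : (Fin d → ℝ) × (Fin d → ℝ) => (g.y + w.1, g.x + w.2))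
      (volume.prod volume) (volume.prod volume) :=
    (measurePreserving_add_left volume g.y).prod (measurePreserving_add_left volume g.x)
  have hm : Measurable (Function.uncurry
      fun (w : (Fin d → ℝ) × (Fin d → ℝ)) (z : Fin r → ℝ) => (g.z + bracketXY β g.x w.1) + z) :=
    (measurable_const.add (hB.comp measurable_fst)).add measurable_snd
  have h1 := h0.skew_product (μc := (volume : Measure (Fin r → ℝ)))
    (μd := (volume : Measure (Fin r → ℝ))) hm
    (ae_of_all _ fun w => (measurePreserving_add_left volume _).map_eq)
  have h2 := Measure.measurePreserving_swap.comp (h1.comp Measure.measurePreserving_swap)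
  have h3 : (fun h : NilGroup β => g * h) =
      fun h => (g.z + bracketXY β g.x h.y + h.z, g.y + h.y, g.x + h.x) := by
    funext h
    refine NilGroup.ext' ?_ rfl rfl
    change g.z + h.z + bracketXY β g.x h.y = (g.z + bracketXY β g.x h.y) + h.z
    abel
  rw [h3]
  exact h2

/-- The Hilbert space `L²(N)`. -/
abbrev L2N (β : Module.Basis (Fin r ⊕ Fin d ⊕ Fin d) ℝ 𝔫) : Type :=
  Lp ℂ 2 (volume : Measure (NilGroup β))

/-- The left regular representation, `(L(g) f)(h) = f(g⁻¹ h)`. -/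
def leftRegular (g : NilGroup β) (f : L2N β) : L2N β :=
  Lp.compMeasurePreserving (fun h : NilGroup β => g⁻¹ * h) (measurePreserving_mul_left g⁻¹) f

/-- The quasi-lattice `Γ_{a,q,b}`. -/
def quasiLattice (β : Module.Basis (Fin r ⊕ Fin d ⊕ Fin d) ℝ 𝔫) (a : Fin r → ℝ)
    (q b : Fin d → ℝ) : Set (NilGroup β) :=
  {γ | ∃ (m : Fin r → ℤ) (k n : Fin d → ℤ),
    γ = nilExp β (∑ j, ((m j : ℝ) / a j) • vecZ β j) *
        nilExp β (∑ j, ((k j : ℝ) / q j) • vecY β j) *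
        nilExp β (∑ j, ((n j : ℝ) / b j) • vecX β j)}

/-! ### Irreducible representations and the Plancherel transform -/

/-- The Hilbert space `L²(ℝ^d)`. -/
abbrev L2R (d : ℕ) : Type := Lp ℂ 2 (volume : Measure (Fin d → ℝ))

/-- The function `t ↦ exp(2πi l(z)) exp(2πi ⟨t, B(l) y⟩) F(t - x)`, where `g = exp z exp y exp x`. -/
def repFun (l : Fin r → ℝ) (g : NilGroup β) (F : (Fin d → ℝ) → ℂ) (t : Fin d → ℝ) : ℂ :=
  Complex.exp (2 * Real.pi * Complex.I * ((l ⬝ᵥ g.z + t ⬝ᵥ (matB β l *ᵥ g.y) : ℝ) : ℂ)) *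
    F (t - g.x)

theorem memLp_repFun (l : Fin r → ℝ) (g : NilGroup β) (F : L2R d) :
    MemLp (repFun l g F) 2 (volume : Measure (Fin d → ℝ)) := by
  have hF : MemLp (fun t => (F : (Fin d → ℝ) → ℂ) (t - g.x)) 2 volume :=
    (Lp.memLp F).comp_measurePreserving (measurePreserving_sub_right volume g.x)
  refine hF.of_le ?_ (ae_of_all _ fun t => ?_)
  · refine AEStronglyMeasurable.mul (Continuous.aestronglyMeasurable ?_) hF.aestronglyMeasurable
    unfold dotProduct
    fun_prop
  · have h : (2 * Real.pi * Complex.I * ((l ⬝ᵥ g.z + t ⬝ᵥ (matB β l *ᵥ g.y) : ℝ) : ℂ)) =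
        ((2 * Real.pi * (l ⬝ᵥ g.z + t ⬝ᵥ (matB β l *ᵥ g.y)) : ℝ) : ℂ) * Complex.I := by
      push_cast
      ring
    rw [repFun, h, norm_mul, Complex.norm_exp_ofReal_mul_I, one_mul]

/-- The irreducible representation `π_l`, realized on `L²(ℝ^d)`. -/
def rep (l : Fin r → ℝ) (g : NilGroup β) (F : L2R d) : L2R d :=
  (memLp_repFun l g F).toLp (repFun l g F)

/-- `T = ∫_N f(g) π_l(g) dg` (as a strong integral): `T` is the group Fourier transform of `f ∈ L¹`
at `l`. -/
def IsFourierTransformAt (f : NilGroup β → ℂ) (l : Fin r → ℝ) (T : L2R d →L[ℂ] L2R d) : Prop :=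
  ∀ u : L2R d, T u = ∫ g : NilGroup β, f g • rep l g u

/-- The square of the Hilbert–Schmidt norm of an operator on `L²(ℝ^d)`. -/
def hsNormSq (T : L2R d →L[ℂ] L2R d) : ℝ≥0∞ :=
  ∑' i, ‖T ((exists_hilbertBasis ℂ (L2R d)).choose_spec.choose i)‖ₑ ^ 2

/-- A (weakly) measurable field of operators on `L²(ℝ^d)`. -/
def IsMeasurableField (T : (Fin r → ℝ) → L2R d →L[ℂ] L2R d) : Prop :=
  ∀ u v : L2R d, Measurable fun l => inner ℂ u (T l v)

/-- The field `T` is the Plancherel transform of `f ∈ L²(N)`. The transform is the extension of the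
Fourier transform from `L¹ ∩ L²` by continuity: `T` is the limit, in the square-integrable
Hilbert–Schmidt fields, of the Fourier transforms of functions in `L¹ ∩ L²` tending to `f`. -/
def IsPlancherelTransform (f : L2N β) (T : (Fin r → ℝ) → L2R d →L[ℂ] L2R d) : Prop :=
  IsMeasurableField T ∧
  ∃ (f' : ℕ → L2N β) (S : ℕ → (Fin r → ℝ) → L2R d →L[ℂ] L2R d),
    (∀ k, Integrable (f' k) volume) ∧
    Tendsto f' atTop (𝓝 f) ∧
    (∀ k l, IsFourierTransformAt (f' k) l (S k l)) ∧
    Tendsto (fun k => ∫⁻ l, hsNormSq (S k l - T l) ∂(plancherelMeasure β)) atTop (𝓝 0)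

/-- `P` is a measurable field of orthogonal projections of `L²(ℝ^d)` such that `K` is the inverse
image under the Plancherel transform of `∫^⊕ L²(ℝ^d) ⊗ P_l(L²(ℝ^d)) dμ(l)`. In terms of
Hilbert–Schmidt operators, `L²(ℝ^d) ⊗ P_l(L²(ℝ^d))` consists of the `T` with `T P_l = T`. -/
structure IsProjectionField (K : Submodule ℂ (L2N β))
    (P : (Fin r → ℝ) → L2R d →L[ℂ] L2R d) : Prop where
  isStarProjection : ∀ l, IsStarProjection (P l)
  measurable : IsMeasurableField P
  mem_iff : ∀ f : L2N β, f ∈ K ↔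
    ∃ T, IsPlancherelTransform f T ∧ ∀ᵐ l ∂(plancherelMeasure β), T l ∘L P l = T l

/-- The multiplicity function `m(l) = rank P_l ∈ ℕ ∪ {∞}`. -/
def multiplicity (P : (Fin r → ℝ) → L2R d →L[ℂ] L2R d) (l : Fin r → ℝ) : ℕ∞ :=
  Cardinal.toENat (LinearMap.rank (P l : L2R d →ₗ[ℂ] L2R d))

end LieAlgebraPart

/-- The family `v` is a Parseval frame of the subspace `K`. -/
def IsParsevalFrame {H : Type*} [NormedAddCommGroup H] [InnerProductSpace ℂ H] {ι : Type*}
    (K : Submodule ℂ H) (v : ι → H) : Prop :=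
  (∀ i, v i ∈ K) ∧ ∀ f ∈ K, HasSum (fun i => ‖inner ℂ f (v i)‖ ^ 2) (‖f‖ ^ 2)

end NilpotentFrames

end

/-!
Compose the Fourier transform in the coordinates of `N` with the change of variables
`(l, t) ↦ (-l, -B(l)ᵀ t)` in the central and `Y` frequencies, whose Jacobian is the Plancherel
density. The result carries `L²(N)` isometrically onto the square integrable kernels of fields of
Hilbert–Schmidt operators, and there `L(g)` multiplies by a phase in `(l, t)` and translates in
`t`. By uniqueness of Fourier coefficients, `f` is orthogonal to the orbit of `φ` exactly when the
rows of the kernels of `f` are orthogonal to those of the kernels of `φ`. Hence the closed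
invariant subspace generated by `φ` is the space of `f` with `f̂(l) P_l = f̂(l)`, where `P_l` is
the projection onto the orthogonal complement of `ker φ̂(l)`.

For the bound, put `A = ∏ a_k`, `Q = ∏ q_i`, `B = ∏ b_i` and test the frame identity on the fields
`x ↦ ⟪P_l v, x⟫ 1_E(l, ·)` of operators of rank one, with `E` inside a box with sides `a_k`, `q_i`
in the new variables. There the phases of the quasi-lattice form a Fourier basis, so that
`∫_E ‖P_l v‖² = A Q ∑ₙ ∫_E |(φ̂(l) P_l v)(t - n / b)|²`. By additivity this holds for every
measurable `E`, and over a cell with sides `1 / b_i` in `t` the sum unfolds to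
`‖P_l v‖² = A Q B ‖φ̂(l) P_l v‖²`. Summing over an orthonormal basis,
`rank P_l = A Q B ‖φ̂(l)‖²_HS`. On the other hand, `|det B(l)| ‖φ̂(l)‖²_HS` is the density in `l`
of the squared norm of `φ`; testing the frame identity on restrictions of `φ̂` to subsets of boxes
with sides `a_k`, and keeping only the translates of `φ` by central elements, bounds it by `1 / A`.
-/

noncomputable section

namespace NilpotentFrames

/-! ### The Fourier transform on `L¹ ∩ L²` -/

section Fourier

open FourierTransform SchwartzMap

variable {E F : Type*} [NormedAddCommGroup E] [InnerProductSpace ℝ E] [FiniteDimensional ℝ E]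
  [MeasurableSpace E] [BorelSpace E] [NormedAddCommGroup F] [NormedSpace ℂ F]

theorem integral_fourier_schwartz_smul [CompleteSpace F] {f : E → F} (hf : Integrable f)
    (g : 𝓢(E, ℂ)) : ∫ x, (𝓕 g) x • f x = ∫ ξ, g ξ • 𝓕 f ξ := by
  rw [SchwartzMap.fourier_coe]
  simpa only [flip_innerₗ] using! VectorFourier.integral_fourierIntegral_smul_eq_flip
    (L := innerₗ E) Real.continuous_fourierChar continuous_inner g.integrable hf

theorem ae_eq_of_integral_schwartz_smul_eq [CompleteSpace F] {f f' : E → F}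
    (hf : LocallyIntegrable f) (hf' : LocallyIntegrable f')
    (h : ∀ g : 𝓢(E, ℂ), ∫ x, g x • f x = ∫ x, g x • f' x) : f =ᵐ[volume] f' := by
  refine ae_eq_of_integral_contDiff_smul_eq hf hf' fun g hg hg_supp => ?_
  have hsupp : HasCompactSupport (Complex.ofRealCLM ∘ g) := hg_supp.comp_left rfl
  have hsmooth : ContDiff ℝ (↑(⊤ : ℕ∞)) (Complex.ofRealCLM ∘ g) := by fun_prop
  simpa using! h (hsupp.toSchwartzMap hsmooth)

theorem coeFn_fourier_ae_eq {F : Type*} [NormedAddCommGroup F] [InnerProductSpace ℂ F]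
    [CompleteSpace F] (f : Lp (α := E) F 2) (hf : Integrable f) :
    ⇑(𝓕 f : Lp (α := E) F 2) =ᵐ[volume] 𝓕 (f : E → F) := by
  have hcont : Continuous (𝓕 (f : E → F)) := VectorFourier.fourierIntegral_continuous
    Real.continuous_fourierChar (L := innerₗ E) continuous_inner hf
  refine ae_eq_of_integral_schwartz_smul_eq ((Lp.memLp _).locallyIntegrable one_le_two)
    hcont.locallyIntegrable fun g => ?_
  have hdistr := DFunLike.congr_fun (Lp.fourier_toTemperedDistribution_eq f) g
  rw [TemperedDistribution.fourier_apply, Lp.toTemperedDistribution_apply,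
    Lp.toTemperedDistribution_apply] at hdistr
  rw [← hdistr, integral_fourier_schwartz_smul hf]

theorem ae_eq_zero_of_fourier_eq_zero [CompleteSpace F] {f : E → F} (hf : Integrable f)
    (h : ∀ ξ, 𝓕 f ξ = 0) : f =ᵐ[volume] 0 := by
  refine ae_eq_of_integral_schwartz_smul_eq hf.locallyIntegrable
    (integrable_zero _ _ _).locallyIntegrable fun g => ?_
  have hg := integral_fourier_schwartz_smul hf (𝓕⁻ g)
  simpa only [fourier_fourierInv_eq, h, Pi.zero_apply, smul_zero] using hg

end Fourier

/-! ### Isometries of `Lᵖ` spaces -/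

section Isometries

variable {X Y E : Type*} [MeasurableSpace X] [MeasurableSpace Y] {μ : Measure X} {ν : Measure Y}
  [NormedAddCommGroup E] [NormedSpace ℂ E] {p : ℝ≥0∞} [Fact (1 ≤ p)]

/-- Composition with a measure preserving map `e`, as an isometry of `Lᵖ` spaces. It is invertible
as soon as `e` has a measure preserving left inverse `e'` up to null sets. -/
def compMeasurePreservingEquiv (e : X → Y) (he : MeasurePreserving e μ ν) (e' : Y → X)
    (he' : MeasurePreserving e' ν μ) (h : ∀ᵐ x ∂μ, e' (e x) = x) :
    Lp E p ν ≃ₗᵢ[ℂ] Lp E p μ :=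
  LinearIsometryEquiv.ofSurjective (Lp.compMeasurePreservingₗᵢ ℂ e he) fun k => by
    refine ⟨Lp.compMeasurePreserving e' he' k, Lp.ext ?_⟩
    filter_upwards [Lp.coeFn_compMeasurePreserving (Lp.compMeasurePreserving e' he' k) he,
      he.quasiMeasurePreserving.ae (Lp.coeFn_compMeasurePreserving k he'), h] with x hx hx' hinv
    exact hx.trans (hx'.trans (congrArg k hinv))

theorem coeFn_compMeasurePreservingEquiv (e : X → Y) (he : MeasurePreserving e μ ν) (e' : Y → X)
    (he' : MeasurePreserving e' ν μ) (h : ∀ᵐ x ∂μ, e' (e x) = x) (f : Lp E p ν) :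
    compMeasurePreservingEquiv e he e' he' h f =ᵐ[μ] fun x => f (e x) :=
  Lp.coeFn_compMeasurePreserving f he

theorem memLp_top_of_norm_eq_one {w : X → ℂ} (hw : Measurable w) (hn : ∀ x, ‖w x‖ = 1) :
    MemLp w ∞ μ :=
  memLp_top_of_bound hw.aestronglyMeasurable 1 (ae_of_all _ fun x => (hn x).le)

/-- Multiplication by a measurable function of modulus one, as an isometry of `Lᵖ`. -/
def unimodularMul (w : X → ℂ) (hw : Measurable w) (hn : ∀ x, ‖w x‖ = 1) :
    Lp E p μ →ₗᵢ[ℂ] Lp E p μ where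
  toFun f := (memLp_top_of_norm_eq_one hw hn).toLp w • f
  map_add' := Lp.add_smul _
  map_smul' c f := (Lp.smul_comm c _ f).symm
  norm_map' f := by
    refine (Lp.norm_def _).trans ((congrArg ENNReal.toReal (eLpNorm_congr_norm_ae ?_)).trans
      (Lp.norm_def f).symm)
    filter_upwards [Lp.coeFn_lpSMul (r := p) ((memLp_top_of_norm_eq_one hw hn).toLp w) f,
      (memLp_top_of_norm_eq_one (μ := μ) hw hn).coeFn_toLp] with x hsmul hwx
    refine (congrArg norm hsmul).trans ?_
    rw [Pi.smul_apply', hwx, norm_smul, hn, one_mul]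

theorem coeFn_unimodularMul (w : X → ℂ) (hw : Measurable w) (hn : ∀ x, ‖w x‖ = 1)
    (f : Lp E p μ) : unimodularMul w hw hn f =ᵐ[μ] fun x => w x • f x := by
  filter_upwards [Lp.coeFn_lpSMul (r := p) ((memLp_top_of_norm_eq_one hw hn).toLp w) f,
    (memLp_top_of_norm_eq_one (μ := μ) hw hn).coeFn_toLp] with x hsmul hwx
  refine hsmul.trans ?_
  rw [Pi.smul_apply', hwx]

/-- The isometry `unimodularMul`, with inverse the multiplication by `w⁻¹`. -/
def unimodularMulEquiv (w : X → ℂ) (hw : Measurable w) (hn : ∀ x, ‖w x‖ = 1) :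
    Lp E p μ ≃ₗᵢ[ℂ] Lp E p μ :=
  LinearIsometryEquiv.ofSurjective (unimodularMul w hw hn) fun f => by
    have hn' : ∀ x, ‖(w x)⁻¹‖ = 1 := fun x => by rw [norm_inv, hn, inv_one]
    refine ⟨unimodularMul _ hw.inv hn' f, Lp.ext ?_⟩
    filter_upwards [coeFn_unimodularMul w hw hn (unimodularMul _ hw.inv hn' f),
      coeFn_unimodularMul _ hw.inv hn' f] with x hx hx'
    have hne : w x ≠ 0 := fun h0 => by simpa [h0] using hn x
    rw [hx, hx', Pi.inv_apply, smul_inv_smul₀ hne]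

theorem coeFn_unimodularMulEquiv (w : X → ℂ) (hw : Measurable w) (hn : ∀ x, ‖w x‖ = 1)
    (f : Lp E p μ) : unimodularMulEquiv w hw hn f =ᵐ[μ] fun x => w x • f x :=
  coeFn_unimodularMul w hw hn f

end Isometries

theorem dense_setOf_integrable {X E : Type*} [MeasurableSpace X] {μ : Measure X}
    [NormedAddCommGroup E] {p : ℝ≥0∞} [Fact (1 ≤ p)] (hp : p ≠ ∞) :
    Dense {f : Lp E p μ | Integrable f μ} := by
  refine (Lp.simpleFunc.dense hp).mono fun f hf => ?_
  have hp0 : p ≠ 0 := (zero_lt_one.trans_le Fact.out).ne'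
  exact ((SimpleFunc.memLp_iff_integrable hp0 hp).1 (Lp.simpleFunc.memLp ⟨f, hf⟩)).congr
    (Lp.simpleFunc.toSimpleFunc_eq_toFun ⟨f, hf⟩)

/-! ### The Fourier transform in measure preserving coordinates -/

section FourierCoordinates

open FourierTransform

variable {X E F : Type*} [MeasureSpace X] [NormedAddCommGroup E] [InnerProductSpace ℝ E]
  [FiniteDimensional ℝ E] [MeasurableSpace E] [BorelSpace E] [NormedAddCommGroup F]

theorem fourier_comp_symm_apply [NormedSpace ℂ F] (e : X ≃ᵐ E) (he : MeasurePreserving e)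
    (f : X → F) (ξ : E) :
    𝓕 (f ∘ e.symm) ξ =
      ∫ x, Complex.exp (-2 * Real.pi * Complex.I * (inner ℝ (e x) ξ : ℝ)) • f x := by
  rw [Real.fourier_eq', ← he.integral_comp e.measurableEmbedding]
  refine integral_congr_ae (ae_of_all _ fun x => ?_)
  simp only [Function.comp_apply, e.symm_apply_apply]
  congr 2
  push_cast
  ring

/-- The Fourier transform on `L²(X)`, where the measure preserving equivalence `e` identifies `X`
with a Euclidean space. -/
def fourierAlong [InnerProductSpace ℂ F] [CompleteSpace F] (e : X ≃ᵐ E)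
    (he : MeasurePreserving e) : Lp (α := X) F 2 ≃ₗᵢ[ℂ] Lp (α := X) F 2 :=
  (compMeasurePreservingEquiv e.symm he.symm e he (ae_of_all _ e.apply_symm_apply)).trans
    ((Lp.fourierTransformₗᵢ E F).trans
      (compMeasurePreservingEquiv e he e.symm he.symm (ae_of_all _ e.symm_apply_apply)))

theorem coeFn_fourierAlong [InnerProductSpace ℂ F] [CompleteSpace F] (e : X ≃ᵐ E)
    (he : MeasurePreserving e) (f : Lp (α := X) F 2) (hf : Integrable f) :
    fourierAlong e he f =ᵐ[volume] fun ξ =>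
      ∫ x, Complex.exp (-2 * Real.pi * Complex.I * (inner ℝ (e x) (e ξ) : ℝ)) • f x := by
  set f' := compMeasurePreservingEquiv e.symm he.symm e he (ae_of_all _ e.apply_symm_apply) f
  have hf' : f' =ᵐ[volume] f ∘ e.symm := coeFn_compMeasurePreservingEquiv _ _ _ _ _ _
  have hint : Integrable f' := (he.symm.integrable_comp_of_integrable hf).congr hf'.symm
  filter_upwards [he.quasiMeasurePreserving.ae (coeFn_fourier_ae_eq f' hint),
    coeFn_compMeasurePreservingEquiv e he e.symm he.symm (ae_of_all _ e.symm_apply_apply)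
      (Lp.fourierTransformₗᵢ E F f')] with ξ hfourier hcomp
  rw [← fourier_comp_symm_apply e he, ← Real.fourier_congr_ae hf']
  exact hcomp.trans hfourier

theorem ae_eq_zero_of_integral_exp_eq_zero [NormedSpace ℂ F] [CompleteSpace F] (e : X ≃ᵐ E)
    (he : MeasurePreserving e) {f : X → F} (hf : Integrable f)
    (h : ∀ ξ, ∫ x, Complex.exp (-2 * Real.pi * Complex.I * (inner ℝ (e x) (e ξ) : ℝ)) • f x = 0) :
    f =ᵐ[volume] 0 := by
  have hzero : f ∘ e.symm =ᵐ[volume] 0 :=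
    ae_eq_zero_of_fourier_eq_zero (he.symm.integrable_comp_of_integrable hf) fun ξ => by
      rw [fourier_comp_symm_apply e he, ← h (e.symm ξ), e.apply_symm_apply]
  filter_upwards [he.quasiMeasurePreserving.ae hzero] with x hx
  simpa using hx

end FourierCoordinates

/-! ### Measurability of Hilbert space valued maps -/

section Measurability

theorem countable_of_orthonormal {𝕜 H ι : Type*} [RCLike 𝕜] [NormedAddCommGroup H]
    [InnerProductSpace 𝕜 H] [SecondCountableTopology H] {v : ι → H} (hv : Orthonormal 𝕜 v) :
    Countable ι := by
  have hdisj : Pairwise (Function.onFun Disjoint fun i => Metric.ball (v i) (1 / 2)) :=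
    fun i j hij => Metric.ball_disjoint_ball <| by
      have hnorm : ‖v i - v j‖ ^ 2 = 2 := by
        rw [@norm_sub_sq 𝕜, hv.2 hij, hv.1, hv.1, map_zero]
        norm_num
      rw [dist_eq_norm]
      nlinarith [norm_nonneg (v i - v j)]
  exact hdisj.countable_of_isOpen_disjoint (fun _ => Metric.isOpen_ball)
    fun i => ⟨v i, Metric.mem_ball_self (by norm_num)⟩

variable {X : Type*} [MeasurableSpace X]

theorem stronglyMeasurable_of_inner {𝕜 H : Type*} [RCLike 𝕜] [NormedAddCommGroup H]
    [InnerProductSpace 𝕜 H] [CompleteSpace H] [SecondCountableTopology H] {F : X → H}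
    (hF : ∀ u, Measurable fun x => inner 𝕜 u (F x)) : StronglyMeasurable F := by
  obtain ⟨w, b, -⟩ := exists_hilbertBasis 𝕜 H
  have : Countable w := countable_of_orthonormal b.orthonormal
  refine stronglyMeasurable_of_tendsto (atTop : Filter (Finset w))
    (f := fun s x => ∑ i ∈ s, inner 𝕜 (b i) (F x) • b i)
    (fun s => Finset.stronglyMeasurable_fun_sum _ fun i _ =>
      (hF (b i)).stronglyMeasurable.smul_const (b i))
    (tendsto_pi_nhds.2 fun x => ?_)
  simpa only [b.repr_apply_apply] using! b.hasSum_repr (F x)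

theorem exists_measurable_enorm_sub_denseSeq_lt {G : Type*} [NormedAddCommGroup G]
    [SecondCountableTopology G] {F : X → G} (hF : StronglyMeasurable F) {ε : ℝ≥0∞} (hε : 0 < ε) :
    ∃ N : X → ℕ, Measurable N ∧ ∀ x, ‖TopologicalSpace.denseSeq G (N x) - F x‖ₑ < ε := by
  classical
  have hex : ∀ x, ∃ k, ‖TopologicalSpace.denseSeq G k - F x‖ₑ < ε := fun x => by
    obtain ⟨_, ⟨k, rfl⟩, hk⟩ := EMetric.mem_closure_iff.1
      ((TopologicalSpace.denseRange_denseSeq G) (F x)) ε hε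
    exact ⟨k, by rwa [edist_comm, edist_eq_enorm_sub] at hk⟩
  exact ⟨fun x => Nat.find (hex x), measurable_find hex fun k =>
    measurableSet_lt (stronglyMeasurable_const.sub hF).enorm measurable_const,
    fun x => Nat.find_spec (hex x)⟩

variable {Y E : Type*} [MeasurableSpace Y] {ν : Measure Y} [NormedAddCommGroup E] {p : ℝ≥0∞}

theorem ae_tendsto_of_tsum_enorm_rpow_ne_top [Fact (1 ≤ p)] (hp : p ≠ ∞) {f : ℕ → Lp E p ν}
    {g : Lp E p ν} (h : ∑' n, ‖f n - g‖ₑ ^ p.toReal ≠ ∞) :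
    ∀ᵐ y ∂ν, Tendsto (fun n => f n y) atTop (𝓝 (g y)) := by
  have hp0 : p ≠ 0 := (zero_lt_one.trans_le Fact.out).ne'
  have hppos : 0 < p.toReal := ENNReal.toReal_pos hp0 hp
  have hm : ∀ n, AEMeasurable (fun y => ‖(f n - g : Lp E p ν) y‖ₑ ^ p.toReal) ν := fun n =>
    (Lp.aestronglyMeasurable _).enorm.pow_const _
  have hsum : ∫⁻ y, ∑' n, ‖(f n - g : Lp E p ν) y‖ₑ ^ p.toReal ∂ν ≠ ∞ := by
    rw [lintegral_tsum hm]
    simpa only [Lp.enorm_def, eLpNorm_eq_lintegral_rpow_enorm_toReal hp0 hp, one_div,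
      ENNReal.rpow_inv_rpow hppos.ne'] using h
  filter_upwards [ae_lt_top' (AEMeasurable.tsum hm) hsum,
    ae_all_iff.2 fun n => Lp.coeFn_sub (f n) g] with y hy hsub
  have hrpow := (ENNReal.tendsto_atTop_zero_of_tsum_ne_top hy.ne).ennrpow_const p.toReal⁻¹
  simp only [ENNReal.rpow_rpow_inv hppos.ne', ENNReal.zero_rpow_of_pos (inv_pos.2 hppos), hsub,
    Pi.sub_apply] at hrpow
  exact tendsto_iff_edist_tendsto_0.2 (by simpa only [edist_eq_enorm_sub] using hrpow)

theorem exists_measurable_joint_representative [MeasurableSpace E] [BorelSpace E]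
    [SecondCountableTopology E] [CompleteSpace E] [Fact (1 ≤ p)] (hp : p ≠ ∞)
    [SecondCountableTopology (Lp E p ν)] {F : X → Lp E p ν}
    (hF : StronglyMeasurable F) :
    ∃ g : X × Y → E, StronglyMeasurable g ∧ ∀ x, F x =ᵐ[ν] fun y => g (x, y) := by
  have hppos : 0 < p.toReal := ENNReal.toReal_pos (zero_lt_one.trans_le Fact.out).ne' hp
  obtain ⟨ε, hε, hεsum⟩ := ENNReal.exists_pos_sum_of_countable' one_ne_zero ℕ
  choose N hN hNε using fun n => exists_measurable_enorm_sub_denseSeq_lt hF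
    (ENNReal.rpow_pos_of_nonneg (p := p.toReal⁻¹) (hε n) (inv_pos.2 hppos).le)
  set D : ℕ → Lp E p ν := TopologicalSpace.denseSeq (Lp E p ν)
  have hDm : StronglyMeasurable fun q : ℕ × Y => D q.1 q.2 :=
    (measurable_from_prod_countable_right fun k =>
      (Lp.stronglyMeasurable (D k)).measurable).stronglyMeasurable
  have hGm : ∀ n, StronglyMeasurable fun q : X × Y => D (N n q.1) q.2 := fun n =>
    hDm.comp_measurable (((hN n).comp measurable_fst).prodMk measurable_snd)
  refine ⟨_, StronglyMeasurable.limUnder (l := atTop) hGm, fun x => ?_⟩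
  have hsum : ∑' n, ‖D (N n x) - F x‖ₑ ^ p.toReal ≠ ∞ := by
    refine ne_top_of_le_ne_top hεsum.ne_top (ENNReal.tsum_le_tsum fun n => ?_)
    exact ((ENNReal.lt_rpow_inv_iff hppos).1 (hNε n x)).le
  filter_upwards [ae_tendsto_of_tsum_enorm_rpow_ne_top hp hsum] with y hy
  exact hy.limUnder_eq.symm

end Measurability

/-! ### Square integrable functions and Parseval's identity in `ℝ≥0∞` -/

section SquareIntegrable

instance : Fact ((2 : ℝ≥0∞) ≠ ∞) := ⟨ENNReal.ofNat_ne_top⟩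

variable {𝕜 X E : Type*} [RCLike 𝕜] [MeasurableSpace X] {μ : Measure X} [NormedAddCommGroup E]

theorem eLpNorm_two_sq (f : X → E) : eLpNorm f 2 μ ^ 2 = ∫⁻ x, ‖f x‖ₑ ^ 2 ∂μ := by
  simpa using eLpNorm_nnreal_pow_eq_lintegral (f := f) (μ := μ) (p := 2) two_ne_zero

theorem enorm_sq_eq_lintegral (f : Lp E 2 μ) : ‖f‖ₑ ^ 2 = ∫⁻ x, ‖f x‖ₑ ^ 2 ∂μ := by
  rw [Lp.enorm_def, eLpNorm_two_sq]

theorem memLp_two_iff {f : X → E} (hf : AEStronglyMeasurable f μ) :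
    MemLp f 2 μ ↔ ∫⁻ x, ‖f x‖ₑ ^ 2 ∂μ < ∞ := by
  rw [← eLpNorm_two_sq, ENNReal.pow_lt_top_iff, or_iff_left two_ne_zero]
  exact and_iff_right hf

theorem enorm_toLp_sq {f : X → E} (hf : MemLp f 2 μ) :
    ‖hf.toLp f‖ₑ ^ 2 = ∫⁻ x, ‖f x‖ₑ ^ 2 ∂μ := by
  rw [Lp.enorm_toLp, eLpNorm_two_sq]

theorem inner_eq_integral (f g : Lp 𝕜 2 μ) : inner 𝕜 f g = ∫ x, star (f x) * g x ∂μ := by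
  simp only [L2.inner_def, RCLike.inner_apply', RCLike.star_def]

theorem integral_mul_eq_inner {g : X → 𝕜} (hg : MemLp g 2 μ) (u : Lp 𝕜 2 μ) :
    ∫ x, g x * u x ∂μ = inner 𝕜 (hg.star.toLp (star g)) u := by
  rw [inner_eq_integral]
  refine integral_congr_ae ?_
  filter_upwards [hg.star.coeFn_toLp] with x hx
  rw [hx, Pi.star_apply, star_star]

theorem enorm_toLp_star_sq {g : X → 𝕜} (hg : MemLp g 2 μ) :
    ‖hg.star.toLp (star g)‖ₑ ^ 2 = ∫⁻ x, ‖g x‖ₑ ^ 2 ∂μ := by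
  simp only [enorm_toLp_sq, Pi.star_apply, RCLike.star_def, RCLike.enorm_conj]

theorem enorm_integral_mul_sq_le {g : X → 𝕜} (hg : MemLp g 2 μ) (u : Lp 𝕜 2 μ) :
    ‖∫ x, g x * u x ∂μ‖ₑ ^ 2 ≤ (∫⁻ x, ‖g x‖ₑ ^ 2 ∂μ) * ‖u‖ₑ ^ 2 := by
  rw [integral_mul_eq_inner hg, ← enorm_toLp_star_sq hg, ← mul_pow]
  gcongr
  simp only [enorm_eq_nnnorm]
  exact_mod_cast nnnorm_inner_le_nnnorm _ _

theorem hasSum_norm_inner_hilbertBasis_sq {H ι : Type*} [NormedAddCommGroup H]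
    [InnerProductSpace 𝕜 H] (b : HilbertBasis ι 𝕜 H) (u : H) :
    HasSum (fun i => ‖inner 𝕜 u (b i)‖ ^ 2) (‖u‖ ^ 2) := by
  have h := RCLike.hasSum_re 𝕜 (b.hasSum_inner_mul_inner u u)
  rw [inner_self_eq_norm_sq] at h
  refine h.congr_fun fun i => ?_
  rw [← inner_conj_symm (b i) u, RCLike.mul_conj]
  norm_cast

theorem tsum_enorm_sq_eq {ι G : Type*} [SeminormedAddGroup G] {f : ι → G} {c : ℝ}
    (h : HasSum (fun i => ‖f i‖ ^ 2) c) : ∑' i, ‖f i‖ₑ ^ 2 = ENNReal.ofReal c := by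
  rw [← h.tsum_eq, ENNReal.ofReal_tsum_of_nonneg (fun i => by positivity) h.summable]
  simp only [← ofReal_norm, ENNReal.ofReal_pow (norm_nonneg _)]

theorem tsum_enorm_inner_hilbertBasis_sq {H ι : Type*} [NormedAddCommGroup H]
    [InnerProductSpace 𝕜 H] (b : HilbertBasis ι 𝕜 H) (u : H) :
    ∑' i, ‖inner 𝕜 u (b i)‖ₑ ^ 2 = ‖u‖ₑ ^ 2 := by
  rw [tsum_enorm_sq_eq (hasSum_norm_inner_hilbertBasis_sq b u),
    ENNReal.ofReal_pow (norm_nonneg _), ofReal_norm]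

end SquareIntegrable

theorem setIntegral_mul_indicator {X 𝕜 : Type*} [MeasurableSpace X] [RCLike 𝕜] {μ : Measure X}
    {t : Set X} (ht : MeasurableSet t) (s : Set X) (f g : X → 𝕜) :
    ∫ x in s, f x * t.indicator g x ∂μ = ∫ x in s ∩ t, f x * g x ∂μ := by
  rw [← setIntegral_indicator ht]
  exact integral_congr_ae (ae_of_all _ fun x => (Set.indicator_mul_right t f g).symm)

/-! ### Integral operators with square integrable kernels -/

section Kernel

variable {𝕜 X Y : Type*} [RCLike 𝕜] [MeasurableSpace X] [MeasurableSpace Y] {μ : Measure X}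
  {ν : Measure Y}

theorem lintegral_enorm_sq_prod [SFinite ν] {κ : X × Y → 𝕜}
    (hκ : AEStronglyMeasurable κ (μ.prod ν)) :
    ∫⁻ p, ‖κ p‖ₑ ^ 2 ∂(μ.prod ν) = ∫⁻ x, ∫⁻ y, ‖κ (x, y)‖ₑ ^ 2 ∂ν ∂μ :=
  lintegral_prod _ (hκ.enorm.pow_const 2)

theorem integrable_mul_coeFn {g : Y → 𝕜} (hg : MemLp g 2 ν) (u : Lp 𝕜 2 ν) :
    Integrable (fun y => g y * u y) ν :=
  hg.integrable_mul (Lp.memLp u)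

variable [SFinite ν]

theorem memLp_two_slice {κ : X × Y → 𝕜} (hκ : MemLp κ 2 (μ.prod ν)) :
    ∀ᵐ x ∂μ, MemLp (fun y => κ (x, y)) 2 ν := by
  have hfin := (memLp_two_iff hκ.1).1 hκ
  rw [lintegral_enorm_sq_prod hκ.1] at hfin
  filter_upwards [ae_lt_top' (hκ.1.enorm.pow_const 2).lintegral_prod_right' hfin.ne,
    hκ.1.prodMk_left] with x hx hmeas
  exact (memLp_two_iff hmeas).2 hx

theorem lintegral_kernel_sq_le {κ : X × Y → 𝕜} (hκ : MemLp κ 2 (μ.prod ν))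
    (u : Lp 𝕜 2 ν) : ∫⁻ x, ‖∫ y, κ (x, y) * u y ∂ν‖ₑ ^ 2 ∂μ ≤
      (∫⁻ p, ‖κ p‖ₑ ^ 2 ∂(μ.prod ν)) * ‖u‖ₑ ^ 2 := by
  rw [lintegral_enorm_sq_prod hκ.1, ← lintegral_mul_const' _ _ (by simp)]
  refine lintegral_mono_ae ?_
  filter_upwards [memLp_two_slice hκ] with x hx
  exact enorm_integral_mul_sq_le hx u

theorem aestronglyMeasurable_kernel_integral {κ : X × Y → 𝕜} (hκ : MemLp κ 2 (μ.prod ν))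
    (u : Lp 𝕜 2 ν) : AEStronglyMeasurable (fun x => ∫ y, κ (x, y) * u y ∂ν) μ :=
  (hκ.1.mul (Lp.aestronglyMeasurable u).comp_snd).integral_prod_right'

theorem memLp_kernel_integral {κ : X × Y → 𝕜} (hκ : MemLp κ 2 (μ.prod ν))
    (u : Lp 𝕜 2 ν) : MemLp (fun x => ∫ y, κ (x, y) * u y ∂ν) 2 μ :=
  (memLp_two_iff (aestronglyMeasurable_kernel_integral hκ u)).2 <|
    (lintegral_kernel_sq_le hκ u).trans_lt <|
      ENNReal.mul_lt_top ((memLp_two_iff hκ.1).1 hκ) (by simp)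

theorem toLp_kernel_integral_add {κ : X × Y → 𝕜} (hκ : MemLp κ 2 (μ.prod ν)) (u v : Lp 𝕜 2 ν) :
    (memLp_kernel_integral hκ (u + v)).toLp _ =
      (memLp_kernel_integral hκ u).toLp _ + (memLp_kernel_integral hκ v).toLp _ := by
  rw [← MemLp.toLp_add]
  refine MemLp.toLp_congr _ _ ?_
  filter_upwards [memLp_two_slice hκ] with x hx
  rw [Pi.add_apply, ← integral_add (integrable_mul_coeFn hx u) (integrable_mul_coeFn hx v)]
  refine integral_congr_ae ?_
  filter_upwards [Lp.coeFn_add u v] with y hy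
  rw [hy, Pi.add_apply, mul_add]

theorem toLp_kernel_integral_smul {κ : X × Y → 𝕜} (hκ : MemLp κ 2 (μ.prod ν)) (c : 𝕜)
    (u : Lp 𝕜 2 ν) :
    (memLp_kernel_integral hκ (c • u)).toLp _ = c • (memLp_kernel_integral hκ u).toLp _ := by
  rw [← MemLp.toLp_const_smul]
  refine MemLp.toLp_congr _ _ (ae_of_all _ fun x => ?_)
  rw [Pi.smul_apply, ← integral_smul]
  refine integral_congr_ae ?_
  filter_upwards [Lp.coeFn_smul c u] with y hy
  rw [hy, Pi.smul_apply, smul_eq_mul, smul_eq_mul, mul_left_comm]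

open Classical in
/-- The integral operator with kernel `κ`; it is `0` if `κ` is not square integrable. -/
def integralOperator (μ : Measure X) (ν : Measure Y) [SFinite ν] (κ : X × Y → 𝕜) :
    Lp 𝕜 2 ν →L[𝕜] Lp 𝕜 2 μ :=
  if hκ : MemLp κ 2 (μ.prod ν) then
    LinearMap.mkContinuous
      { toFun := fun u => (memLp_kernel_integral hκ u).toLp _
        map_add' := toLp_kernel_integral_add hκ
        map_smul' := toLp_kernel_integral_smul hκ }
      (eLpNorm κ 2 (μ.prod ν)).toReal fun u => by
        refine (Lp.norm_toLp _ (memLp_kernel_integral hκ u)).trans_le ?_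
        rw [Lp.norm_def, ← ENNReal.toReal_mul]
        refine ENNReal.toReal_mono (ENNReal.mul_ne_top hκ.2.ne (Lp.memLp u).2.ne) ?_
        have h := lintegral_kernel_sq_le hκ u
        rw [← eLpNorm_two_sq, ← eLpNorm_two_sq, Lp.enorm_def, ← mul_pow] at h
        exact (ENNReal.pow_le_pow_left_iff two_ne_zero).1 h
  else 0

theorem coeFn_integralOperator {κ : X × Y → 𝕜} (hκ : MemLp κ 2 (μ.prod ν)) (u : Lp 𝕜 2 ν) :
    integralOperator μ ν κ u =ᵐ[μ] fun x => ∫ y, κ (x, y) * u y ∂ν := by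
  rw [integralOperator, dif_pos hκ]
  exact (memLp_kernel_integral hκ u).coeFn_toLp

theorem integralOperator_of_not_memLp {κ : X × Y → 𝕜} (hκ : ¬MemLp κ 2 (μ.prod ν)) :
    integralOperator μ ν κ = 0 :=
  dif_neg hκ

theorem enorm_integralOperator_sq {κ : X × Y → 𝕜} (hκ : MemLp κ 2 (μ.prod ν)) (u : Lp 𝕜 2 ν) :
    ‖integralOperator μ ν κ u‖ₑ ^ 2 = ∫⁻ x, ‖∫ y, κ (x, y) * u y ∂ν‖ₑ ^ 2 ∂μ := by
  rw [enorm_sq_eq_lintegral]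
  refine lintegral_congr_ae ?_
  filter_upwards [coeFn_integralOperator hκ u] with x hx
  rw [hx]

theorem enorm_integralOperator_sq_le {κ : X × Y → 𝕜} (hκ : MemLp κ 2 (μ.prod ν)) (u : Lp 𝕜 2 ν) :
    ‖integralOperator μ ν κ u‖ₑ ^ 2 ≤ (∫⁻ p, ‖κ p‖ₑ ^ 2 ∂(μ.prod ν)) * ‖u‖ₑ ^ 2 :=
  (enorm_integralOperator_sq hκ u).trans_le (lintegral_kernel_sq_le hκ u)

theorem integralOperator_congr {κ κ' : X × Y → 𝕜} (h : κ =ᵐ[μ.prod ν] κ') :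
    integralOperator μ ν κ = integralOperator μ ν κ' := by
  by_cases hκ : MemLp κ 2 (μ.prod ν)
  · have hκ' : MemLp κ' 2 (μ.prod ν) := (memLp_congr_ae h).1 hκ
    refine ContinuousLinearMap.ext fun u => Lp.ext ?_
    filter_upwards [coeFn_integralOperator hκ u, coeFn_integralOperator hκ' u,
      Measure.ae_ae_of_ae_prod h] with x hx hx' hslice
    rw [hx, hx']
    refine integral_congr_ae ?_
    filter_upwards [hslice] with y hy
    rw [hy]
  · rw [integralOperator_of_not_memLp hκ,
      integralOperator_of_not_memLp fun hκ' => hκ ((memLp_congr_ae h).2 hκ')]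

theorem integralOperator_sub {κ κ' : X × Y → 𝕜} (hκ : MemLp κ 2 (μ.prod ν))
    (hκ' : MemLp κ' 2 (μ.prod ν)) :
    integralOperator μ ν (κ - κ') = integralOperator μ ν κ - integralOperator μ ν κ' := by
  refine ContinuousLinearMap.ext fun u => Lp.ext ?_
  filter_upwards [coeFn_integralOperator hκ u, coeFn_integralOperator hκ' u,
    coeFn_integralOperator (hκ.sub hκ') u,
    Lp.coeFn_sub (integralOperator μ ν κ u) (integralOperator μ ν κ' u), memLp_two_slice hκ,
    memLp_two_slice hκ'] with x hx hx' hdiff hsub hslice hslice'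
  rw [hdiff, sub_apply, hsub, Pi.sub_apply, hx, hx',
    ← integral_sub (integrable_mul_coeFn hslice u) (integrable_mul_coeFn hslice' u)]
  simp only [Pi.sub_apply, sub_mul]

theorem inner_integralOperator {κ : X × Y → 𝕜} (hκ : MemLp κ 2 (μ.prod ν)) (u : Lp 𝕜 2 ν)
    (v : Lp 𝕜 2 μ) :
    inner 𝕜 v (integralOperator μ ν κ u) =
      ∫ x, star (v x) * ∫ y, κ (x, y) * u y ∂ν ∂μ := by
  rw [inner_eq_integral]
  refine integral_congr_ae ?_
  filter_upwards [coeFn_integralOperator hκ u] with x hx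
  rw [hx]

theorem tsum_enorm_integralOperator_sq {ι : Type*} [Countable ι]
    (b : HilbertBasis ι 𝕜 (Lp 𝕜 2 ν)) {κ : X × Y → 𝕜} (hκ : MemLp κ 2 (μ.prod ν)) :
    ∑' i, ‖integralOperator μ ν κ (b i)‖ₑ ^ 2 = ∫⁻ p, ‖κ p‖ₑ ^ 2 ∂(μ.prod ν) := by
  simp only [enorm_integralOperator_sq hκ]
  rw [← lintegral_tsum fun i =>
    (aestronglyMeasurable_kernel_integral hκ (b i)).enorm.pow_const 2, lintegral_enorm_sq_prod hκ.1]
  refine lintegral_congr_ae ?_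
  filter_upwards [memLp_two_slice hκ] with x hx
  simp only [integral_mul_eq_inner hx, tsum_enorm_inner_hilbertBasis_sq]
  exact enorm_toLp_star_sq hx

end Kernel

/-! ### Fourier series on boxes -/

section FourierSeries

variable {ι : Type*}

/-- The half-open box with lower corner `c` and side lengths `s`. -/
def box (c s : ι → ℝ) : Set (ι → ℝ) := {x | ∀ i, x i ∈ Set.Ioc (c i) (c i + s i)}

theorem measurableSet_box [Countable ι] (c s : ι → ℝ) : MeasurableSet (box c s) :=
  MeasurableSet.univ_pi' fun _ => measurableSet_Ioc

theorem preimage_mul_left_box (c : ι → ℝ) {s : ι → ℝ} (hs : ∀ i, 0 < s i) :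
    (fun x => s * x) ⁻¹' box c s = box (c / s) 1 := by
  refine Set.ext fun x => forall_congr' fun i => and_congr ?_ ?_
  · exact (div_lt_iff₀' (hs i)).symm
  · rw [Pi.div_apply, Pi.one_apply, div_add_one (hs i).ne', le_div_iff₀' (hs i)]
    rfl

theorem measurableEmbedding_mul_left [Countable ι] {s : ι → ℝ} (hs : ∀ i, 0 < s i) :
    MeasurableEmbedding fun x : ι → ℝ => s * x :=
  (measurable_const_mul s).measurableEmbedding fun _ _ hxy =>
    funext fun i => mul_left_cancel₀ (hs i).ne' (congrFun hxy i)

variable [Fintype ι]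

theorem volume_box (c s : ι → ℝ) : volume (box c s) = ∏ i, ENNReal.ofReal (s i) := by
  have hbox : box c s = Set.univ.pi fun i => Set.Ioc (c i) (c i + s i) :=
    Set.ext fun x => Set.mem_univ_pi.symm
  simp only [hbox, volume_pi_pi, Real.volume_Ioc, add_sub_cancel_left]

theorem volume_eq_smul_map_mul_left {s : ι → ℝ} (hs : ∀ i, 0 < s i) :
    volume = (∏ i, ENNReal.ofReal (s i)) • Measure.map (fun x : ι → ℝ => s * x) volume := by
  classical
  have hpos : 0 < ∏ i, s i := Finset.prod_pos fun i _ => hs i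
  have hmap := Real.map_matrix_volume_pi_eq_smul_volume_pi (M := Matrix.diagonal s)
    (by rw [Matrix.det_diagonal]; exact hpos.ne')
  have hcoe : ⇑(Matrix.toLin' (Matrix.diagonal s)) = fun x => s * x := by
    ext x i
    rw [Matrix.toLin'_apply, Matrix.mulVec_diagonal, Pi.mul_apply]
  rw [hcoe, Matrix.det_diagonal, abs_of_pos (inv_pos.2 hpos)] at hmap
  rw [hmap, smul_smul, ← ENNReal.ofReal_prod_of_nonneg fun i _ => (hs i).le,
    ← ENNReal.ofReal_mul hpos.le, mul_inv_cancel₀ hpos.ne', ENNReal.ofReal_one, one_smul]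

theorem volume_restrict_box_eq_smul_map (c : ι → ℝ) {s : ι → ℝ} (hs : ∀ i, 0 < s i) :
    volume.restrict (box c s) = (∏ i, ENNReal.ofReal (s i)) •
      Measure.map (fun x : ι → ℝ => s * x) (volume.restrict (box (c / s) 1)) := by
  conv_lhs => rw [volume_eq_smul_map_mul_left hs]
  rw [Measure.restrict_smul, (measurableEmbedding_mul_left hs).restrict_map,
    preimage_mul_left_box c hs]

theorem setLIntegral_box (c : ι → ℝ) {s : ι → ℝ} (hs : ∀ i, 0 < s i) (f : (ι → ℝ) → ℝ≥0∞) :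
    ∫⁻ x in box c s, f x =
      (∏ i, ENNReal.ofReal (s i)) * ∫⁻ x in box (c / s) 1, f (s * x) := by
  rw [volume_restrict_box_eq_smul_map c hs, lintegral_smul_measure,
    (measurableEmbedding_mul_left hs).lintegral_map, smul_eq_mul]

theorem setIntegral_box {E : Type*} [NormedAddCommGroup E] [NormedSpace ℝ E] (c : ι → ℝ)
    {s : ι → ℝ} (hs : ∀ i, 0 < s i) (f : (ι → ℝ) → E) :
    ∫ x in box c s, f x =
      (∏ i, ENNReal.ofReal (s i)).toReal • ∫ x in box (c / s) 1, f (s * x) := by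
  rw [volume_restrict_box_eq_smul_map c hs, integral_smul_measure,
    (measurableEmbedding_mul_left hs).integral_map]

attribute [local instance] instMeasureSpaceUnitAddCircle

theorem integral_exp_unit_box_eq_mFourierCoeff (c : ι → ℝ) (G : (ι → ℝ) → ℂ) (m : ι → ℤ) :
    ∫ x in box c 1, Complex.exp (-2 * Real.pi * Complex.I * ((∑ i, m i * x i : ℝ) : ℂ)) * G x =
      UnitAddTorus.mFourierCoeff (fun τ => G (UnitAddTorus.measurableEquivPiIoc c τ)) m := by
  rw [UnitAddTorus.mFourierCoeff_eq_integral _ m c]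
  refine setIntegral_congr_fun (measurableSet_box c 1) fun x hx => ?_
  have hlift : UnitAddTorus.measurableEquivPiIoc c (fun i => x i) = (⟨x, hx⟩ : box c 1) :=
    (UnitAddTorus.measurableEquivPiIoc c).apply_symm_apply ⟨x, hx⟩
  simp only [hlift, smul_eq_mul, UnitAddTorus.mFourier, ContinuousMap.coe_mk, fourier_coe_apply,
    Pi.neg_apply, ← Complex.exp_sum]
  congr 2
  push_cast
  rw [Finset.mul_sum]
  refine Finset.sum_congr rfl fun i _ => ?_
  ring

theorem lintegral_torus_eq_setLIntegral_unit_box (c : ι → ℝ) (f : (ι → ℝ) → ℝ≥0∞) :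
    ∫⁻ τ, f (UnitAddTorus.measurableEquivPiIoc c τ) = ∫⁻ x in box c 1, f x := by
  rw [UnitAddTorus.lintegral_preimage _ c]
  refine setLIntegral_congr_fun (measurableSet_box c 1) fun x hx => ?_
  exact congrArg (fun y => f y.1)
    ((UnitAddTorus.measurableEquivPiIoc c).apply_symm_apply ⟨x, hx⟩)

theorem tsum_enorm_integral_unit_box (c : ι → ℝ) {G : (ι → ℝ) → ℂ} (hG : Measurable G)
    (hG2 : ∫⁻ x in box c 1, ‖G x‖ₑ ^ 2 < ∞) :
    ∑' m : ι → ℤ, ‖∫ x in box c 1,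
      Complex.exp (-2 * Real.pi * Complex.I * ((∑ i, m i * x i : ℝ) : ℂ)) * G x‖ₑ ^ 2 =
        ∫⁻ x in box c 1, ‖G x‖ₑ ^ 2 := by
  simp only [integral_exp_unit_box_eq_mFourierCoeff]
  rw [← lintegral_torus_eq_setLIntegral_unit_box c fun x => ‖G x‖ₑ ^ 2] at hG2 ⊢
  set f : UnitAddTorus ι → ℂ := fun τ => G (UnitAddTorus.measurableEquivPiIoc c τ)
  have hf : MemLp f 2 volume := (memLp_two_iff (hG.comp (measurable_subtype_coe.comp
    (UnitAddTorus.measurableEquivPiIoc c).measurable)).aestronglyMeasurable).2 hG2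
  rw [← enorm_toLp_sq hf, ← tsum_enorm_inner_hilbertBasis_sq UnitAddTorus.mFourierBasis]
  refine tsum_congr fun m => ?_
  have hcoeff : UnitAddTorus.mFourierCoeff (hf.toLp f) m = UnitAddTorus.mFourierCoeff f m :=
    integral_congr_ae (hf.coeFn_toLp.mono fun τ hτ => congrArg _ hτ)
  rw [← hcoeff, ← UnitAddTorus.mFourierBasis_repr, HilbertBasis.repr_apply_apply,
    ← inner_conj_symm, RCLike.enorm_conj]

theorem tsum_enorm_integral_box (c : ι → ℝ) {s : ι → ℝ} (hs : ∀ i, 0 < s i) {G : (ι → ℝ) → ℂ}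
    (hG : Measurable G) (hG2 : ∫⁻ x in box c s, ‖G x‖ₑ ^ 2 < ∞) :
    ∑' m : ι → ℤ, ‖∫ x in box c s, Complex.exp (-2 * Real.pi * Complex.I *
      ((∑ i, m i / s i * x i : ℝ) : ℂ)) * G x‖ₑ ^ 2 =
        (∏ i, ENNReal.ofReal (s i)) * ∫⁻ x in box c s, ‖G x‖ₑ ^ 2 := by
  set A := ∏ i, ENNReal.ofReal (s i) with hA
  have hA0 : A ≠ 0 := Finset.prod_ne_zero_iff.2 fun i _ => by simpa using hs i
  have hAtop : A ≠ ∞ := ENNReal.prod_ne_top fun i _ => ENNReal.ofReal_ne_top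
  have hexp : ∀ (m : ι → ℤ) x, ∑ i, (m i : ℝ) / s i * (s * x) i = ∑ i, m i * x i := fun m x =>
    Finset.sum_congr rfl fun i _ => by
      rw [Pi.mul_apply, ← mul_assoc, div_mul_cancel₀ _ (hs i).ne']
  have hterm : ∀ z : ℂ, ‖A.toReal • z‖ₑ ^ 2 = A ^ 2 * ‖z‖ₑ ^ 2 := fun z => by
    rw [enorm_smul, mul_pow, Real.enorm_of_nonneg ENNReal.toReal_nonneg,
      ENNReal.ofReal_toReal hAtop]
  rw [setLIntegral_box c hs] at hG2 ⊢
  simp only [setIntegral_box c hs, hexp, ← hA, hterm]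
  rw [ENNReal.tsum_mul_left, ← mul_assoc, ← sq, tsum_enorm_integral_unit_box
    (G := fun x => G (s * x)) _ (hG.comp (measurable_const_mul s))
    (ENNReal.lt_top_of_mul_ne_top_right hG2.ne hA0)]

end FourierSeries

section FourierSeriesProd

variable {ι κ : Type*} [Fintype ι] [Fintype κ]

theorem tsum_enorm_integral_box_prod (c₁ : ι → ℝ) (c₂ : κ → ℝ) {a : ι → ℝ} {q : κ → ℝ}
    (ha : ∀ i, 0 < a i) (hq : ∀ i, 0 < q i) {G : (ι → ℝ) × (κ → ℝ) → ℂ} (hG : Measurable G)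
    (hG2 : ∫⁻ ξ in box c₁ a ×ˢ box c₂ q, ‖G ξ‖ₑ ^ 2 < ∞) :
    ∑' w : (ι → ℤ) × (κ → ℤ), ‖∫ ξ in box c₁ a ×ˢ box c₂ q, Complex.exp (-2 * Real.pi *
      Complex.I * ((ξ.1 ⬝ᵥ (fun i => w.1 i / a i) + ξ.2 ⬝ᵥ (fun i => w.2 i / q i) : ℝ) : ℂ)) *
        G ξ‖ₑ ^ 2 =
      (∏ i, ENNReal.ofReal (a i)) * (∏ i, ENNReal.ofReal (q i)) *
        ∫⁻ ξ in box c₁ a ×ˢ box c₂ q, ‖G ξ‖ₑ ^ 2 := by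
  set e : (ι ⊕ κ → ℝ) ≃ᵐ (ι → ℝ) × (κ → ℝ) := MeasurableEquiv.sumPiEquivProdPi fun _ => ℝ
  have he : MeasurePreserving e := volume_measurePreserving_sumPiEquivProdPi fun _ => ℝ
  have hbox : e ⁻¹' (box c₁ a ×ˢ box c₂ q) = box (Sum.elim c₁ c₂) (Sum.elim a q) := by
    ext v
    simp only [box, Set.mem_preimage, Set.mem_ofPred_eq, Set.mem_prod, Sum.forall]
    rfl
  have hside : ∀ i, 0 < Sum.elim a q i := Sum.forall.2 ⟨ha, hq⟩
  have hphase : ∀ (m : ι ⊕ κ → ℤ) (v : ι ⊕ κ → ℝ), ∑ i, m i / Sum.elim a q i * v i =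
      (e v).1 ⬝ᵥ (fun i => m (.inl i) / a i) + (e v).2 ⬝ᵥ (fun i => m (.inr i) / q i) :=
    fun m v => by
      rw [Fintype.sum_sum_type, dotProduct_comm, dotProduct_comm (e v).2]
      rfl
  have hnorm := he.setLIntegral_comp_preimage_emb e.measurableEmbedding (fun ξ => ‖G ξ‖ₑ ^ 2)
    (box c₁ a ×ˢ box c₂ q)
  have hseries := tsum_enorm_integral_box (Sum.elim c₁ c₂) hside (hG.comp e.measurable)
    (by rwa [← hbox, Function.comp_def, hnorm])
  rw [← hbox, Function.comp_def, hnorm, Fintype.prod_sum_type] at hseries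
  refine Eq.trans ?_ hseries
  rw [← (Equiv.sumPiEquivProdPi fun _ : ι ⊕ κ => ℤ).tsum_eq]
  refine tsum_congr fun m => ?_
  rw [← he.setIntegral_preimage_emb e.measurableEmbedding]
  simp only [hphase]
  rfl

end FourierSeriesProd

/-! ### Tilings by boxes -/

section Tiling

variable {ι : Type*} {s : ι → ℝ}

/-- The box with index `n` of the tiling of `ℝ^ι` by translates of the box with side lengths `s`
at the origin. -/
def cell (s : ι → ℝ) (n : ι → ℤ) : Set (ι → ℝ) := box (fun i => n i * s i) s

theorem existsUnique_mem_cell (hs : ∀ i, 0 < s i) (x : ι → ℝ) : ∃! n, x ∈ cell s n := by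
  have h : ∀ i, ∃! k : ℤ, x i ∈ Set.Ioc (k * s i) (k * s i + s i) := fun i => by
    simpa only [zsmul_eq_mul, zero_add, Set.mem_Ioc, sub_pos, tsub_le_iff_left] using
      existsUnique_sub_zsmul_mem_Ioc (hs i) (x i) 0
  choose k hk hu using h
  exact ⟨k, hk, fun n hn => funext fun i => hu i _ (hn i)⟩

theorem measurableSet_cell [Countable ι] (n : ι → ℤ) : MeasurableSet (cell s n) :=
  measurableSet_box _ _

theorem sub_mem_cell_neg_iff (n : ι → ℤ) (t : ι → ℝ) :
    (t - fun i => n i * s i) ∈ cell s (-n) ↔ t ∈ cell s 0 := by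
  refine forall_congr' fun i => ?_
  simp only [Pi.zero_apply, Int.cast_zero, zero_mul, zero_add, Set.mem_Ioc, Pi.sub_apply,
    Pi.neg_apply, Int.cast_neg, neg_mul, neg_lt_sub_iff_lt_add, lt_add_iff_pos_right,
    tsub_le_iff_right, neg_add_cancel_comm]

variable [Fintype ι]

theorem setLIntegral_cell_translate (n : ι → ℤ) (F : (ι → ℝ) → ℝ≥0∞) :
    ∫⁻ t in cell s 0, F (t - fun i => n i * s i) = ∫⁻ t in cell s (-n), F t := by
  rw [← lintegral_indicator (measurableSet_cell _), ← lintegral_indicator (measurableSet_cell _),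
    ← lintegral_sub_right_eq_self ((cell s (-n)).indicator F) fun i => n i * s i]
  classical simp only [Set.indicator_apply, sub_mem_cell_neg_iff]

theorem tsum_setLIntegral_cell (hs : ∀ i, 0 < s i) (F : (ι → ℝ) → ℝ≥0∞) :
    ∑' n : ι → ℤ, ∫⁻ t in cell s n, F t = ∫⁻ t, F t := by
  have hcover : ⋃ n, cell s n = Set.univ :=
    Set.iUnion_eq_univ_iff.2 fun x => (existsUnique_mem_cell hs x).exists
  have hdisj : Pairwise (Function.onFun Disjoint (cell s)) := fun m n hmn =>
    Set.disjoint_left.2 fun x hm hn => hmn ((existsUnique_mem_cell hs x).unique hm hn)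
  rw [← lintegral_iUnion measurableSet_cell hdisj, hcover, Measure.restrict_univ]

theorem tsum_setLIntegral_cell_translate (hs : ∀ i, 0 < s i) (F : (ι → ℝ) → ℝ≥0∞) :
    ∑' n : ι → ℤ, ∫⁻ t in cell s 0, F (t - fun i => n i * s i) = ∫⁻ t, F t := by
  simp only [setLIntegral_cell_translate]
  exact ((Equiv.neg (ι → ℤ)).tsum_eq fun n => ∫⁻ t in cell s n, F t).trans
    (tsum_setLIntegral_cell hs F)

end Tiling

/-! ### The matrix `B(l)` and the Plancherel measure -/

section BracketMatrix

variable {r d : ℕ} {𝔫 : Type*} [LieRing 𝔫] [LieAlgebra ℝ 𝔫]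
  {β : Module.Basis (Fin r ⊕ Fin d ⊕ Fin d) ℝ 𝔫}

theorem functional_apply (l : Fin r → ℝ) (u : 𝔫) :
    functional β l u = ∑ k, l k * β.repr u (Sum.inl k) := by
  rw [functional, Module.Basis.constr_apply_fintype, Fintype.sum_sum_type]
  simp [Module.Basis.equivFun_apply, mul_comm]

theorem matB_apply (l : Fin r → ℝ) (i j : Fin d) :
    matB β l i j = -∑ k, l k * β.repr ⁅vecX β i, vecY β j⁆ (Sum.inl k) := by
  rw [matB, Matrix.of_apply, functional_apply]

theorem matB_add (l l' : Fin r → ℝ) : matB β (l + l') = matB β l + matB β l' := by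
  ext i j
  simp only [matB_apply, Matrix.add_apply, Pi.add_apply, add_mul, Finset.sum_add_distrib, neg_add]

theorem matB_smul (c : ℝ) (l : Fin r → ℝ) : matB β (c • l) = c • matB β l := by
  ext i j
  simp [matB_apply, mul_assoc, Finset.mul_sum]

theorem continuous_matB : Continuous (matB β) := by
  refine continuous_matrix fun i j => ?_
  simp only [matB_apply]
  fun_prop

theorem continuous_det_matB : Continuous fun l => (matB β l).det :=
  continuous_matB.matrix_det

theorem dotProduct_bracketXY (l : Fin r → ℝ) (x y : Fin d → ℝ) :
    l ⬝ᵥ bracketXY β x y = -(x ⬝ᵥ (matB β l *ᵥ y)) := by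
  simp only [dotProduct, bracketXY, Matrix.mulVec, matB_apply, Finset.mul_sum, neg_mul,
    Finset.sum_mul, mul_neg, Finset.sum_neg_distrib, neg_neg]
  rw [Finset.sum_comm]
  refine Finset.sum_congr rfl fun i _ => ?_
  rw [Finset.sum_comm]
  refine Finset.sum_congr rfl fun j _ => Finset.sum_congr rfl fun k _ => ?_
  ring

theorem IsAdmissibleBasis.mem_center_iff (hβ : IsAdmissibleBasis β) {u : 𝔫} :
    u ∈ LieAlgebra.center ℝ 𝔫 ↔ u ∈ Submodule.span ℝ (Set.range (vecZ β)) := by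
  rw [← hβ.center_eq, LieSubmodule.mem_toSubmodule]

theorem IsAdmissibleBasis.repr_Y_eq_zero (hβ : IsAdmissibleBasis β) {u : 𝔫}
    (hu : u ∈ LieAlgebra.center ℝ 𝔫) (j : Fin d) : β.repr u (Sum.inr (Sum.inl j)) = 0 := by
  refine LinearMap.eqOn_span (f := β.coord (Sum.inr (Sum.inl j))) (g := 0) ?_
    (hβ.mem_center_iff.1 hu)
  rintro _ ⟨k, rfl⟩
  simp [vecZ]

theorem apply_eq_functional (f : Module.Dual ℝ 𝔫) {u : 𝔫}
    (hu : u ∈ Submodule.span ℝ (Set.range (vecZ β))) :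
    f u = functional β (fun k => f (vecZ β k)) u := by
  refine LinearMap.eqOn_span ?_ hu
  rintro _ ⟨k, rfl⟩
  exact (β.constr_basis ℝ (Sum.elim (fun k => f (vecZ β k)) 0) (Sum.inl k)).symm

theorem IsAdmissibleBasis.apply_lie_sum_Y_eq_zero (hβ : IsAdmissibleBasis β)
    (f : Module.Dual ℝ 𝔫) {y : Fin d → ℝ} (hy : matB β (fun k => f (vecZ β k)) *ᵥ y = 0) (v : 𝔫) :
    f ⁅∑ j, y j • vecY β j, v⁆ = 0 := by
  suffices f ∘ₗ (LieAlgebra.ad ℝ 𝔫 (∑ j, y j • vecY β j) : 𝔫 →ₗ[ℝ] 𝔫) = 0 from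
    LinearMap.congr_fun this v
  refine β.ext fun s => ?_
  rcases s with k | j | i
  · have hZ : vecZ β k ∈ LieAlgebra.center ℝ 𝔫 :=
      hβ.mem_center_iff.2 (Submodule.subset_span ⟨k, rfl⟩)
    exact (congrArg f ((LieModule.mem_maxTrivSubmodule ℝ 𝔫 𝔫 _).1 hZ _)).trans (map_zero f)
  · change f ⁅∑ j, y j • vecY β j, vecY β j⁆ = 0
    simp only [sum_lie, smul_lie, hβ.lie_Y_Y, smul_zero, Finset.sum_const_zero, map_zero]
  · change f ⁅∑ j, y j • vecY β j, vecX β i⁆ = 0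
    rw [sum_lie, map_sum]
    refine Eq.trans (Finset.sum_congr rfl fun j _ => ?_) (congrFun hy i)
    rw [smul_lie, map_smul, ← lie_skew, map_neg,
      apply_eq_functional f (hβ.mem_center_iff.1 (hβ.lie_mem_center _ _)), smul_eq_mul, mul_comm]
    rfl

theorem IsAdmissibleBasis.exists_det_matB_ne_zero (hβ : IsAdmissibleBasis β) :
    ∃ l, (matB β l).det ≠ 0 := by
  obtain ⟨f, hf⟩ := hβ.exists_radical_eq_center
  refine ⟨fun k => f (vecZ β k), fun hdet => ?_⟩
  obtain ⟨y, hy0, hy⟩ := Matrix.exists_mulVec_eq_zero_iff.2 hdet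
  refine hy0 (funext fun j => ?_)
  simpa [vecY, Finsupp.single_apply] using
    hβ.repr_Y_eq_zero (hf _ (hβ.apply_lie_sum_Y_eq_zero f hy)) j

theorem exists_polynomial_eval_eq_det_matB {l₀ : Fin r → ℝ} (h₀ : (matB β l₀).det ≠ 0)
    (l : Fin r → ℝ) : ∃ p : Polynomial ℝ, p ≠ 0 ∧ ∀ s, p.eval s = (matB β (l + s • l₀)).det := by
  refine ⟨((Polynomial.X : Polynomial ℝ) • (matB β l₀).map Polynomial.C +
    (matB β l).map Polynomial.C).det, fun h => h₀ ?_, fun s => ?_⟩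
  · rw [← Polynomial.coeff_det_X_add_C_card (matB β l₀) (matB β l), h, Polynomial.coeff_zero]
  · rw [← Polynomial.coe_evalRingHom, RingHom.map_det]
    congr 1
    ext i j
    simp only [matB_add, matB_smul, Matrix.add_apply, Matrix.smul_apply, smul_eq_mul,
      Polynomial.coe_evalRingHom, RingHom.mapMatrix_apply, Matrix.map_apply, Polynomial.eval_add,
      Polynomial.eval_mul, Polynomial.eval_X, Polynomial.eval_C]
    ring

theorem IsAdmissibleBasis.ae_det_matB_ne_zero (hβ : IsAdmissibleBasis β) :
    ∀ᵐ l, (matB β l).det ≠ 0 := by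
  obtain ⟨l₀, h₀⟩ := hβ.exists_det_matB_ne_zero
  have hm : MeasurableSet {l : Fin r → ℝ | (matB β l).det ≠ 0} :=
    (measurableSet_eq_fun continuous_det_matB.measurable measurable_const).compl
  refine ae_mem_of_ae_add_linearMap_mem (LinearMap.toSpanSingleton ℝ (Fin r → ℝ) l₀)
    volume volume hm fun l => ?_
  obtain ⟨p, hp, heval⟩ := exists_polynomial_eval_eq_det_matB h₀ l
  refine measure_mono_null (fun s hs => ?_)
    (Set.Finite.measure_zero (Polynomial.finite_setOfPred_isRoot hp) _)
  exact (heval s).trans (not_not.1 hs)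

instance : SigmaFinite (plancherelMeasure β) :=
  SigmaFinite.withDensity_of_ne_top (ae_of_all _ fun _ => ENNReal.ofReal_ne_top)

theorem measurable_abs_det_matB : Measurable fun l => ENNReal.ofReal |(matB β l).det| :=
  continuous_det_matB.measurable.abs.ennreal_ofReal

theorem lintegral_plancherelMeasure {f : (Fin r → ℝ) → ℝ≥0∞} (hf : Measurable f) :
    ∫⁻ l, f l ∂(plancherelMeasure β) = ∫⁻ l, ENNReal.ofReal |(matB β l).det| * f l :=
  lintegral_withDensity_eq_lintegral_mul _ measurable_abs_det_matB hf

theorem IsAdmissibleBasis.ae_plancherelMeasure_iff (hβ : IsAdmissibleBasis β)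
    {p : (Fin r → ℝ) → Prop} : (∀ᵐ l ∂(plancherelMeasure β), p l) ↔ ∀ᵐ l, p l := by
  rw [plancherelMeasure, ae_withDensity_iff measurable_abs_det_matB]
  refine ⟨fun h => ?_, fun h => h.mono fun _ hl _ => hl⟩
  filter_upwards [h, hβ.ae_det_matB_ne_zero] with l hl hdet
  exact hl (by simpa using hdet)

/-! ### The parametrization of the coadjoint orbits -/

/-- The map `(l, t) ↦ (-l, -B(l)ᵀ t)`. It turns the frequency variables of the partial Fourier
transform of `N` in `(z, y)` into the parameter `l` of `π_l` and the variable `t` of `L²(ℝ^d)`, and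
its Jacobian is the Plancherel density. -/
def orbitMap (β : Module.Basis (Fin r ⊕ Fin d ⊕ Fin d) ℝ 𝔫) (p : (Fin r → ℝ) × (Fin d → ℝ)) :
    (Fin r → ℝ) × (Fin d → ℝ) :=
  (-p.1, -((matB β p.1)ᵀ *ᵥ p.2))

/-- The inverse of `orbitMap` at the points where `det B` does not vanish. -/
def orbitMapInv (β : Module.Basis (Fin r ⊕ Fin d ⊕ Fin d) ℝ 𝔫) (p : (Fin r → ℝ) × (Fin d → ℝ)) :
    (Fin r → ℝ) × (Fin d → ℝ) :=
  (-p.1, -(((matB β (-p.1))ᵀ)⁻¹ *ᵥ p.2))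

theorem measurable_orbitMap : Measurable (orbitMap β) :=
  measurable_fst.neg.prodMk ((continuous_matB.comp continuous_fst).matrix_transpose.matrix_mulVec
    continuous_snd).measurable.neg

theorem measurable_orbitMapInv : Measurable (orbitMapInv β) := by
  have hB : Continuous fun p : (Fin r → ℝ) × (Fin d → ℝ) => (matB β (-p.1))ᵀ :=
    (continuous_matB.comp continuous_fst.neg).matrix_transpose
  unfold orbitMapInv
  simp only [Matrix.inv_def, Ring.inverse_eq_inv', Matrix.smul_mulVec]
  exact measurable_fst.neg.prodMk (hB.matrix_det.measurable.inv.smul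
    (hB.matrix_adjugate.matrix_mulVec continuous_snd).measurable).neg

theorem orbitMapInv_orbitMap {p : (Fin r → ℝ) × (Fin d → ℝ)} (hp : (matB β p.1).det ≠ 0) :
    orbitMapInv β (orbitMap β p) = p := by
  have hu : IsUnit (matB β p.1)ᵀ.det := by
    rw [Matrix.det_transpose]
    exact hp.isUnit
  refine Prod.ext (neg_neg _) ?_
  simp only [orbitMapInv, orbitMap, neg_neg, Matrix.mulVec_neg, Matrix.mulVec_mulVec,
    Matrix.nonsing_inv_mul _ hu, Matrix.one_mulVec]

theorem volume_preimage_mulVec {ι : Type*} [Fintype ι] [DecidableEq ι] {A : Matrix ι ι ℝ}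
    (hA : A.det ≠ 0) {s : Set (ι → ℝ)} (hs : MeasurableSet s) :
    ENNReal.ofReal |A.det| * volume ((A *ᵥ ·) ⁻¹' s) = volume s := by
  have hmap : Measure.map (A *ᵥ ·) volume = _ := Real.map_matrix_volume_pi_eq_smul_volume_pi hA
  have hmeas : Measurable (A *ᵥ ·) := (continuous_const.matrix_mulVec continuous_id).measurable
  rw [← Measure.map_apply hmeas hs, hmap, Measure.smul_apply, smul_eq_mul, abs_inv, ← mul_assoc,
    ← ENNReal.ofReal_mul (abs_nonneg _), mul_inv_cancel₀ (abs_ne_zero.2 hA), ENNReal.ofReal_one,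
    one_mul]

theorem IsAdmissibleBasis.measurePreserving_orbitMap (hβ : IsAdmissibleBasis β) :
    MeasurePreserving (orbitMap β) ((plancherelMeasure β).prod volume) volume := by
  refine ⟨measurable_orbitMap, Measure.ext fun s hs => ?_⟩
  rw [Measure.map_apply measurable_orbitMap hs, Measure.prod_apply (measurable_orbitMap hs),
    lintegral_plancherelMeasure (measurable_measure_prodMk_left (measurable_orbitMap hs)),
    Measure.volume_eq_prod, Measure.prod_apply hs,
    ← lintegral_neg_eq_self (fun l => volume (Prod.mk l ⁻¹' s))]
  refine lintegral_congr_ae ?_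
  filter_upwards [hβ.ae_det_matB_ne_zero] with l hl
  have habs : |(-(matB β l)ᵀ).det| = |(matB β l).det| := by
    rw [Matrix.det_neg, Matrix.det_transpose, abs_mul, abs_pow, abs_neg, abs_one, one_pow, one_mul]
  have hvol := volume_preimage_mulVec (A := -(matB β l)ᵀ) (abs_ne_zero.1 (habs ▸ abs_ne_zero.2 hl))
    (measurable_prodMk_left (x := -l) hs)
  simp only [habs, Matrix.neg_mulVec] at hvol
  exact hvol

theorem IsAdmissibleBasis.ae_orbitMapInv_orbitMap (hβ : IsAdmissibleBasis β) :
    ∀ᵐ p ∂((plancherelMeasure β).prod volume), orbitMapInv β (orbitMap β p) = p := by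
  have hfst : ∀ᵐ p ∂((plancherelMeasure β).prod (volume : Measure (Fin d → ℝ))),
      (matB β p.1).det ≠ 0 :=
    Measure.quasiMeasurePreserving_fst.ae
      (hβ.ae_plancherelMeasure_iff.2 hβ.ae_det_matB_ne_zero)
  exact hfst.mono fun _ => orbitMapInv_orbitMap

theorem IsAdmissibleBasis.measurePreserving_orbitMapInv (hβ : IsAdmissibleBasis β) :
    MeasurePreserving (orbitMapInv β) volume ((plancherelMeasure β).prod volume) := by
  refine ⟨measurable_orbitMapInv, ?_⟩
  rw [← hβ.measurePreserving_orbitMap.map_eq,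
    Measure.map_map measurable_orbitMapInv measurable_orbitMap,
    Measure.map_congr (f := orbitMapInv β ∘ orbitMap β) (g := id) hβ.ae_orbitMapInv_orbitMap,
    Measure.map_id]

end BracketMatrix

/-! ### Hilbert–Schmidt operators given by kernels -/

section HilbertSchmidt

variable {d : ℕ}

/-- The Fourier transform of `L²(ℝ^d)`. -/
def fourierL2 (d : ℕ) : L2R d ≃ₗᵢ[ℂ] L2R d :=
  fourierAlong (MeasurableEquiv.toLp 2 (Fin d → ℝ))
    (EuclideanSpace.volume_preserving_symm_measurableEquiv_toLp (Fin d)).symm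

theorem coeFn_fourierL2 (f : L2R d) (hf : Integrable f) :
    (fourierL2 d f : (Fin d → ℝ) → ℂ) =ᵐ[volume] fun t =>
      ∫ s, Complex.exp (-2 * Real.pi * Complex.I * ((t ⬝ᵥ s : ℝ) : ℂ)) * f s := by
  refine (coeFn_fourierAlong _ _ f hf).trans (ae_of_all _ fun t => ?_)
  simp [EuclideanSpace.inner_toLp_toLp]

/-- The operator on `L²(ℝ^d)` whose composition with the Fourier transform is the integral operator
with kernel `κ`. In this normalization the operators `∫ f(g) π_l(g) dg` have kernels depending on
`f` through a partial Fourier transform only. -/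
def hsOp (κ : (Fin d → ℝ) × (Fin d → ℝ) → ℂ) : L2R d →L[ℂ] L2R d :=
  integralOperator volume volume κ ∘L ((fourierL2 d).symm : L2R d →L[ℂ] L2R d)

theorem hsOp_apply (κ : (Fin d → ℝ) × (Fin d → ℝ) → ℂ) (u : L2R d) :
    hsOp κ u = integralOperator volume volume κ ((fourierL2 d).symm u) := rfl

theorem coeFn_hsOp {κ : (Fin d → ℝ) × (Fin d → ℝ) → ℂ} (hκ : MemLp κ 2 volume) (u : L2R d) :
    (hsOp κ u : (Fin d → ℝ) → ℂ) =ᵐ[volume]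
      fun t => ∫ s, κ (t, s) * (fourierL2 d).symm u s :=
  coeFn_integralOperator hκ _

theorem hsOp_congr {κ κ' : (Fin d → ℝ) × (Fin d → ℝ) → ℂ} (h : κ =ᵐ[volume] κ') :
    hsOp κ = hsOp κ' := by
  rw [hsOp, hsOp, integralOperator_congr h]

theorem hsOp_sub {κ κ' : (Fin d → ℝ) × (Fin d → ℝ) → ℂ} (hκ : MemLp κ 2 volume)
    (hκ' : MemLp κ' 2 volume) : hsOp (κ - κ') = hsOp κ - hsOp κ' := by
  rw [hsOp, integralOperator_sub hκ hκ', ContinuousLinearMap.sub_comp]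
  rfl

theorem enorm_hsOp_sq_le {κ : (Fin d → ℝ) × (Fin d → ℝ) → ℂ} (hκ : MemLp κ 2 volume)
    (u : L2R d) : ‖hsOp κ u‖ₑ ^ 2 ≤ (∫⁻ p, ‖κ p‖ₑ ^ 2) * ‖u‖ₑ ^ 2 := by
  rw [hsOp_apply, ← LinearIsometryEquiv.enorm_map (fourierL2 d).symm u]
  exact enorm_integralOperator_sq_le hκ _

/-- The index set of `stdBasis`. -/
def BasisIndex (d : ℕ) : Type := ((exists_hilbertBasis ℂ (L2R d)).choose : Set (L2R d))

/-- The Hilbert basis of `L²(ℝ^d)` used in the definition of `hsNormSq`. -/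
def stdBasis (d : ℕ) : HilbertBasis (BasisIndex d) ℂ (L2R d) :=
  (exists_hilbertBasis ℂ (L2R d)).choose_spec.choose

instance : Countable (BasisIndex d) := countable_of_orthonormal (stdBasis d).orthonormal

theorem hsNormSq_eq_tsum (T : L2R d →L[ℂ] L2R d) :
    hsNormSq T = ∑' i, ‖T (stdBasis d i)‖ₑ ^ 2 := rfl

theorem hsNormSq_hsOp {κ : (Fin d → ℝ) × (Fin d → ℝ) → ℂ} (hκ : MemLp κ 2 volume) :
    hsNormSq (hsOp κ) = ∫⁻ p, ‖κ p‖ₑ ^ 2 := by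
  let b : HilbertBasis (BasisIndex d) ℂ (L2R d) :=
    HilbertBasis.ofRepr ((fourierL2 d).trans (stdBasis d).repr)
  have hb : ∀ i, b i = (fourierL2 d).symm (stdBasis d i) := fun i => by
    classical
    rw [← b.repr_symm_single, ← (stdBasis d).repr_symm_single]
    rfl
  have hsum := tsum_enorm_integralOperator_sq b (hκ : MemLp κ 2 (volume.prod volume))
  simp only [hb] at hsum
  exact hsum

theorem ext_stdBasis {T T' : L2R d →L[ℂ] L2R d} (h : ∀ i, T (stdBasis d i) = T' (stdBasis d i)) :
    T = T' :=
  ContinuousLinearMap.ext_on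
    (Submodule.dense_iff_topologicalClosure_eq_top.2 (stdBasis d).dense_span)
    (Set.eqOn_range.2 (funext h))

theorem eq_zero_of_hsNormSq_eq_zero {T : L2R d →L[ℂ] L2R d} (h : hsNormSq T = 0) : T = 0 := by
  rw [hsNormSq_eq_tsum, ENNReal.tsum_eq_zero] at h
  exact ext_stdBasis fun i => by simpa using h i

theorem hsNormSq_add_le (S T : L2R d →L[ℂ] L2R d) :
    hsNormSq (S + T) ≤ 2 * hsNormSq S + 2 * hsNormSq T := by
  simp only [hsNormSq_eq_tsum]
  rw [← ENNReal.tsum_mul_left, ← ENNReal.tsum_mul_left, ← ENNReal.tsum_add]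
  refine ENNReal.tsum_le_tsum fun i => ?_
  have htriangle : ‖(S + T) (stdBasis d i)‖ₑ ≤ ‖S (stdBasis d i)‖ₑ + ‖T (stdBasis d i)‖ₑ :=
    enorm_add_le _ _
  refine (pow_le_pow_left₀ zero_le htriangle 2).trans ?_
  have hconvex := ENNReal.rpow_add_le_mul_rpow_add_rpow ‖S (stdBasis d i)‖ₑ ‖T (stdBasis d i)‖ₑ
    (p := 2) one_le_two
  rw [show (2 : ℝ≥0∞) ^ ((2 : ℝ) - 1) = 2 by norm_num] at hconvex
  simpa [← mul_add] using hconvex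

theorem hsNormSq_neg (T : L2R d →L[ℂ] L2R d) : hsNormSq (-T) = hsNormSq T := by
  simp [hsNormSq_eq_tsum]

end HilbertSchmidt

section MeasurableFields

variable {r d : ℕ} {T : (Fin r → ℝ) → L2R d →L[ℂ] L2R d}

theorem IsMeasurableField.stronglyMeasurable (hT : IsMeasurableField T) (v : L2R d) :
    StronglyMeasurable fun l => T l v :=
  stronglyMeasurable_of_inner fun u => hT u v

theorem IsMeasurableField.measurable_enorm (hT : IsMeasurableField T) (v : L2R d) :
    Measurable fun l => ‖T l v‖ₑ :=
  (hT.stronglyMeasurable v).enorm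

theorem IsMeasurableField.measurable_hsNormSq (hT : IsMeasurableField T) :
    Measurable fun l => hsNormSq (T l) := by
  simp only [hsNormSq_eq_tsum]
  exact Measurable.tsum fun i => (hT.measurable_enorm _).pow_const 2

theorem IsMeasurableField.sub {T' : (Fin r → ℝ) → L2R d →L[ℂ] L2R d} (hT : IsMeasurableField T)
    (hT' : IsMeasurableField T') : IsMeasurableField fun l => T l - T' l := fun u v => by
  simp only [sub_apply, inner_sub_right]
  exact (hT u v).sub (hT' u v)

theorem isMeasurableField_hsOp {k : (Fin r → ℝ) × ((Fin d → ℝ) × (Fin d → ℝ)) → ℂ}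
    (hk : Measurable k) : IsMeasurableField fun l => hsOp fun p => k (l, p) := by
  classical
  intro u v
  set w := (fourierL2 d).symm v
  let S : Set (Fin r → ℝ) := {l | ∫⁻ p, ‖k (l, p)‖ₑ ^ 2 < ∞}
  have hS : MeasurableSet S :=
    measurableSet_lt ((hk.enorm.pow_const 2).lintegral_prod_right') measurable_const
  have hmem : ∀ l, MemLp (fun p => k (l, p)) 2 volume ↔ l ∈ S := fun l =>
    memLp_two_iff (hk.comp measurable_prodMk_left).aestronglyMeasurable
  have hinner : ∀ l, inner ℂ u (hsOp (fun p => k (l, p)) v) =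
      S.indicator (fun l => ∫ t, star (u t) * ∫ s, k (l, (t, s)) * w s) l := fun l => by
    by_cases hl : l ∈ S
    · rw [Set.indicator_of_mem hl, hsOp_apply]
      exact inner_integralOperator ((hmem l).2 hl) w u
    · rw [Set.indicator_of_notMem hl, hsOp_apply,
        integralOperator_of_not_memLp (μ := volume) (ν := volume) (mt (hmem l).1 hl),
        zero_apply, inner_zero_right]
  simp only [hinner]
  refine Measurable.indicator ?_ hS
  have hk' : Measurable fun x : ((Fin r → ℝ) × (Fin d → ℝ)) × (Fin d → ℝ) =>
      k (x.1.1, (x.1.2, x.2)) := hk.comp (by fun_prop)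
  have hker : StronglyMeasurable fun q : (Fin r → ℝ) × (Fin d → ℝ) =>
      ∫ s, k (q.1, (q.2, s)) * w s :=
    (hk'.mul ((Lp.stronglyMeasurable w).measurable.comp
      measurable_snd)).stronglyMeasurable.integral_prod_right
  have hpair : StronglyMeasurable fun q : (Fin r → ℝ) × (Fin d → ℝ) =>
      star (u q.2) * ∫ s, k (q.1, (q.2, s)) * w s :=
    (((Lp.stronglyMeasurable u).comp_measurable measurable_snd).star).mul hker
  exact hpair.integral_prod_right'.measurable

end MeasurableFields

section Transform

variable {r d : ℕ} {𝔫 : Type*} [LieRing 𝔫] [LieAlgebra ℝ 𝔫]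
  {β : Module.Basis (Fin r ⊕ Fin d ⊕ Fin d) ℝ 𝔫}

/-! ### Phases -/

section Phases

variable {X : Type*} [MeasurableSpace X]

theorem measurable_dotProduct {n : ℕ} {v w : X → Fin n → ℝ} (hv : Measurable v)
    (hw : Measurable w) : Measurable fun x => v x ⬝ᵥ w x := by
  unfold dotProduct
  fun_prop

theorem norm_exp_two_pi_I (x : ℝ) : ‖Complex.exp (2 * Real.pi * Complex.I * (x : ℂ))‖ = 1 := by
  rw [show 2 * Real.pi * Complex.I * (x : ℂ) = ((2 * Real.pi * x : ℝ) : ℂ) * Complex.I by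
    push_cast; ring, Complex.norm_exp_ofReal_mul_I]

theorem measurable_exp_two_pi_I {f : X → ℝ} (hf : Measurable f) :
    Measurable fun x => Complex.exp (2 * Real.pi * Complex.I * (f x : ℂ)) := by
  fun_prop

instance : SigmaFinite (volume : Measure (NilGroup β)) :=
  inferInstanceAs (SigmaFinite (volume : Measure ((Fin r → ℝ) × (Fin d → ℝ) × (Fin d → ℝ))))

theorem NilGroup.measurable_z : Measurable (NilGroup.z : NilGroup β → _) :=
  (measurable_fst : Measurable (Prod.fst : (Fin r → ℝ) × (Fin d → ℝ) × (Fin d → ℝ) → _))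

theorem NilGroup.measurable_y : Measurable (NilGroup.y : NilGroup β → _) :=
  (measurable_fst.comp measurable_snd : Measurable
    fun p : (Fin r → ℝ) × (Fin d → ℝ) × (Fin d → ℝ) => p.2.1)

theorem NilGroup.measurable_x : Measurable (NilGroup.x : NilGroup β → _) :=
  (measurable_snd.comp measurable_snd : Measurable
    fun p : (Fin r → ℝ) × (Fin d → ℝ) × (Fin d → ℝ) => p.2.2)

/-- The phase factor of the representation `π_l`. -/
def repPhase (g : NilGroup β) (l : Fin r → ℝ) (t : Fin d → ℝ) : ℂ :=
  Complex.exp (2 * Real.pi * Complex.I * ((l ⬝ᵥ g.z + t ⬝ᵥ (matB β l *ᵥ g.y) : ℝ) : ℂ))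

/-- The kernel, at `p = (l, t, s)`, of `π_l(g)` composed with the Fourier transform. -/
def repKernel (g : NilGroup β) (p : (Fin r → ℝ) × ((Fin d → ℝ) × (Fin d → ℝ))) : ℂ :=
  repPhase g p.1 p.2.1 *
    Complex.exp (2 * Real.pi * Complex.I * (((g.x - p.2.1) ⬝ᵥ p.2.2 : ℝ) : ℂ))

theorem norm_repPhase (g : NilGroup β) (l : Fin r → ℝ) (t : Fin d → ℝ) : ‖repPhase g l t‖ = 1 :=
  norm_exp_two_pi_I _

theorem norm_repKernel (g : NilGroup β) (p : (Fin r → ℝ) × ((Fin d → ℝ) × (Fin d → ℝ))) :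
    ‖repKernel g p‖ = 1 := by
  rw [repKernel, norm_mul, norm_repPhase, norm_exp_two_pi_I, one_mul]

theorem measurable_matB_mulVec {l : X → Fin r → ℝ} {y : X → Fin d → ℝ} (hl : Measurable l)
    (hy : Measurable y) : Measurable fun x => matB β (l x) *ᵥ y x := by
  have hrow : ∀ i, Continuous fun l => matB β l i := fun i =>
    (continuous_apply i).comp continuous_matB
  exact measurable_pi_lambda _ fun i => measurable_dotProduct ((hrow i).measurable.comp hl) hy

theorem measurable_repPhase {g : X → NilGroup β} {l : X → Fin r → ℝ} {t : X → Fin d → ℝ}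
    (hg : Measurable g) (hl : Measurable l) (ht : Measurable t) :
    Measurable fun x => repPhase (g x) (l x) (t x) := by
  have hz : Measurable fun x => l x ⬝ᵥ (g x).z :=
    measurable_dotProduct hl (NilGroup.measurable_z.comp hg)
  have hBy : Measurable fun x => matB β (l x) *ᵥ (g x).y :=
    measurable_matB_mulVec hl (NilGroup.measurable_y.comp hg)
  have hsum : Measurable fun x => l x ⬝ᵥ (g x).z + t x ⬝ᵥ (matB β (l x) *ᵥ (g x).y) :=
    hz.add (measurable_dotProduct ht hBy)
  exact measurable_exp_two_pi_I hsum

theorem measurable_repKernel {g : X → NilGroup β}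
    {p : X → (Fin r → ℝ) × ((Fin d → ℝ) × (Fin d → ℝ))} (hg : Measurable g) (hp : Measurable p) :
    Measurable fun x => repKernel (g x) (p x) :=
  (measurable_repPhase hg hp.fst hp.snd.fst).mul (measurable_exp_two_pi_I
    (measurable_dotProduct ((NilGroup.measurable_x.comp hg).sub hp.snd.fst) hp.snd.snd))

theorem repPhase_mul (g h : NilGroup β) (l : Fin r → ℝ) (t : Fin d → ℝ) :
    repPhase (g * h) l t = repPhase g l t * repPhase h l (t - g.x) := by
  have hz : l ⬝ᵥ (g * h).z = l ⬝ᵥ g.z + l ⬝ᵥ h.z - g.x ⬝ᵥ (matB β l *ᵥ h.y) := by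
    change l ⬝ᵥ (g.z + h.z + bracketXY β g.x h.y) = _
    rw [dotProduct_add, dotProduct_add, dotProduct_bracketXY, sub_eq_add_neg]
  have hy : (g * h).y = g.y + h.y := rfl
  rw [repPhase, repPhase, repPhase, ← Complex.exp_add, hz, hy, Matrix.mulVec_add, dotProduct_add,
    sub_dotProduct]
  congr 1
  push_cast
  ring

end Phases

/-! ### The Plancherel transform as an isometry onto a space of kernels -/

/-- The group as a Euclidean space. -/
def groupEquiv (β : Module.Basis (Fin r ⊕ Fin d ⊕ Fin d) ℝ 𝔫) : NilGroup β ≃ᵐ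
    WithLp 2 (EuclideanSpace ℝ (Fin r) ×
      WithLp 2 (EuclideanSpace ℝ (Fin d) × EuclideanSpace ℝ (Fin d))) :=
  (MeasurableEquiv.prodCongr (MeasurableEquiv.toLp 2 (Fin r → ℝ))
    ((MeasurableEquiv.prodCongr (MeasurableEquiv.toLp 2 (Fin d → ℝ))
      (MeasurableEquiv.toLp 2 (Fin d → ℝ))).trans (MeasurableEquiv.toLp 2 _))).trans
        (MeasurableEquiv.toLp 2 _)

theorem measurePreserving_groupEquiv : MeasurePreserving (groupEquiv β) := by
  have h : ∀ n, MeasurePreserving (MeasurableEquiv.toLp 2 (Fin n → ℝ)) := fun n =>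
    (EuclideanSpace.volume_preserving_symm_measurableEquiv_toLp (Fin n)).symm
  exact (WithLp.volume_preserving_toLp _ _).comp
    ((h r).prod ((WithLp.volume_preserving_toLp _ _).comp ((h d).prod (h d))))

theorem inner_groupEquiv (g h : NilGroup β) : inner ℝ (groupEquiv β g) (groupEquiv β h) =
    g.z ⬝ᵥ h.z + g.y ⬝ᵥ h.y + g.x ⬝ᵥ h.x := by
  change h.z ⬝ᵥ star g.z + (h.y ⬝ᵥ star g.y + h.x ⬝ᵥ star g.x) = _
  simp only [star_trivial, dotProduct_comm, add_assoc]

/-- The measure on the points `(l, t, s)` at which the kernels of fields of Hilbert–Schmidt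
operators are evaluated. -/
abbrev fieldMeasure (β : Module.Basis (Fin r ⊕ Fin d ⊕ Fin d) ℝ 𝔫) :
    Measure ((Fin r → ℝ) × ((Fin d → ℝ) × (Fin d → ℝ))) :=
  (plancherelMeasure β).prod volume

/-- The frequency, in the Fourier transform of `L²(N)` with respect to all coordinates, that
corresponds to the point `(l, t, s)` of a kernel. -/
def kernelPoint (β : Module.Basis (Fin r ⊕ Fin d ⊕ Fin d) ℝ 𝔫)
    (p : (Fin r → ℝ) × ((Fin d → ℝ) × (Fin d → ℝ))) : NilGroup β :=
  NilGroup.mk (orbitMap β (p.1, p.2.1)).1 (orbitMap β (p.1, p.2.1)).2 (-p.2.2)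

/-- The almost everywhere inverse of `kernelPoint`. -/
def kernelPointInv (β : Module.Basis (Fin r ⊕ Fin d ⊕ Fin d) ℝ 𝔫) (g : NilGroup β) :
    (Fin r → ℝ) × ((Fin d → ℝ) × (Fin d → ℝ)) :=
  ((orbitMapInv β (g.z, g.y)).1, ((orbitMapInv β (g.z, g.y)).2, -g.x))

theorem IsAdmissibleBasis.measurePreserving_kernelPoint (hβ : IsAdmissibleBasis β) :
    MeasurePreserving (kernelPoint β) (fieldMeasure β) volume :=
  (measurePreserving_prodAssoc volume volume volume).comp
    ((hβ.measurePreserving_orbitMap.prod (Measure.measurePreserving_neg volume)).comp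
      ((measurePreserving_prodAssoc (plancherelMeasure β) volume volume).symm
        MeasurableEquiv.prodAssoc))

theorem IsAdmissibleBasis.measurePreserving_kernelPointInv (hβ : IsAdmissibleBasis β) :
    MeasurePreserving (kernelPointInv β) volume (fieldMeasure β) :=
  (measurePreserving_prodAssoc (plancherelMeasure β) volume volume).comp
    ((hβ.measurePreserving_orbitMapInv.prod (Measure.measurePreserving_neg volume)).comp
      ((measurePreserving_prodAssoc volume volume volume).symm MeasurableEquiv.prodAssoc))

theorem IsAdmissibleBasis.ae_kernelPointInv_kernelPoint (hβ : IsAdmissibleBasis β) :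
    ∀ᵐ p ∂(fieldMeasure β), kernelPointInv β (kernelPoint β p) = p := by
  have hdet : ∀ᵐ p ∂(fieldMeasure β), (matB β p.1).det ≠ 0 :=
    Measure.quasiMeasurePreserving_fst.ae
      (hβ.ae_plancherelMeasure_iff.2 hβ.ae_det_matB_ne_zero)
  filter_upwards [hdet] with p hp
  have hinv : orbitMapInv β ((kernelPoint β p).z, (kernelPoint β p).y) = (p.1, p.2.1) :=
    orbitMapInv_orbitMap (p := (p.1, p.2.1)) hp
  simp only [kernelPointInv, hinv]
  exact Prod.ext rfl (Prod.ext rfl (neg_neg _))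

theorem measurable_exp_neg_dotProduct :
    Measurable fun p : (Fin r → ℝ) × ((Fin d → ℝ) × (Fin d → ℝ)) =>
      Complex.exp (2 * Real.pi * Complex.I * ((-(p.2.1 ⬝ᵥ p.2.2) : ℝ) : ℂ)) :=
  measurable_exp_two_pi_I (measurable_dotProduct measurable_snd.fst measurable_snd.snd).neg

/-- The isometry of `L²(N)` onto the space of square integrable fields of kernels that implements
the Plancherel transform: the kernels, in the normalization of `hsOp`, of the Plancherel transform
of `f` are a Fourier transform of `f` in the coordinates `kernelPoint`, up to a phase. -/
def kernelTransform (hβ : IsAdmissibleBasis β) : L2N β ≃ₗᵢ[ℂ] Lp ℂ 2 (fieldMeasure β) :=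
  (fourierAlong (groupEquiv β) measurePreserving_groupEquiv).trans
    ((compMeasurePreservingEquiv (kernelPoint β) hβ.measurePreserving_kernelPoint (kernelPointInv β)
      hβ.measurePreserving_kernelPointInv hβ.ae_kernelPointInv_kernelPoint).trans
        (unimodularMulEquiv _ measurable_exp_neg_dotProduct fun _ => norm_exp_two_pi_I _))

theorem exp_mul_exp_inner_kernelPoint (p : (Fin r → ℝ) × ((Fin d → ℝ) × (Fin d → ℝ)))
    (g : NilGroup β) :
    Complex.exp (2 * Real.pi * Complex.I * ((-(p.2.1 ⬝ᵥ p.2.2) : ℝ) : ℂ)) *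
      Complex.exp (-2 * Real.pi * Complex.I *
        ((inner ℝ (groupEquiv β g) (groupEquiv β (kernelPoint β p)) : ℝ) : ℂ)) =
    repKernel g p := by
  have hz : g.z ⬝ᵥ (kernelPoint β p).z = -(p.1 ⬝ᵥ g.z) := by
    change g.z ⬝ᵥ (-p.1) = _
    rw [dotProduct_neg, dotProduct_comm]
  have hy : g.y ⬝ᵥ (kernelPoint β p).y = -(p.2.1 ⬝ᵥ (matB β p.1 *ᵥ g.y)) := by
    change g.y ⬝ᵥ (-((matB β p.1)ᵀ *ᵥ p.2.1)) = _
    rw [dotProduct_neg, Matrix.mulVec_transpose, dotProduct_comm, Matrix.dotProduct_mulVec]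
  have hx : g.x ⬝ᵥ (kernelPoint β p).x = -(g.x ⬝ᵥ p.2.2) := by
    change g.x ⬝ᵥ (-p.2.2) = _
    rw [dotProduct_neg]
  rw [repKernel, repPhase, ← Complex.exp_add, ← Complex.exp_add, inner_groupEquiv, hz, hy, hx,
    sub_dotProduct]
  congr 1
  push_cast
  ring

theorem coeFn_kernelTransform (hβ : IsAdmissibleBasis β) (f : L2N β) (hf : Integrable f) :
    (kernelTransform hβ f : _ → ℂ) =ᵐ[fieldMeasure β] fun p =>
      ∫ g : NilGroup β, repKernel g p * f g := by
  have hfourier := hβ.measurePreserving_kernelPoint.quasiMeasurePreserving.ae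
    (coeFn_fourierAlong (groupEquiv β) measurePreserving_groupEquiv f hf)
  have hcomp := coeFn_compMeasurePreservingEquiv (kernelPoint β) hβ.measurePreserving_kernelPoint
    (kernelPointInv β) hβ.measurePreserving_kernelPointInv hβ.ae_kernelPointInv_kernelPoint
    (fourierAlong (groupEquiv β) measurePreserving_groupEquiv f)
  have hphase := coeFn_unimodularMulEquiv _ (measurable_exp_neg_dotProduct (r := r) (d := d))
    (fun _ => norm_exp_two_pi_I _)
    (compMeasurePreservingEquiv (kernelPoint β) hβ.measurePreserving_kernelPoint (kernelPointInv β)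
      hβ.measurePreserving_kernelPointInv hβ.ae_kernelPointInv_kernelPoint
      (fourierAlong (groupEquiv β) measurePreserving_groupEquiv f))
  filter_upwards [hfourier, hcomp, hphase] with p hfourier hcomp hphase
  refine hphase.trans ?_
  rw [hcomp, hfourier, smul_eq_mul, ← integral_const_mul]
  simp only [smul_eq_mul, ← mul_assoc, exp_mul_exp_inner_kernelPoint]

/-! ### The left regular representation -/

theorem coeFn_leftRegular (g : NilGroup β) (f : L2N β) :
    (leftRegular g f : NilGroup β → ℂ) =ᵐ[volume] fun h => f (g⁻¹ * h) :=
  Lp.coeFn_compMeasurePreserving f (measurePreserving_mul_left g⁻¹)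

theorem NilGroup.measurableEmbedding_mul_left (g : NilGroup β) :
    MeasurableEmbedding fun h : NilGroup β => g * h :=
  (MeasurableEquiv.mk (Equiv.mulLeft g) (measurePreserving_mul_left g).measurable
    (measurePreserving_mul_left g⁻¹).measurable).measurableEmbedding

/-- The translation of the variable `t` of a kernel. -/
def translateKernel (x : Fin d → ℝ) (p : (Fin r → ℝ) × ((Fin d → ℝ) × (Fin d → ℝ))) :
    (Fin r → ℝ) × ((Fin d → ℝ) × (Fin d → ℝ)) :=
  (p.1, (p.2.1 - x, p.2.2))

theorem measurePreserving_translateKernel (x : Fin d → ℝ) :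
    MeasurePreserving (translateKernel x) (fieldMeasure β) (fieldMeasure β) :=
  (MeasurePreserving.id _).prod
    ((measurePreserving_sub_right volume x).prod (MeasurePreserving.id volume))

theorem repKernel_mul (p : (Fin r → ℝ) × ((Fin d → ℝ) × (Fin d → ℝ))) (g h : NilGroup β) :
    repKernel (g * h) p = repPhase g p.1 p.2.1 * repKernel h (translateKernel g.x p) := by
  have hx : (g * h).x - p.2.1 = h.x - (p.2.1 - g.x) := by
    change g.x + h.x - p.2.1 = _
    abel
  rw [repKernel, repPhase_mul, hx, mul_assoc]
  rfl

/-- The representations `π_l`, acting on the first variable of kernels. -/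
def repOnKernels (g : NilGroup β) : Lp ℂ 2 (fieldMeasure β) →ₗᵢ[ℂ] Lp ℂ 2 (fieldMeasure β) :=
  (unimodularMul (μ := fieldMeasure β) (fun p => repPhase g p.1 p.2.1)
    (measurable_repPhase measurable_const measurable_fst measurable_snd.fst)
    fun _ => norm_repPhase g _ _).comp
      (Lp.compMeasurePreservingₗᵢ ℂ (translateKernel g.x) (measurePreserving_translateKernel g.x))

theorem coeFn_repOnKernels (g : NilGroup β) (k : Lp ℂ 2 (fieldMeasure β)) :
    (repOnKernels g k : _ → ℂ) =ᵐ[fieldMeasure β] fun p =>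
      repPhase g p.1 p.2.1 * k (translateKernel g.x p) := by
  have hmul := coeFn_unimodularMul (μ := fieldMeasure β) (fun p => repPhase g p.1 p.2.1)
    (measurable_repPhase measurable_const measurable_fst measurable_snd.fst)
    (fun _ => norm_repPhase g _ _)
    (Lp.compMeasurePreserving (translateKernel g.x) (measurePreserving_translateKernel g.x) k)
  filter_upwards [Lp.coeFn_compMeasurePreserving k (measurePreserving_translateKernel (β := β) g.x),
    hmul] with p hcomp hmul
  exact hmul.trans (congrArg (_ • ·) hcomp)

theorem continuous_leftRegular (g : NilGroup β) :
    Continuous (leftRegular g : L2N β → L2N β) :=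
  (Lp.compMeasurePreservingₗᵢ ℂ _ (measurePreserving_mul_left g⁻¹)).continuous

theorem kernelTransform_leftRegular (hβ : IsAdmissibleBasis β) (g : NilGroup β) (f : L2N β) :
    kernelTransform hβ (leftRegular g f) = repOnKernels g (kernelTransform hβ f) := by
  have hclosed : IsClosed {f : L2N β |
      kernelTransform hβ (leftRegular g f) = repOnKernels g (kernelTransform hβ f)} :=
    isClosed_eq ((kernelTransform hβ).continuous.comp (continuous_leftRegular g))
      ((repOnKernels g).continuous.comp (kernelTransform hβ).continuous)
  refine hclosed.closure_subset_iff.2 ?_ (dense_setOf_integrable ENNReal.ofNat_ne_top f)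
  rintro f (hf : Integrable f volume)
  have hgf : Integrable (leftRegular g f) volume :=
    ((measurePreserving_mul_left g⁻¹).integrable_comp_of_integrable hf).congr
      (coeFn_leftRegular g f).symm
  refine Lp.ext ?_
  filter_upwards [coeFn_kernelTransform hβ _ hgf, coeFn_repOnKernels g (kernelTransform hβ f),
    (measurePreserving_translateKernel (β := β) g.x).quasiMeasurePreserving.ae
      (coeFn_kernelTransform hβ f hf)] with p hgf hrep hf
  rw [hgf, hrep, hf, ← integral_const_mul,
    ← (measurePreserving_mul_left g).integral_comp (NilGroup.measurableEmbedding_mul_left g)]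
  refine integral_congr_ae ?_
  filter_upwards [(measurePreserving_mul_left g).quasiMeasurePreserving.ae (coeFn_leftRegular g f)]
    with h hh
  rw [hh, inv_mul_cancel_left, repKernel_mul, mul_assoc]

end Transform

section Plancherel

variable {r d : ℕ} {𝔫 : Type*} [LieRing 𝔫] [LieAlgebra ℝ 𝔫]
  {β : Module.Basis (Fin r ⊕ Fin d ⊕ Fin d) ℝ 𝔫}

/-! ### The group Fourier transform of integrable functions -/

theorem measurable_repPhase_apply (g : NilGroup β) (l : Fin r → ℝ) :
    Measurable fun t : Fin d → ℝ => repPhase g l t :=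
  measurable_repPhase measurable_const measurable_const measurable_id

/-- The operator `π_l(g)` as a linear isometry. -/
def repIsometry (l : Fin r → ℝ) (g : NilGroup β) : L2R d →ₗᵢ[ℂ] L2R d :=
  (unimodularMul (μ := volume) (fun t => repPhase g l t) (measurable_repPhase_apply g l)
    fun _ => norm_repPhase g l _).comp
      (Lp.compMeasurePreservingₗᵢ ℂ (fun t => t - g.x) (measurePreserving_sub_right volume g.x))

theorem coeFn_rep (l : Fin r → ℝ) (g : NilGroup β) (u : L2R d) :
    (rep l g u : (Fin d → ℝ) → ℂ) =ᵐ[volume] fun t => repPhase g l t * u (t - g.x) :=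
  (memLp_repFun l g u).coeFn_toLp

theorem rep_eq_repIsometry (l : Fin r → ℝ) (g : NilGroup β) (u : L2R d) :
    rep l g u = repIsometry l g u := by
  have hmul := coeFn_unimodularMul (μ := volume) (fun t => repPhase g l t)
    (measurable_repPhase_apply g l) (fun _ => norm_repPhase g l _)
    (Lp.compMeasurePreserving (fun t => t - g.x) (measurePreserving_sub_right volume g.x) u)
  refine Lp.ext ((coeFn_rep l g u).trans ?_)
  filter_upwards [Lp.coeFn_compMeasurePreserving u (measurePreserving_sub_right volume g.x), hmul]
    with t hcomp hmul
  exact (congrArg (_ * ·) hcomp.symm).trans hmul.symm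

theorem stronglyMeasurable_rep (l : Fin r → ℝ) (u : L2R d) :
    StronglyMeasurable fun g : NilGroup β => rep l g u := by
  refine stronglyMeasurable_of_inner (𝕜 := ℂ) fun v => ?_
  have hinner : ∀ g : NilGroup β, inner ℂ v (rep l g u) =
      ∫ t, star (v t) * (repPhase g l t * u (t - g.x)) := fun g => by
    rw [inner_eq_integral]
    refine integral_congr_ae ?_
    filter_upwards [coeFn_rep l g u] with t ht
    rw [ht]
  have hv : Measurable fun p : NilGroup β × (Fin d → ℝ) => star ((v : (Fin d → ℝ) → ℂ) p.2) :=
    continuous_star.measurable.comp ((Lp.stronglyMeasurable v).measurable.comp measurable_snd)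
  have hphase : Measurable fun p : NilGroup β × (Fin d → ℝ) => repPhase p.1 l p.2 :=
    measurable_repPhase measurable_fst measurable_const measurable_snd
  have hu : Measurable fun p : NilGroup β × (Fin d → ℝ) => (u : (Fin d → ℝ) → ℂ) (p.2 - p.1.x) :=
    (Lp.stronglyMeasurable u).measurable.comp
      (measurable_snd.sub (NilGroup.measurable_x.comp measurable_fst))
  simp only [hinner]
  exact (hv.mul (hphase.mul hu)).stronglyMeasurable.integral_prod_right.measurable

theorem integrable_smul_rep {f : NilGroup β → ℂ} (hf : Integrable f) (l : Fin r → ℝ)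
    (u : L2R d) : Integrable fun g => f g • rep l g u := by
  refine (hf.norm.mul_const ‖u‖).mono'
    (hf.aestronglyMeasurable.smul (stronglyMeasurable_rep l u).aestronglyMeasurable)
    (ae_of_all _ fun g => ?_)
  rw [norm_smul, rep_eq_repIsometry, LinearIsometry.norm_map]

theorem exists_isFourierTransformAt {f : NilGroup β → ℂ} (hf : Integrable f) (l : Fin r → ℝ) :
    ∃ T : L2R d →L[ℂ] L2R d, IsFourierTransformAt f l T := by
  refine ⟨LinearMap.mkContinuous
    { toFun := fun u => ∫ g, f g • rep l g u
      map_add' := fun u v => ?_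
      map_smul' := fun c u => ?_ } (∫ g, ‖f g‖) fun u => ?_, fun u => rfl⟩
  · rw [← integral_add (integrable_smul_rep hf l u) (integrable_smul_rep hf l v)]
    simp only [rep_eq_repIsometry, map_add, smul_add]
  · rw [RingHom.id_apply, ← integral_smul]
    simp only [rep_eq_repIsometry, map_smul, smul_comm c]
  · change ‖∫ g, f g • rep l g u‖ ≤ _
    refine (norm_integral_le_integral_norm _).trans_eq ?_
    rw [← integral_mul_const]
    simp only [norm_smul, rep_eq_repIsometry, LinearIsometry.norm_map]

/-! ### Kernels of the group Fourier transform -/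

theorem coeFn_rep_fourierL2 (l : Fin r → ℝ) (g : NilGroup β) (s : L2R d) (hs : Integrable s) :
    (rep l g (fourierL2 d s) : (Fin d → ℝ) → ℂ) =ᵐ[volume] fun t =>
      ∫ σ, repKernel g (l, (t, σ)) * s σ := by
  filter_upwards [coeFn_rep l g (fourierL2 d s), (measurePreserving_sub_right volume
    g.x).quasiMeasurePreserving.ae (coeFn_fourierL2 s hs)] with t hrep hfourier
  rw [hrep, hfourier, ← integral_const_mul]
  congr with σ
  rw [repKernel, ← mul_assoc, ← neg_sub g.x t, neg_dotProduct]
  push_cast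
  ring_nf

theorem integrable_star_mul {X Y : Type*} [MeasurableSpace X] [MeasurableSpace Y] {μ : Measure X}
    {ν : Measure Y} {v : X → ℂ} {s : Y → ℂ} (hv : Integrable v μ) (hs : Integrable s ν) :
    Integrable (fun p : X × Y => star (v p.1) * s p.2) (μ.prod ν) :=
  ((integrable_norm_iff (continuous_star.comp_aestronglyMeasurable hv.1)).1
    (by simpa only [norm_star] using hv.norm)).mul_prod hs

theorem inner_rep_fourierL2 (l : Fin r → ℝ) (g : NilGroup β) {s v : L2R d} (hs : Integrable s)
    (hv : Integrable v) : inner ℂ v (rep l g (fourierL2 d s)) =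
      ∫ p : (Fin d → ℝ) × (Fin d → ℝ), repKernel g (l, p) * (star (v p.1) * s p.2) := by
  have hint : Integrable (fun p : (Fin d → ℝ) × (Fin d → ℝ) =>
      repKernel g (l, p) * (star (v p.1) * s p.2)) (volume.prod volume) :=
    (integrable_star_mul hv hs).bdd_mul (c := 1)
      (measurable_repKernel measurable_const measurable_prodMk_left).aestronglyMeasurable
      (ae_of_all _ fun p => (norm_repKernel g _).le)
  rw [inner_eq_integral, Measure.volume_eq_prod, integral_prod _ hint]
  refine integral_congr_ae ?_
  filter_upwards [coeFn_rep_fourierL2 l g s hs] with t ht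
  rw [ht, ← integral_const_mul]
  simp only [mul_left_comm]

theorem integral_mul_inner_rep_fourierL2 {f : NilGroup β → ℂ} (hf : Integrable f)
    (l : Fin r → ℝ) {s v : L2R d} (hs : Integrable s) (hv : Integrable v) :
    ∫ g, f g * inner ℂ v (rep l g (fourierL2 d s)) =
      ∫ p : (Fin d → ℝ) × (Fin d → ℝ),
        (∫ g, repKernel g (l, p) * f g) * (star (v p.1) * s p.2) := by
  have hint : Integrable (fun q : NilGroup β × ((Fin d → ℝ) × (Fin d → ℝ)) =>
      repKernel q.1 (l, q.2) * (f q.1 * (star (v q.2.1) * s q.2.2))) (volume.prod volume) :=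
    (hf.mul_prod (integrable_star_mul hv hs)).bdd_mul (c := 1)
      (measurable_repKernel measurable_fst
        (measurable_const.prodMk measurable_snd)).aestronglyMeasurable
      (ae_of_all _ fun q => (norm_repKernel _ _).le)
  calc ∫ g, f g * inner ℂ v (rep l g (fourierL2 d s))
      = ∫ g, ∫ p : (Fin d → ℝ) × (Fin d → ℝ),
          repKernel g (l, p) * (f g * (star (v p.1) * s p.2)) := by
        congr with g
        rw [inner_rep_fourierL2 l g hs hv, ← integral_const_mul]
        simp only [mul_left_comm]
    _ = ∫ p : (Fin d → ℝ) × (Fin d → ℝ), ∫ g,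
          repKernel g (l, p) * (f g * (star (v p.1) * s p.2)) := integral_integral_swap hint
    _ = _ := by simp only [← mul_assoc, integral_mul_const]

theorem inner_hsOp_fourierL2 {κ : (Fin d → ℝ) × (Fin d → ℝ) → ℂ} (hκ : MemLp κ 2 volume)
    {s v : L2R d} (hint : Integrable fun p : (Fin d → ℝ) × (Fin d → ℝ) =>
      κ p * (star (v p.1) * s p.2)) :
    inner ℂ v (hsOp κ (fourierL2 d s)) = ∫ p, κ p * (star (v p.1) * s p.2) := by
  rw [hsOp_apply, LinearIsometryEquiv.symm_apply_apply,
    inner_integralOperator (μ := volume) (ν := volume) hκ, Measure.volume_eq_prod,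
    integral_prod _ hint]
  simp only [← integral_const_mul, mul_left_comm]

theorem IsFourierTransformAt.eq_hsOp {f : NilGroup β → ℂ} (hf : Integrable f) {l : Fin r → ℝ}
    {κ : (Fin d → ℝ) × (Fin d → ℝ) → ℂ} (hκ : MemLp κ 2 volume)
    (hκf : κ =ᵐ[volume] fun p => ∫ g, repKernel g (l, p) * f g) {S : L2R d →L[ℂ] L2R d}
    (hS : IsFourierTransformAt f l S) : S = hsOp κ := by
  have hdense : Dense ((fourierL2 d) '' {s : L2R d | Integrable s}) :=
    (fourierL2 d).surjective.denseRange.dense_image (fourierL2 d).continuous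
      (dense_setOf_integrable ENNReal.ofNat_ne_top)
  have hbound : ∀ᵐ p : (Fin d → ℝ) × (Fin d → ℝ), ‖κ p‖ ≤ ∫ g, ‖f g‖ := by
    filter_upwards [hκf] with p hp
    rw [hp]
    refine (norm_integral_le_integral_norm _).trans_eq ?_
    simp only [norm_mul, norm_repKernel, one_mul]
  refine ContinuousLinearMap.ext fun u => hdense.induction (P := fun u => S u = hsOp κ u) ?_
    (isClosed_eq S.continuous (hsOp κ).continuous) u
  rintro _ ⟨s, hs : Integrable s volume, rfl⟩
  refine Dense.eq_of_inner_right (𝕜 := ℂ) (dense_setOf_integrable ENNReal.ofNat_ne_top)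
    fun v (hv : Integrable v volume) => ?_
  calc inner ℂ v (S (fourierL2 d s))
      = ∫ g, f g * inner ℂ v (rep l g (fourierL2 d s)) := by
        rw [hS, ← innerSL_apply_apply (𝕜 := ℂ),
          ← (innerSL ℂ v).integral_comp_comm (integrable_smul_rep hf l _)]
        simp only [innerSL_apply_apply, inner_smul_right]
    _ = ∫ p : (Fin d → ℝ) × (Fin d → ℝ), κ p * (star (v p.1) * s p.2) := by
        rw [integral_mul_inner_rep_fourierL2 hf l hs hv]
        refine integral_congr_ae ?_
        filter_upwards [hκf] with p hp
        rw [hp]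
    _ = inner ℂ v (hsOp κ (fourierL2 d s)) :=
        (inner_hsOp_fourierL2 hκ ((integrable_star_mul hv hs).bdd_mul hκ.1 hbound)).symm

/-! ### The Plancherel transform in terms of kernels -/

/-- The Plancherel transform of `f`, as the field of the operators whose kernels are given by
`kernelTransform`. -/
def plancherelField (hβ : IsAdmissibleBasis β) (f : L2N β) (l : Fin r → ℝ) : L2R d →L[ℂ] L2R d :=
  hsOp fun p => kernelTransform hβ f (l, p)

theorem isMeasurableField_plancherelField (hβ : IsAdmissibleBasis β) (f : L2N β) :
    IsMeasurableField (plancherelField hβ f) :=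
  isMeasurableField_hsOp (Lp.stronglyMeasurable (kernelTransform hβ f)).measurable

theorem ae_memLp_kernelTransform (hβ : IsAdmissibleBasis β) (f : L2N β) :
    ∀ᵐ l ∂(plancherelMeasure β), MemLp (fun p => kernelTransform hβ f (l, p)) 2 volume :=
  memLp_two_slice (Lp.memLp (kernelTransform hβ f))

theorem ae_forall_isFourierTransformAt_eq (hβ : IsAdmissibleBasis β) (f : L2N β)
    (hf : Integrable f) : ∀ᵐ l ∂(plancherelMeasure β),
      ∀ S, IsFourierTransformAt f l S → S = plancherelField hβ f l := by
  filter_upwards [ae_memLp_kernelTransform hβ f,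
    Measure.ae_ae_of_ae_prod (coeFn_kernelTransform hβ f hf)] with l hmem hker S hS
  exact hS.eq_hsOp hf hmem hker

theorem lintegral_hsNormSq_plancherelField_sub (hβ : IsAdmissibleBasis β) (f f' : L2N β) :
    ∫⁻ l, hsNormSq (plancherelField hβ f l - plancherelField hβ f' l) ∂(plancherelMeasure β) =
      ‖f - f'‖ₑ ^ 2 := by
  have hsub := Lp.coeFn_sub (kernelTransform hβ f) (kernelTransform hβ f')
  rw [← map_sub] at hsub
  rw [← (kernelTransform hβ).enorm_map, enorm_sq_eq_lintegral,
    lintegral_enorm_sq_prod (Lp.aestronglyMeasurable (kernelTransform hβ (f - f')))]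
  refine lintegral_congr_ae ?_
  filter_upwards [ae_memLp_kernelTransform hβ f, ae_memLp_kernelTransform hβ f',
    Measure.ae_ae_of_ae_prod hsub] with l hmem hmem' hsub
  rw [plancherelField, plancherelField, ← hsOp_sub hmem hmem', hsNormSq_hsOp (hmem.sub hmem')]
  refine lintegral_congr_ae ?_
  filter_upwards [hsub] with p hp
  rw [hp]
  rfl

theorem tendsto_enorm_sub_sq {E : Type*} [SeminormedAddCommGroup E] {f : ℕ → E} {a : E}
    (h : Tendsto f atTop (𝓝 a)) : Tendsto (fun k => ‖f k - a‖ₑ ^ 2) atTop (𝓝 0) := by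
  simpa [edist_eq_enorm_sub] using
    ENNReal.Tendsto.pow (n := 2) (tendsto_iff_edist_tendsto_0.1 h)

theorem isPlancherelTransform_plancherelField (hβ : IsAdmissibleBasis β) (f : L2N β) :
    IsPlancherelTransform f (plancherelField hβ f) := by
  obtain ⟨f', hf', hlim⟩ :=
    mem_closure_iff_seq_limit.1 (dense_setOf_integrable ENNReal.ofNat_ne_top f)
  choose S hS using fun k l => exists_isFourierTransformAt (hf' k) l
  refine ⟨isMeasurableField_plancherelField hβ f, f', S, hf', hlim, hS, ?_⟩
  refine (tendsto_congr fun k => ?_).2 (tendsto_enorm_sub_sq hlim)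
  rw [← lintegral_hsNormSq_plancherelField_sub hβ]
  refine lintegral_congr_ae ?_
  filter_upwards [ae_forall_isFourierTransformAt_eq hβ (f' k) (hf' k)] with l hl
  rw [hl _ (hS k l)]

theorem IsPlancherelTransform.ae_eq (hβ : IsAdmissibleBasis β) {f : L2N β}
    {T : (Fin r → ℝ) → L2R d →L[ℂ] L2R d} (hT : IsPlancherelTransform f T) :
    ∀ᵐ l ∂(plancherelMeasure β), T l = plancherelField hβ f l := by
  obtain ⟨hTm, f', S, hf', hlim, hS, hTlim⟩ := hT
  have hle : ∀ k, ∫⁻ l, hsNormSq (T l - plancherelField hβ f l) ∂(plancherelMeasure β) ≤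
      2 * ∫⁻ l, hsNormSq (S k l - T l) ∂(plancherelMeasure β) + 2 * ‖f' k - f‖ₑ ^ 2 := fun k => by
    have hmeas := ((isMeasurableField_plancherelField hβ (f' k)).sub
      (isMeasurableField_plancherelField hβ f)).measurable_hsNormSq
    rw [← lintegral_hsNormSq_plancherelField_sub hβ,
      ← lintegral_const_mul' _ _ ENNReal.ofNat_ne_top,
      ← lintegral_const_mul' _ _ ENNReal.ofNat_ne_top, ← lintegral_add_right _ (hmeas.const_mul 2)]
    refine lintegral_mono_ae ?_
    filter_upwards [ae_forall_isFourierTransformAt_eq hβ (f' k) (hf' k)] with l hl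
    rw [← hl _ (hS k l), ← hsNormSq_neg (S k l - T l)]
    exact (congrArg hsNormSq (by abel)).trans_le (hsNormSq_add_le _ _)
  have hlim0 : Tendsto (fun k => 2 * ∫⁻ l, hsNormSq (S k l - T l) ∂(plancherelMeasure β) +
      2 * ‖f' k - f‖ₑ ^ 2) atTop (𝓝 0) := by
    simpa using (ENNReal.Tendsto.const_mul (a := 2) hTlim (Or.inr ENNReal.ofNat_ne_top)).add
      (ENNReal.Tendsto.const_mul (tendsto_enorm_sub_sq hlim) (Or.inr ENNReal.ofNat_ne_top))
  have hzero : ∫⁻ l, hsNormSq (T l - plancherelField hβ f l) ∂(plancherelMeasure β) = 0 :=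
    le_antisymm (ge_of_tendsto' hlim0 hle) zero_le
  filter_upwards [(lintegral_eq_zero_iff
    (hTm.sub (isMeasurableField_plancherelField hβ f)).measurable_hsNormSq).1 hzero] with l hl
  exact sub_eq_zero.1 (eq_zero_of_hsNormSq_eq_zero hl)

theorem exists_isPlancherelTransform_iff (hβ : IsAdmissibleBasis β) (f : L2N β)
    (P : (Fin r → ℝ) → L2R d →L[ℂ] L2R d) :
    (∃ T, IsPlancherelTransform f T ∧ ∀ᵐ l ∂(plancherelMeasure β), T l ∘L P l = T l) ↔
      ∀ᵐ l ∂(plancherelMeasure β), plancherelField hβ f l ∘L P l = plancherelField hβ f l := by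
  refine ⟨?_, fun h => ⟨_, isPlancherelTransform_plancherelField hβ f, h⟩⟩
  rintro ⟨T, hT, h⟩
  filter_upwards [h, hT.ae_eq hβ] with l hTP hT
  rw [← hT, hTP]

end Plancherel

section SupportProjection

/-! ### The right support projection of an operator -/

open ContinuousLinearMap TopologicalSpace

section RCLike

variable {𝕜 E F : Type*} [RCLike 𝕜] [NormedAddCommGroup E] [InnerProductSpace 𝕜 E]
  [CompleteSpace E] [NormedAddCommGroup F] [InnerProductSpace 𝕜 F]

theorem inner_apply_of_isStarProjection {P : E →L[𝕜] E} (hP : IsStarProjection P) (u v : E) :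
    inner 𝕜 (P u) (P v) = inner 𝕜 u (P v) := by
  have hadj : adjoint P = P := hP.isSelfAdjoint
  have hidem : P (P v) = P v := DFunLike.congr_fun hP.isIdempotentElem.eq v
  nth_rewrite 1 [← hadj]
  rw [adjoint_inner_left, hidem]

/-- The right support projection of `T`: the orthogonal projection onto `(ker T)ᗮ`, which is the
smallest projection `P` with `T P = T`. -/
def supportProj (T : E →L[𝕜] F) : E →L[𝕜] E := (T.ker)ᗮ.starProjection

theorem isStarProjection_supportProj (T : E →L[𝕜] F) : IsStarProjection (supportProj T) :=
  isStarProjection_starProjection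

theorem comp_supportProj (T : E →L[𝕜] F) : T ∘L supportProj T = T := by
  have : CompleteSpace T.ker := T.isClosed_ker.completeSpace_coe
  ext1 u
  have hker : u - supportProj T u ∈ T.ker := by
    rw [← Submodule.orthogonal_orthogonal T.ker]
    exact Submodule.sub_starProjection_mem_orthogonal u
  exact (sub_eq_zero.1 ((map_sub T _ _).symm.trans hker)).symm

theorem supportProj_apply_eq_zero {T : E →L[𝕜] F} {u : E} (hu : T u = 0) : supportProj T u = 0 :=
  (Submodule.starProjection_apply_eq_zero_iff _).2
    (Submodule.le_orthogonal_orthogonal _ (show u ∈ T.ker from hu))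

omit [CompleteSpace E] in
theorem norm_sub_starProjection_eq_infDist (U : Submodule 𝕜 E) [U.HasOrthogonalProjection]
    (v : E) : ‖v - U.starProjection v‖ = Metric.infDist v U := by
  simp only [Submodule.starProjection_minimal, Metric.infDist_eq_iInf, dist_eq_norm]
  rfl

theorem norm_sub_supportProj_eq_infDist [CompleteSpace F] [SeparableSpace F] (T : E →L[𝕜] F)
    (v : E) : ‖v - supportProj T v‖ =
      Metric.infDist v (Set.range fun i => adjoint T (denseSeq F i)) := by
  have hdense : closure (Set.range fun i => adjoint T (denseSeq F i)) = ((T.ker)ᗮ : Set E) := by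
    rw [orthogonal_ker, Submodule.topologicalClosure_coe]
    change closure (Set.range (adjoint T ∘ denseSeq F)) = closure (Set.range (adjoint T))
    rw [Set.range_comp, ← closure_image_closure (adjoint T).continuous,
      (denseRange_denseSeq F).closure_range, Set.image_univ]
  rw [supportProj, norm_sub_starProjection_eq_infDist, ← hdense, Metric.infDist_closure]

theorem norm_supportProj_sq (T : E →L[𝕜] F) (v : E) :
    ‖supportProj T v‖ ^ 2 = ‖v‖ ^ 2 - ‖v - supportProj T v‖ ^ 2 := by
  rw [Submodule.norm_sq_eq_add_norm_sq_starProjection v (T.ker)ᗮ,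
    Submodule.starProjection_orthogonal' (T.ker)ᗮ]
  exact (add_sub_cancel_right _ _).symm

end RCLike

variable {r d : ℕ} {T : (Fin r → ℝ) → L2R d →L[ℂ] L2R d}

theorem IsMeasurableField.stronglyMeasurable_adjoint (hT : IsMeasurableField T) (u : L2R d) :
    StronglyMeasurable fun l => adjoint (T l) u := by
  refine stronglyMeasurable_of_inner (𝕜 := ℂ) fun v => ?_
  have hstar : ∀ l, inner ℂ v (adjoint (T l) u) = star (inner ℂ u (T l v)) := fun l => by
    rw [adjoint_inner_right]
    exact (inner_conj_symm _ _).symm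
  simp only [hstar]
  exact continuous_star.measurable.comp (hT u v)

theorem IsMeasurableField.measurable_norm_supportProj_sq (hT : IsMeasurableField T) (v : L2R d) :
    Measurable fun l => ‖supportProj (T l) v‖ ^ 2 := by
  have hdist : Measurable fun l => ‖v - supportProj (T l) v‖ := by
    simp only [norm_sub_supportProj_eq_infDist, Metric.infDist, Metric.infEDist, iInf_range,
      edist_eq_enorm_sub]
    exact (Measurable.iInf fun i =>
      (stronglyMeasurable_const.sub (hT.stronglyMeasurable_adjoint _)).enorm).ennreal_toReal
  simp only [norm_supportProj_sq]
  exact measurable_const.sub (hdist.pow_const 2)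

theorem IsMeasurableField.supportProj (hT : IsMeasurableField T) :
    IsMeasurableField fun l => supportProj (T l) := fun u v => by
  have hpolar : ∀ l, inner ℂ u (NilpotentFrames.supportProj (T l) v) = _ := fun l =>
    (inner_apply_of_isStarProjection (isStarProjection_supportProj (T l)) u v).symm.trans
      (inner_eq_sum_norm_sq_div_four _ _)
  have hnorm : ∀ w, Measurable fun l => ((‖NilpotentFrames.supportProj (T l) w‖ : ℝ) : ℂ) ^ 2 :=
    fun w => by exact_mod_cast
      Complex.measurable_ofReal.comp (hT.measurable_norm_supportProj_sq w)
  simp only [hpolar, ← map_add, ← map_sub, ← map_smul]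
  fun_prop

end SupportProjection

section FieldSpace

variable {r d : ℕ} {𝔫 : Type*} [LieRing 𝔫] [LieAlgebra ℝ 𝔫]
  {β : Module.Basis (Fin r ⊕ Fin d ⊕ Fin d) ℝ 𝔫}

/-! ### Algebra of the Plancherel transform -/

theorem ae_plancherelField_sub (hβ : IsAdmissibleBasis β) (f f' : L2N β) :
    ∀ᵐ l ∂(plancherelMeasure β),
      plancherelField hβ (f - f') l = plancherelField hβ f l - plancherelField hβ f' l := by
  have hsub := Lp.coeFn_sub (kernelTransform hβ f) (kernelTransform hβ f')
  rw [← map_sub] at hsub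
  filter_upwards [ae_memLp_kernelTransform hβ f, ae_memLp_kernelTransform hβ f',
    Measure.ae_ae_of_ae_prod hsub] with l hmem hmem' hl
  rw [plancherelField, plancherelField, plancherelField, ← hsOp_sub hmem hmem']
  exact hsOp_congr hl

theorem hsOp_smul {κ : (Fin d → ℝ) × (Fin d → ℝ) → ℂ} (hκ : MemLp κ 2 volume) (c : ℂ) :
    hsOp (c • κ) = c • hsOp κ := by
  refine ContinuousLinearMap.ext fun u => Lp.ext ?_
  filter_upwards [coeFn_hsOp hκ u, coeFn_hsOp (hκ.const_smul c) u, Lp.coeFn_smul c (hsOp κ u)]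
    with t hκ hcκ hsmul
  rw [hcκ, smul_apply, hsmul, Pi.smul_apply, hκ, ← integral_smul]
  simp only [Pi.smul_apply, smul_eq_mul, mul_assoc]

theorem ae_plancherelField_smul (hβ : IsAdmissibleBasis β) (c : ℂ) (f : L2N β) :
    ∀ᵐ l ∂(plancherelMeasure β), plancherelField hβ (c • f) l = c • plancherelField hβ f l := by
  have hsmul := Lp.coeFn_smul c (kernelTransform hβ f)
  rw [← map_smul] at hsmul
  filter_upwards [ae_memLp_kernelTransform hβ f, Measure.ae_ae_of_ae_prod hsmul] with l hmem hl
  rw [plancherelField, plancherelField, ← hsOp_smul hmem]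
  exact hsOp_congr hl

theorem lintegral_hsNormSq_plancherelField (hβ : IsAdmissibleBasis β) (f : L2N β) :
    ∫⁻ l, hsNormSq (plancherelField hβ f l) ∂(plancherelMeasure β) = ‖f‖ₑ ^ 2 := by
  rw [← sub_zero f, ← lintegral_hsNormSq_plancherelField_sub hβ f 0]
  refine lintegral_congr_ae ?_
  filter_upwards [ae_plancherelField_sub hβ f 0] with l hl
  rw [hl]

theorem ae_enorm_plancherelField_sq_le (hβ : IsAdmissibleBasis β) (f : L2N β) :
    ∀ᵐ l ∂(plancherelMeasure β), ∀ u,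
      ‖plancherelField hβ f l u‖ₑ ^ 2 ≤ hsNormSq (plancherelField hβ f l) * ‖u‖ₑ ^ 2 := by
  filter_upwards [ae_memLp_kernelTransform hβ f] with l hl u
  rw [plancherelField, hsNormSq_hsOp hl]
  exact enorm_hsOp_sq_le hl u

theorem ae_plancherelField_leftRegular (hβ : IsAdmissibleBasis β) (g : NilGroup β) (f : L2N β) :
    ∀ᵐ l ∂(plancherelMeasure β), ∀ u,
      plancherelField hβ (leftRegular g f) l u = rep l g (plancherelField hβ f l u) := by
  have hrep := coeFn_repOnKernels g (kernelTransform hβ f)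
  rw [← kernelTransform_leftRegular] at hrep
  filter_upwards [ae_memLp_kernelTransform hβ f, ae_memLp_kernelTransform hβ (leftRegular g f),
    Measure.ae_ae_of_ae_prod hrep] with l hmem hmem' hrep u
  refine Lp.ext ?_
  filter_upwards [coeFn_hsOp hmem' u, coeFn_rep l g (plancherelField hβ f l u),
    (measurePreserving_sub_right volume g.x).quasiMeasurePreserving.ae (coeFn_hsOp hmem u),
    Measure.ae_ae_of_ae_prod hrep] with t hleft hright hshift hker
  rw [plancherelField, hleft, hright, plancherelField, hshift, ← integral_const_mul]
  refine integral_congr_ae ?_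
  filter_upwards [hker] with s hs
  rw [hs]
  simp only [translateKernel]
  ring

/-! ### The space attached to a field of projections -/

/-- The space of all `f ∈ L²(N)` whose Plancherel transform `T` satisfies `T P = T`. -/
def fieldSpace (hβ : IsAdmissibleBasis β) (P : (Fin r → ℝ) → L2R d →L[ℂ] L2R d) :
    Submodule ℂ (L2N β) where
  carrier :=
    {f | ∀ᵐ l ∂(plancherelMeasure β), plancherelField hβ f l ∘L P l = plancherelField hβ f l}
  add_mem' := fun {f f'} hf hf' => by
    have hadd : f + f' = f - (-1 : ℂ) • f' := by rw [neg_one_smul, sub_neg_eq_add]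
    filter_upwards [hf, hf', ae_plancherelField_sub hβ f ((-1 : ℂ) • f'),
      ae_plancherelField_smul hβ (-1) f'] with l hl hl' hsub hsmul
    rw [hadd, hsub, hsmul, ContinuousLinearMap.sub_comp, ContinuousLinearMap.smul_comp, hl, hl']
  zero_mem' := by
    filter_upwards [ae_plancherelField_sub hβ 0 0] with l hsub
    rw [← sub_self (0 : L2N β), hsub, sub_self, ContinuousLinearMap.zero_comp]
  smul_mem' := fun c f hf => by
    filter_upwards [hf, ae_plancherelField_smul hβ c f] with l hl hsmul
    rw [hsmul, ContinuousLinearMap.smul_comp, hl]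

variable {P : (Fin r → ℝ) → L2R d →L[ℂ] L2R d}

theorem mem_fieldSpace {hβ : IsAdmissibleBasis β} {f : L2N β} : f ∈ fieldSpace hβ P ↔
    ∀ᵐ l ∂(plancherelMeasure β), plancherelField hβ f l ∘L P l = plancherelField hβ f l :=
  Iff.rfl

theorem ae_iInf_hsNormSq_plancherelField_sub_eq_zero (hβ : IsAdmissibleBasis β) {f : L2N β}
    {f' : ℕ → L2N β} (hlim : Tendsto f' atTop (𝓝 f)) :
    ∀ᵐ l ∂(plancherelMeasure β),
      ⨅ k, hsNormSq (plancherelField hβ (f' k) l - plancherelField hβ f l) = 0 := by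
  have hm : ∀ k, Measurable fun l =>
      hsNormSq (plancherelField hβ (f' k) l - plancherelField hβ f l) := fun k =>
    ((isMeasurableField_plancherelField hβ _).sub
      (isMeasurableField_plancherelField hβ f)).measurable_hsNormSq
  refine (lintegral_eq_zero_iff (Measurable.iInf hm)).1 (le_antisymm ?_ zero_le)
  refine ge_of_tendsto' (tendsto_enorm_sub_sq hlim) fun k => ?_
  rw [← lintegral_hsNormSq_plancherelField_sub hβ]
  exact lintegral_mono fun l => iInf_le _ k

theorem isClosed_fieldSpace (hβ : IsAdmissibleBasis β) :
    IsClosed (fieldSpace hβ P : Set (L2N β)) := by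
  refine isClosed_of_closure_subset fun f hf => ?_
  obtain ⟨f', hf', hlim⟩ := mem_closure_iff_seq_limit.1 hf
  filter_upwards [ae_iInf_hsNormSq_plancherelField_sub_eq_zero hβ hlim, ae_all_iff.2 hf',
    ae_all_iff.2 fun k => ae_plancherelField_sub hβ (f' k) f,
    ae_all_iff.2 fun k => ae_enorm_plancherelField_sq_le hβ (f' k - f)] with l hinf hf' hsub hle
  ext1 w
  have hbound : ∀ k, ‖plancherelField hβ f l (P l w - w)‖ₑ ^ 2 ≤
      hsNormSq (plancherelField hβ (f' k) l - plancherelField hβ f l) * ‖P l w - w‖ₑ ^ 2 :=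
    fun k => by
      have hzero : plancherelField hβ (f' k) l (P l w - w) = 0 := by
        rw [map_sub, sub_eq_zero, ← ContinuousLinearMap.comp_apply, hf' k]
      have hle := hle k (P l w - w)
      rwa [hsub k, sub_apply, hzero, zero_sub, enorm_neg] at hle
  have hzero : ‖plancherelField hβ f l (P l w - w)‖ₑ ^ 2 ≤ 0 := by
    refine (le_iInf hbound).trans_eq ?_
    rw [← ENNReal.iInf_mul' (fun h => absurd h (by simp)) fun _ => inferInstance, hinf, zero_mul]
  have hzero : plancherelField hβ f l (P l w - w) = 0 := by simpa using hzero
  rwa [map_sub, sub_eq_zero] at hzero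

theorem leftRegular_mem_fieldSpace {hβ : IsAdmissibleBasis β} {f : L2N β}
    (hf : f ∈ fieldSpace hβ P) (g : NilGroup β) : leftRegular g f ∈ fieldSpace hβ P := by
  filter_upwards [mem_fieldSpace.1 hf, ae_plancherelField_leftRegular hβ g f] with l hl hrep
  ext1 u
  rw [ContinuousLinearMap.comp_apply, hrep, hrep, ← ContinuousLinearMap.comp_apply, hl]

theorem mem_fieldSpace_supportProj (hβ : IsAdmissibleBasis β) (f : L2N β) :
    f ∈ fieldSpace hβ fun l => supportProj (plancherelField hβ f l) :=
  ae_of_all _ fun _ => comp_supportProj _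

theorem isProjectionField_iff (hβ : IsAdmissibleBasis β) {K : Submodule ℂ (L2N β)} :
    IsProjectionField K P ↔ (∀ l, IsStarProjection (P l)) ∧ IsMeasurableField P ∧
      K = fieldSpace hβ P := by
  refine ⟨fun h => ⟨h.1, h.2, ?_⟩, fun h => ⟨h.1, h.2.1, fun f => ?_⟩⟩
  · ext f
    rw [h.3, exists_isPlancherelTransform_iff hβ, mem_fieldSpace]
  · rw [exists_isPlancherelTransform_iff hβ, h.2.2, mem_fieldSpace]

end FieldSpace

section Correlation

variable {r d : ℕ} {𝔫 : Type*} [LieRing 𝔫] [LieAlgebra ℝ 𝔫]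
  {β : Module.Basis (Fin r ⊕ Fin d ⊕ Fin d) ℝ 𝔫}

/-! ### Matrix coefficients of the left regular representation -/

/-- The partial inner product of the kernels of `L(exp x) φ` and `f`. As a function of the central
and `Y`-coordinates of `g`, with `x` fixed, the matrix coefficient `⟪L(g) φ, f⟫` is the Fourier
transform of the correlation in orbit coordinates. -/
def correlation (hβ : IsAdmissibleBasis β) (φ f : L2N β) (x : Fin d → ℝ)
    (p : (Fin r → ℝ) × (Fin d → ℝ)) : ℂ :=
  ∫ σ, star (kernelTransform hβ φ (p.1, (p.2 - x, σ))) * kernelTransform hβ f (p.1, (p.2, σ))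

theorem stronglyMeasurable_correlation (hβ : IsAdmissibleBasis β) (φ f : L2N β) :
    StronglyMeasurable fun w : (Fin d → ℝ) × ((Fin r → ℝ) × (Fin d → ℝ)) =>
      correlation hβ φ f w.1 w.2 := by
  refine StronglyMeasurable.integral_prod_right (f := fun
    (w : (Fin d → ℝ) × ((Fin r → ℝ) × (Fin d → ℝ))) (σ : Fin d → ℝ) =>
      star (kernelTransform hβ φ (w.2.1, (w.2.2 - w.1, σ))) *
        kernelTransform hβ f (w.2.1, (w.2.2, σ))) (Measurable.stronglyMeasurable ?_)
  exact (continuous_star.measurable.comp ((Lp.stronglyMeasurable _).measurable.comp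
    (by fun_prop : Measurable fun w : ((Fin d → ℝ) × ((Fin r → ℝ) × (Fin d → ℝ))) × (Fin d → ℝ) =>
      (w.1.2.1, (w.1.2.2 - w.1.1, w.2))))).mul
        ((Lp.stronglyMeasurable _).measurable.comp (by fun_prop))

theorem integrable_correlation_integrand (hβ : IsAdmissibleBasis β) (φ f : L2N β)
    (x : Fin d → ℝ) : Integrable (fun p => star (kernelTransform hβ φ (translateKernel x p)) *
      kernelTransform hβ f p) (fieldMeasure β) :=
  ((Lp.memLp (kernelTransform hβ φ)).comp_measurePreserving
    (measurePreserving_translateKernel x)).star.integrable_mul (Lp.memLp (kernelTransform hβ f))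

theorem integrable_correlation (hβ : IsAdmissibleBasis β) (φ f : L2N β) (x : Fin d → ℝ) :
    Integrable (correlation hβ φ f x) ((plancherelMeasure β).prod volume) :=
  ((measurePreserving_prodAssoc (plancherelMeasure β) (volume : Measure (Fin d → ℝ))
    (volume : Measure (Fin d → ℝ))).integrable_comp_of_integrable
      (integrable_correlation_integrand hβ φ f x)).integral_prod_left

theorem inner_leftRegular_eq_integral (hβ : IsAdmissibleBasis β) (φ f : L2N β) (g : NilGroup β) :
    inner ℂ (leftRegular g φ) f = ∫ p, star (repPhase g p.1 p.2) * correlation hβ φ f g.x p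
      ∂((plancherelMeasure β).prod volume) := by
  have hphase : Measurable fun p : (Fin r → ℝ) × ((Fin d → ℝ) × (Fin d → ℝ)) =>
      star (repPhase g p.1 p.2.1) :=
    continuous_star.measurable.comp
      (measurable_repPhase measurable_const measurable_fst measurable_snd.fst)
  have hint := (integrable_correlation_integrand hβ φ f g.x).bdd_mul (c := 1)
    hphase.aestronglyMeasurable (ae_of_all _ fun p => by rw [norm_star, norm_repPhase])
  have hassoc := measurePreserving_prodAssoc (plancherelMeasure β) (volume : Measure (Fin d → ℝ))
    (volume : Measure (Fin d → ℝ))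
  rw [← (kernelTransform hβ).inner_map_map, kernelTransform_leftRegular, inner_eq_integral]
  calc _ = ∫ p, star (repPhase g p.1 p.2.1) * (star (kernelTransform hβ φ (translateKernel g.x p)) *
        kernelTransform hβ f p) ∂(fieldMeasure β) := by
        refine integral_congr_ae ?_
        filter_upwards [coeFn_repOnKernels g (kernelTransform hβ φ)] with p hp
        rw [hp, star_mul', mul_assoc]
    _ = ∫ p : (Fin r → ℝ) × (Fin d → ℝ), (∫ σ : Fin d → ℝ, star (repPhase g p.1 p.2) *
          (star (kernelTransform hβ φ (p.1, (p.2 - g.x, σ))) *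
            kernelTransform hβ f (p.1, (p.2, σ)))) ∂((plancherelMeasure β).prod volume) :=
        (hassoc.integral_comp MeasurableEquiv.prodAssoc.measurableEmbedding _).symm.trans
          (integral_prod _ (hassoc.integrable_comp_of_integrable hint))
    _ = _ := integral_congr_ae (ae_of_all _ fun p => integral_const_mul _ _)

/-! ### Uniqueness of Fourier coefficients -/

/-- `ℝ^r × ℝ^d` as a Euclidean space. -/
def prodEuclideanEquiv (r d : ℕ) : (Fin r → ℝ) × (Fin d → ℝ) ≃ᵐ
    WithLp 2 (EuclideanSpace ℝ (Fin r) × EuclideanSpace ℝ (Fin d)) :=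
  (MeasurableEquiv.prodCongr (MeasurableEquiv.toLp 2 (Fin r → ℝ))
    (MeasurableEquiv.toLp 2 (Fin d → ℝ))).trans (MeasurableEquiv.toLp 2 _)

theorem measurePreserving_prodEuclideanEquiv : MeasurePreserving (prodEuclideanEquiv r d) := by
  have h : ∀ n, MeasurePreserving (MeasurableEquiv.toLp 2 (Fin n → ℝ)) := fun n =>
    (EuclideanSpace.volume_preserving_symm_measurableEquiv_toLp (Fin n)).symm
  exact (WithLp.volume_preserving_toLp _ _).comp ((h r).prod (h d))

theorem inner_prodEuclideanEquiv (p p' : (Fin r → ℝ) × (Fin d → ℝ)) :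
    inner ℝ (prodEuclideanEquiv r d p) (prodEuclideanEquiv r d p') =
      p.1 ⬝ᵥ p'.1 + p.2 ⬝ᵥ p'.2 := by
  change p'.1 ⬝ᵥ star p.1 + p'.2 ⬝ᵥ star p.2 = _
  simp only [star_trivial, dotProduct_comm]

theorem star_repPhase (z : Fin r → ℝ) (y x : Fin d → ℝ) (p : (Fin r → ℝ) × (Fin d → ℝ)) :
    star (repPhase (NilGroup.mk z y x : NilGroup β) p.1 p.2) =
      Complex.exp (-2 * Real.pi * Complex.I * (((orbitMap β p).1 ⬝ᵥ (-z) +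
        (orbitMap β p).2 ⬝ᵥ (-y) : ℝ) : ℂ)) := by
  have hfreq : (orbitMap β p).1 ⬝ᵥ (-z) + (orbitMap β p).2 ⬝ᵥ (-y) =
      p.1 ⬝ᵥ z + p.2 ⬝ᵥ (matB β p.1 *ᵥ y) := by
    rw [orbitMap, neg_dotProduct_neg, neg_dotProduct_neg, Matrix.mulVec_transpose,
      Matrix.dotProduct_mulVec]
  rw [hfreq, repPhase, RCLike.star_def, ← Complex.exp_conj]
  congr 1
  simp only [map_mul, Complex.conj_ofReal, Complex.conj_I, map_ofNat]
  change 2 * Real.pi * -Complex.I * ((p.1 ⬝ᵥ z + p.2 ⬝ᵥ (matB β p.1 *ᵥ y) : ℝ) : ℂ) = _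
  ring

theorem setIntegral_star_repPhase_mul (hβ : IsAdmissibleBasis β)
    {G : (Fin r → ℝ) × (Fin d → ℝ) → ℂ}
    (hG : AEStronglyMeasurable G ((plancherelMeasure β).prod volume))
    {S : Set ((Fin r → ℝ) × (Fin d → ℝ))} (hS : MeasurableSet S) (z : Fin r → ℝ)
    (y x : Fin d → ℝ) :
    ∫ p in orbitMap β ⁻¹' S, star (repPhase (NilGroup.mk z y x : NilGroup β) p.1 p.2) * G p
      ∂((plancherelMeasure β).prod volume) =
    ∫ ξ in S, Complex.exp (-2 * Real.pi * Complex.I *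
      ((ξ.1 ⬝ᵥ (-z) + ξ.2 ⬝ᵥ (-y) : ℝ) : ℂ)) * G (orbitMapInv β ξ) := by
  have hphase : Measurable fun ξ : (Fin r → ℝ) × (Fin d → ℝ) => Complex.exp (-2 * Real.pi *
      Complex.I * ((ξ.1 ⬝ᵥ (-z) + ξ.2 ⬝ᵥ (-y) : ℝ) : ℂ)) := by
    have hz := measurable_dotProduct (measurable_fst (α := Fin r → ℝ) (β := Fin d → ℝ))
      (measurable_const (a := -z))
    have hy := measurable_dotProduct (measurable_snd (α := Fin r → ℝ) (β := Fin d → ℝ))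
      (measurable_const (a := -y))
    fun_prop
  have hrestrict := hβ.measurePreserving_orbitMap.restrict_preimage hS
  rw [← hrestrict.map_eq, integral_map hrestrict.measurable.aemeasurable]
  · refine integral_congr_ae ?_
    filter_upwards [ae_restrict_of_ae hβ.ae_orbitMapInv_orbitMap] with p hp
    rw [star_repPhase, hp]
  · rw [hrestrict.map_eq]
    exact hphase.aestronglyMeasurable.fun_mul
      (hG.comp_measurePreserving hβ.measurePreserving_orbitMapInv).restrict

theorem ae_eq_zero_of_integral_repPhase (hβ : IsAdmissibleBasis β)
    {G : (Fin r → ℝ) × (Fin d → ℝ) → ℂ} (hG : Integrable G ((plancherelMeasure β).prod volume))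
    {x : Fin d → ℝ} (h : ∀ z y, ∫ p, star (repPhase (NilGroup.mk z y x : NilGroup β) p.1 p.2) * G p
      ∂((plancherelMeasure β).prod volume) = 0) :
    G =ᵐ[(plancherelMeasure β).prod volume] 0 := by
  have hzero : (fun ξ => G (orbitMapInv β ξ)) =ᵐ[volume] 0 := by
    refine ae_eq_zero_of_integral_exp_eq_zero (prodEuclideanEquiv r d)
      measurePreserving_prodEuclideanEquiv
      (hβ.measurePreserving_orbitMapInv.integrable_comp_of_integrable hG) fun η => ?_
    have hη := setIntegral_star_repPhase_mul hβ hG.1 .univ (-η.1) (-η.2) x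
    simpa only [Set.preimage_univ, setIntegral_univ, h, neg_neg, inner_prodEuclideanEquiv,
      smul_eq_mul] using hη.symm
  filter_upwards [hβ.measurePreserving_orbitMap.quasiMeasurePreserving.ae hzero,
    hβ.ae_orbitMapInv_orbitMap] with p hp hinv
  rwa [hinv] at hp

theorem ae_correlation_eq_zero (hβ : IsAdmissibleBasis β) {φ f : L2N β}
    (h : ∀ g : NilGroup β, inner ℂ (leftRegular g φ) f = 0) :
    ∀ᵐ l ∂(plancherelMeasure β), ∀ᵐ t : Fin d → ℝ, ∀ᵐ s : Fin d → ℝ,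
      ∫ σ, star (kernelTransform hβ φ (l, (s, σ))) * kernelTransform hβ f (l, (t, σ)) = 0 := by
  have hfixed : ∀ x, ∀ᵐ p ∂((plancherelMeasure β).prod volume), correlation hβ φ f x p = 0 :=
    fun x => ae_eq_zero_of_integral_repPhase (x := x) hβ (integrable_correlation hβ φ f x)
      fun z y => (inner_leftRegular_eq_integral hβ φ f (NilGroup.mk z y x)).symm.trans (h _)
  have hswap : ∀ᵐ p ∂((plancherelMeasure β).prod (volume : Measure (Fin d → ℝ))),
      ∀ᵐ x : Fin d → ℝ, correlation hβ φ f x p = 0 :=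
    (Measure.ae_ae_comm (p := fun x p => correlation hβ φ f x p = 0)
      ((stronglyMeasurable_correlation hβ φ f).measurable
        (measurableSet_singleton 0))).1 (ae_of_all _ hfixed)
  filter_upwards [Measure.ae_ae_of_ae_prod hswap] with l hl
  filter_upwards [hl] with t ht
  filter_upwards [(quasiMeasurePreserving_sub_left (volume : Measure (Fin d → ℝ)) t).ae ht]
    with s hs
  simpa only [correlation, sub_sub_cancel] using hs

/-! ### Existence of the field of projections -/

theorem hsOp_fourierL2_star_toLp_eq_zero {κ : (Fin d → ℝ) × (Fin d → ℝ) → ℂ}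
    (hκ : MemLp κ 2 volume) {w : (Fin d → ℝ) → ℂ} (hw : MemLp w 2 volume)
    (h : ∀ᵐ s, ∫ σ, star (κ (s, σ)) * w σ = 0) :
    hsOp κ (fourierL2 d (hw.star.toLp (star w))) = 0 := by
  refine Lp.ext ?_
  filter_upwards [h, coeFn_hsOp hκ (fourierL2 d (hw.star.toLp (star w))),
    Lp.coeFn_zero ℂ 2 (volume : Measure (Fin d → ℝ))] with s hs hop hzero
  have hconj : ∫ σ, κ (s, σ) * hw.star.toLp (star w) σ = star (∫ σ, star (κ (s, σ)) * w σ) := by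
    rw [RCLike.star_def, ← integral_conj]
    refine integral_congr_ae ?_
    filter_upwards [hw.star.coeFn_toLp] with σ hσ
    rw [hσ, ← RCLike.star_def, star_mul', star_star, Pi.star_apply]
  rw [hop, hzero, LinearIsometryEquiv.symm_apply_apply, hconj, hs, star_zero, Pi.zero_apply]

theorem hsOp_comp_supportProj_hsOp_eq_zero {κ κ' : (Fin d → ℝ) × (Fin d → ℝ) → ℂ}
    (hκ : MemLp κ 2 volume) (hκ' : MemLp κ' 2 volume)
    (h : ∀ᵐ t, ∀ᵐ s, ∫ σ, star (κ (s, σ)) * κ' (t, σ) = 0) :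
    hsOp κ' ∘L supportProj (hsOp κ) = 0 := by
  refine ContinuousLinearMap.ext fun u => Lp.ext ?_
  filter_upwards [h, coeFn_hsOp hκ' (supportProj (hsOp κ) u), memLp_two_slice hκ',
    Lp.coeFn_zero ℂ 2 (volume : Measure (Fin d → ℝ))] with t ht hop hmem hzero
  have hker := supportProj_apply_eq_zero (hsOp_fourierL2_star_toLp_eq_zero hκ hmem ht)
  rw [ContinuousLinearMap.comp_apply, hop, zero_apply, hzero, integral_mul_eq_inner hmem,
    ← (fourierL2 d).inner_map_map, LinearIsometryEquiv.apply_symm_apply,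
    ← inner_apply_of_isStarProjection (isStarProjection_supportProj _)]
  exact (congrArg (inner ℂ · _) hker).trans (inner_zero_left _)

theorem eq_zero_of_inner_leftRegular_eq_zero (hβ : IsAdmissibleBasis β) {φ f : L2N β}
    (hf : f ∈ fieldSpace hβ fun l => supportProj (plancherelField hβ φ l))
    (h : ∀ g : NilGroup β, inner ℂ (leftRegular g φ) f = 0) : f = 0 := by
  have hzero : ∀ᵐ l ∂(plancherelMeasure β), hsNormSq (plancherelField hβ f l) = 0 := by
    filter_upwards [ae_correlation_eq_zero hβ h, ae_memLp_kernelTransform hβ φ,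
      ae_memLp_kernelTransform hβ f, mem_fieldSpace.1 hf] with l hcorr hφmem hfmem hl
    rw [← hl, plancherelField, plancherelField,
      hsOp_comp_supportProj_hsOp_eq_zero hφmem hfmem hcorr]
    simp [hsNormSq_eq_tsum]
  have hnorm := lintegral_hsNormSq_plancherelField hβ f
  rw [lintegral_congr_ae hzero] at hnorm
  simpa using hnorm.symm

theorem isProjectionField_supportProj (hβ : IsAdmissibleBasis β) {K : Submodule ℂ (L2N β)}
    (hK_closed : IsClosed (K : Set (L2N β)))
    {φ : L2N β} (hφ : ∀ g : NilGroup β, leftRegular g φ ∈ K)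
    (hcyclic : ∀ f ∈ K, (∀ g : NilGroup β, inner ℂ f (leftRegular g φ) = 0) → f = 0) :
    IsProjectionField K fun l => supportProj (plancherelField hβ φ l) := by
  refine (isProjectionField_iff hβ).2 ⟨fun l => isStarProjection_supportProj _,
    (isMeasurableField_plancherelField hβ φ).supportProj, ?_⟩
  set V := fieldSpace hβ fun l => supportProj (plancherelField hβ φ l)
  have hφV : ∀ g, leftRegular g φ ∈ V :=
    leftRegular_mem_fieldSpace (mem_fieldSpace_supportProj hβ φ)
  have hKV_closed : IsClosed ((K ⊓ V : Submodule ℂ (L2N β)) : Set (L2N β)) :=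
    hK_closed.inter (isClosed_fieldSpace hβ)
  have : CompleteSpace (K ⊓ V : Submodule ℂ (L2N β)) := hKV_closed.completeSpace_coe
  have : CompleteSpace K := hK_closed.completeSpace_coe
  have hKV : K ≤ V := fun f hf => by
    obtain ⟨p, hp, e, he, rfl⟩ := (K ⊓ V).exists_add_mem_mem_orthogonal f
    have heK : e ∈ K := (K.add_mem_iff_right hp.1).1 hf
    rw [hcyclic e heK fun g => (Submodule.mem_orthogonal' _ _).1 he _ ⟨hφ g, hφV g⟩, add_zero]
    exact hp.2
  refine le_antisymm hKV fun f hf => ?_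
  obtain ⟨p, hp, e, he, rfl⟩ := K.exists_add_mem_mem_orthogonal f
  have heV : e ∈ V := (V.add_mem_iff_right (hKV hp)).1 hf
  rw [eq_zero_of_inner_leftRegular_eq_zero hβ heV fun g =>
    (Submodule.mem_orthogonal _ _).1 he _ (hφ g), add_zero]
  exact hp

end Correlation

section QuasiLattice

variable {r d : ℕ} {𝔫 : Type*} [LieRing 𝔫] [LieAlgebra ℝ 𝔫]
  {β : Module.Basis (Fin r ⊕ Fin d ⊕ Fin d) ℝ 𝔫}

/-! ### Fourier series in orbit coordinates -/

/-- The set of points that `orbitMap` maps into a given box. -/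
def orbitBox (β : Module.Basis (Fin r ⊕ Fin d ⊕ Fin d) ℝ 𝔫) (c₁ a : Fin r → ℝ)
    (c₂ q : Fin d → ℝ) : Set ((Fin r → ℝ) × (Fin d → ℝ)) :=
  orbitMap β ⁻¹' (box c₁ a ×ˢ box c₂ q)

theorem measurableSet_orbitBox (c₁ a : Fin r → ℝ) (c₂ q : Fin d → ℝ) :
    MeasurableSet (orbitBox β c₁ a c₂ q) :=
  measurable_orbitMap ((measurableSet_box _ _).prod (measurableSet_box _ _))

theorem measure_orbitBox_lt_top (hβ : IsAdmissibleBasis β) (c₁ a : Fin r → ℝ)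
    (c₂ q : Fin d → ℝ) :
    ((plancherelMeasure β).prod volume) (orbitBox β c₁ a c₂ q) < ∞ := by
  rw [orbitBox, hβ.measurePreserving_orbitMap.measure_preimage
    ((measurableSet_box _ _).prod (measurableSet_box _ _)).nullMeasurableSet,
    Measure.volume_eq_prod, Measure.prod_prod, volume_box, volume_box]
  exact ENNReal.mul_lt_top (ENNReal.prod_lt_top fun i _ => ENNReal.ofReal_lt_top)
    (ENNReal.prod_lt_top fun i _ => ENNReal.ofReal_lt_top)

theorem setLIntegral_orbitBox (hβ : IsAdmissibleBasis β) (c₁ a : Fin r → ℝ) (c₂ q : Fin d → ℝ)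
    {F : (Fin r → ℝ) × (Fin d → ℝ) → ℝ≥0∞} (hF : Measurable F) :
    ∫⁻ p in orbitBox β c₁ a c₂ q, F p ∂((plancherelMeasure β).prod volume) =
      ∫⁻ ξ in box c₁ a ×ˢ box c₂ q, F (orbitMapInv β ξ) := by
  rw [← hβ.measurePreserving_orbitMap.setLIntegral_comp_preimage
    ((measurableSet_box c₁ a).prod (measurableSet_box c₂ q))
      (f := fun ξ => F (orbitMapInv β ξ)) (hF.comp measurable_orbitMapInv)]
  refine lintegral_congr_ae ?_
  filter_upwards [ae_restrict_of_ae hβ.ae_orbitMapInv_orbitMap] with p hp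
  rw [hp]

/-- The point of the quasi-lattice with the integral coordinates `w = ((m, k), n)`. -/
def latticePoint (β : Module.Basis (Fin r ⊕ Fin d ⊕ Fin d) ℝ 𝔫) (a : Fin r → ℝ)
    (q b : Fin d → ℝ) (w : ((Fin r → ℤ) × (Fin d → ℤ)) × (Fin d → ℤ)) : NilGroup β :=
  NilGroup.mk (fun i => w.1.1 i / a i) (fun i => w.1.2 i / q i) (fun i => w.2 i / b i)

theorem tsum_enorm_integral_repPhase (hβ : IsAdmissibleBasis β) {a : Fin r → ℝ} {q : Fin d → ℝ}
    (ha : ∀ i, 0 < a i) (hq : ∀ i, 0 < q i) (b : Fin d → ℝ) (n : Fin d → ℤ) (c₁ : Fin r → ℝ)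
    (c₂ : Fin d → ℝ) {H : (Fin r → ℝ) × (Fin d → ℝ) → ℂ} (hH : Measurable H)
    (hH2 : ∫⁻ p in orbitBox β c₁ a c₂ q, ‖H p‖ₑ ^ 2 ∂((plancherelMeasure β).prod volume) < ∞) :
    ∑' w : (Fin r → ℤ) × (Fin d → ℤ), ‖∫ p in orbitBox β c₁ a c₂ q,
      star (repPhase (latticePoint β a q b (w, n)) p.1 p.2) * H p
        ∂((plancherelMeasure β).prod volume)‖ₑ ^ 2 =
    (∏ i, ENNReal.ofReal (a i)) * (∏ i, ENNReal.ofReal (q i)) *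
      ∫⁻ p in orbitBox β c₁ a c₂ q, ‖H p‖ₑ ^ 2 ∂((plancherelMeasure β).prod volume) := by
  have hneg : ∀ {k : ℕ} (m : Fin k → ℤ) (s : Fin k → ℝ),
      (-fun i => ((-m) i : ℝ) / s i) = fun i => m i / s i := fun m s => funext fun i => by
    simp [neg_div]
  rw [setLIntegral_orbitBox hβ c₁ a c₂ q (hH.enorm.pow_const 2)] at hH2 ⊢
  rw [← tsum_enorm_integral_box_prod c₁ c₂ ha hq (G := fun ξ => H (orbitMapInv β ξ))
    (hH.comp measurable_orbitMapInv) hH2, ← (Equiv.neg ((Fin r → ℤ) × (Fin d → ℤ))).tsum_eq]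
  refine tsum_congr fun w => ?_
  rw [orbitBox, latticePoint, setIntegral_star_repPhase_mul hβ hH.aestronglyMeasurable
    ((measurableSet_box _ _).prod (measurableSet_box _ _))]
  simp only [Equiv.neg_apply, Prod.fst_neg, Prod.snd_neg, hneg]

/-! ### The quasi-lattice -/

@[simp]
theorem NilGroup.z_mk (z : Fin r → ℝ) (y x : Fin d → ℝ) : (mk z y x : NilGroup β).z = z := rfl

@[simp]
theorem NilGroup.y_mk (z : Fin r → ℝ) (y x : Fin d → ℝ) : (mk z y x : NilGroup β).y = y := rfl

@[simp]
theorem NilGroup.x_mk (z : Fin r → ℝ) (y x : Fin d → ℝ) : (mk z y x : NilGroup β).x = x := rfl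

theorem bracketXY_zero_left (y : Fin d → ℝ) : bracketXY β 0 y = 0 := by
  funext k
  simp [bracketXY]

theorem bracketXY_zero_right (x : Fin d → ℝ) : bracketXY β x 0 = 0 := by
  funext k
  simp [bracketXY]

theorem nilExp_sum_vecZ (c : Fin r → ℝ) :
    nilExp β (∑ j, c j • vecZ β j) = NilGroup.mk c 0 0 := by
  refine NilGroup.ext' ?_ ?_ ?_ <;>
    simp [nilExp, vecZ, Finsupp.single_apply, ← Pi.zero_def, bracketXY_zero_left]

theorem nilExp_sum_vecY (c : Fin d → ℝ) :
    nilExp β (∑ j, c j • vecY β j) = NilGroup.mk 0 c 0 := by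
  refine NilGroup.ext' ?_ ?_ ?_ <;>
    simp [nilExp, vecY, Finsupp.single_apply, ← Pi.zero_def, bracketXY_zero_left]

theorem nilExp_sum_vecX (c : Fin d → ℝ) :
    nilExp β (∑ j, c j • vecX β j) = NilGroup.mk 0 0 c := by
  refine NilGroup.ext' ?_ ?_ ?_ <;>
    simp [nilExp, vecX, Finsupp.single_apply, ← Pi.zero_def, bracketXY_zero_right]

theorem latticePoint_eq (a : Fin r → ℝ) (q b : Fin d → ℝ)
    (w : ((Fin r → ℤ) × (Fin d → ℤ)) × (Fin d → ℤ)) : latticePoint β a q b w =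
      nilExp β (∑ j, ((w.1.1 j : ℝ) / a j) • vecZ β j) *
        nilExp β (∑ j, ((w.1.2 j : ℝ) / q j) • vecY β j) *
        nilExp β (∑ j, ((w.2 j : ℝ) / b j) • vecX β j) := by
  rw [nilExp_sum_vecZ, nilExp_sum_vecY, nilExp_sum_vecX]
  refine NilGroup.ext' ?_ ?_ ?_ <;>
    simp [latticePoint, NilGroup.mul_def, bracketXY_zero_left]

theorem injective_intCast_div {ι : Type*} {s : ι → ℝ} (hs : ∀ i, 0 < s i) :
    Function.Injective fun (m : ι → ℤ) i => (m i : ℝ) / s i := fun _ _ h =>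
  funext fun i => Int.cast_injective ((div_left_inj' (hs i).ne').1 (congrFun h i))

theorem latticePoint_injective {a : Fin r → ℝ} {q b : Fin d → ℝ} (ha : ∀ i, 0 < a i)
    (hq : ∀ i, 0 < q i) (hb : ∀ i, 0 < b i) : Function.Injective (latticePoint β a q b) :=
  fun _ _ h => Prod.ext (Prod.ext (injective_intCast_div ha (congrArg NilGroup.z h))
    (injective_intCast_div hq (congrArg NilGroup.y h)))
      (injective_intCast_div hb (congrArg NilGroup.x h))

/-- The parametrization of the quasi-lattice by its integral coordinates. -/
def latticeEquiv (β : Module.Basis (Fin r ⊕ Fin d ⊕ Fin d) ℝ 𝔫) {a : Fin r → ℝ}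
    {q b : Fin d → ℝ} (ha : ∀ i, 0 < a i) (hq : ∀ i, 0 < q i) (hb : ∀ i, 0 < b i) :
    ((Fin r → ℤ) × (Fin d → ℤ)) × (Fin d → ℤ) ≃ quasiLattice β a q b :=
  Equiv.ofBijective
    (fun w => ⟨latticePoint β a q b w, w.1.1, w.1.2, w.2, latticePoint_eq a q b w⟩)
    ⟨fun _ _ h => latticePoint_injective ha hq hb (congrArg Subtype.val h),
      fun ⟨_, m, k, n, h⟩ =>
        ⟨((m, k), n), Subtype.ext ((latticePoint_eq a q b ((m, k), n)).trans h.symm)⟩⟩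

theorem IsParsevalFrame.tsum_enorm_inner_sq {H : Type*} [NormedAddCommGroup H]
    [InnerProductSpace ℂ H] {ι : Type*} {K : Submodule ℂ H} {v : ι → H}
    (hv : IsParsevalFrame K v) {f : H} (hf : f ∈ K) :
    ∑' i, ‖inner ℂ (v i) f‖ₑ ^ 2 = ‖f‖ₑ ^ 2 := by
  simp only [← ofReal_norm, norm_inner_symm _ f]
  simp only [ofReal_norm]
  rw [tsum_enorm_sq_eq (hv.2 f hf), ENNReal.ofReal_pow (norm_nonneg f), ofReal_norm]

theorem IsParsevalFrame.eq_zero_of_inner_eq_zero {H : Type*} [NormedAddCommGroup H]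
    [InnerProductSpace ℂ H] {ι : Type*} {K : Submodule ℂ H} {v : ι → H}
    (hv : IsParsevalFrame K v) {f : H} (hf : f ∈ K) (h : ∀ i, inner ℂ f (v i) = 0) : f = 0 := by
  have hsum := hv.2 f hf
  simp only [h, norm_zero, ne_eq, OfNat.ofNat_ne_zero, not_false_eq_true, zero_pow] at hsum
  exact norm_eq_zero.1 (pow_eq_zero_iff two_ne_zero |>.1 (hsum.unique hasSum_zero))

theorem tsum_enorm_inner_latticePoint {a : Fin r → ℝ} {q b : Fin d → ℝ} (ha : ∀ i, 0 < a i)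
    (hq : ∀ i, 0 < q i) (hb : ∀ i, 0 < b i) {K : Submodule ℂ (L2N β)} {φ : L2N β}
    (hframe : IsParsevalFrame K fun γ : quasiLattice β a q b => leftRegular (γ : NilGroup β) φ)
    {f : L2N β} (hf : f ∈ K) :
    ∑' w, ‖inner ℂ (leftRegular (latticePoint β a q b w) φ) f‖ₑ ^ 2 = ‖f‖ₑ ^ 2 :=
  ((latticeEquiv β ha hq hb).tsum_eq _).trans (hframe.tsum_enorm_inner_sq hf)

end QuasiLattice

/-! ### The rank of a projection -/

section Rank

variable {d : ℕ}

theorem card_le_hsNormSq {P : L2R d →L[ℂ] L2R d} (hP : IsStarProjection P) {n : ℕ}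
    {v : Fin n → L2R d} (hv : Orthonormal ℂ v) (hPv : ∀ i, P (v i) = v i) :
    (n : ℝ≥0∞) ≤ hsNormSq P := by
  have hinner : ∀ i u, inner ℂ (P u) (v i) = inner ℂ u (v i) := fun i u => by
    rw [← hPv i, inner_apply_of_isStarProjection hP]
  have hsum : ∀ i, ∑' j, ‖inner ℂ (P (stdBasis d j)) (v i)‖ₑ ^ 2 = 1 := fun i => by
    simp only [hinner, ← ofReal_norm, norm_inner_symm _ (v i)]
    simp only [ofReal_norm]
    rw [tsum_enorm_inner_hilbertBasis_sq, ← ofReal_norm, hv.1, ENNReal.ofReal_one, one_pow]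
  have hbessel : ∀ u, ∑ i, ‖inner ℂ u (v i)‖ₑ ^ 2 ≤ ‖u‖ₑ ^ 2 := fun u => by
    have h := ENNReal.ofReal_le_ofReal (hv.sum_inner_products_le u (s := Finset.univ))
    rw [ENNReal.ofReal_sum_of_nonneg fun _ _ => by positivity] at h
    simpa only [ENNReal.ofReal_pow (norm_nonneg _), norm_inner_symm _ u, ofReal_norm] using h
  calc (n : ℝ≥0∞) = ∑ i, ∑' j, ‖inner ℂ (P (stdBasis d j)) (v i)‖ₑ ^ 2 := by simp [hsum]
    _ = ∑' j, ∑ i, ‖inner ℂ (P (stdBasis d j)) (v i)‖ₑ ^ 2 :=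
        (Summable.tsum_finsetSum fun i _ => ENNReal.summable).symm
    _ ≤ ∑' j, ‖P (stdBasis d j)‖ₑ ^ 2 := ENNReal.tsum_le_tsum fun j => hbessel _
    _ = hsNormSq P := (hsNormSq_eq_tsum P).symm

theorem natCast_le_hsNormSq_of_le_rank {P : L2R d →L[ℂ] L2R d} (hP : IsStarProjection P) {n : ℕ}
    (hn : (n : Cardinal) ≤ LinearMap.rank (P : L2R d →ₗ[ℂ] L2R d)) :
    (n : ℝ≥0∞) ≤ hsNormSq P := by
  obtain ⟨w, hw⟩ := exists_linearIndependent_of_le_rank hn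
  have horth := InnerProductSpace.gramSchmidtNormed_orthonormal hw
  set v := InnerProductSpace.gramSchmidtNormed ℂ w
  refine card_le_hsNormSq hP (v := fun i => (v i : L2R d)) ?_ fun i => ?_
  · exact horth.comp_linearIsometry (Submodule.subtypeₗᵢ _)
  · obtain ⟨u, hu⟩ := (v i).2
    rw [← hu]
    exact congrArg (fun S : L2R d →L[ℂ] L2R d => S u) hP.isIdempotentElem

theorem multiplicity_le_hsNormSq {r : ℕ} {P : (Fin r → ℝ) → L2R d →L[ℂ] L2R d} {l : Fin r → ℝ}
    (hP : IsStarProjection (P l)) : (multiplicity P l : ℝ≥0∞) ≤ hsNormSq (P l) := by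
  have hnat : ∀ n : ℕ, (n : ℕ∞) ≤ multiplicity P l → (n : ℝ≥0∞) ≤ hsNormSq (P l) := fun n hn =>
    natCast_le_hsNormSq_of_le_rank hP (Cardinal.natCast_le_toENat.1 hn)
  generalize multiplicity P l = m at hnat
  induction m with
  | top =>
    refine (ENNReal.eq_top_of_forall_nnreal_le fun x => ?_).ge
    obtain ⟨n, hn⟩ := exists_nat_ge x
    exact le_trans (mod_cast hn) (hnat n le_top)
  | coe n => exact hnat n le_rfl

end Rank

section Kernels

variable {r d : ℕ} {𝔫 : Type*} [LieRing 𝔫] [LieAlgebra ℝ 𝔫]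
  {β : Module.Basis (Fin r ⊕ Fin d ⊕ Fin d) ℝ 𝔫}
  {κ : (Fin r → ℝ) × ((Fin d → ℝ) × (Fin d → ℝ)) → ℂ}

/-! ### Functions with a given kernel -/

/-- The function in `L²(N)` whose Plancherel transform has the kernel `κ`. -/
def ofKernel (hβ : IsAdmissibleBasis β) (hκ : MemLp κ 2 (fieldMeasure β)) : L2N β :=
  (kernelTransform hβ).symm (hκ.toLp κ)

theorem coeFn_kernelTransform_ofKernel (hβ : IsAdmissibleBasis β)
    (hκ : MemLp κ 2 (fieldMeasure β)) :
    kernelTransform hβ (ofKernel hβ hκ) =ᵐ[fieldMeasure β] κ := by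
  rw [ofKernel, LinearIsometryEquiv.apply_symm_apply]
  exact hκ.coeFn_toLp

theorem ae_plancherelField_ofKernel (hβ : IsAdmissibleBasis β)
    (hκ : MemLp κ 2 (fieldMeasure β)) :
    ∀ᵐ l ∂(plancherelMeasure β),
      plancherelField hβ (ofKernel hβ hκ) l = hsOp fun p => κ (l, p) := by
  filter_upwards [Measure.ae_ae_of_ae_prod (coeFn_kernelTransform_ofKernel hβ hκ)] with l hl
  exact hsOp_congr hl

theorem enorm_ofKernel_sq (hβ : IsAdmissibleBasis β) (hκ : MemLp κ 2 (fieldMeasure β)) :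
    ‖ofKernel hβ hκ‖ₑ ^ 2 = ∫⁻ p, ‖κ p‖ₑ ^ 2 ∂(fieldMeasure β) := by
  rw [← enorm_toLp_sq hκ, ofKernel, ← ofReal_norm, LinearIsometryEquiv.norm_map, ofReal_norm]

theorem hsOp_zero : hsOp (fun _ : (Fin d → ℝ) × (Fin d → ℝ) => (0 : ℂ)) = 0 := by
  have h := hsOp_smul (d := d) (κ := 0) MemLp.zero 0
  rwa [zero_smul, zero_smul] at h

theorem hsNormSq_zero : hsNormSq (0 : L2R d →L[ℂ] L2R d) = 0 := by
  simp [hsNormSq_eq_tsum]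

/-! ### Cutting off along the dual of the centre -/

variable {E : Set (Fin r → ℝ)}

/-- The function whose Plancherel transform is that of `φ` on `E` and vanishes elsewhere. -/
def spectralCutoff (hβ : IsAdmissibleBasis β) (hE : MeasurableSet E) (φ : L2N β) : L2N β :=
  ofKernel hβ ((Lp.memLp (kernelTransform hβ φ)).indicator (measurable_fst hE))

theorem ae_plancherelField_spectralCutoff (hβ : IsAdmissibleBasis β) (hE : MeasurableSet E)
    (φ : L2N β) : ∀ᵐ l ∂(plancherelMeasure β),
      plancherelField hβ (spectralCutoff hβ hE φ) l = E.indicator (plancherelField hβ φ) l := by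
  filter_upwards [ae_plancherelField_ofKernel hβ
    ((Lp.memLp (kernelTransform hβ φ)).indicator (measurable_fst hE))] with l hl
  by_cases hlE : l ∈ E
  · rw [spectralCutoff, hl, Set.indicator_of_mem hlE, plancherelField]
    simp only [Set.indicator, Set.mem_preimage, hlE, if_true]
  · rw [spectralCutoff, hl, Set.indicator_of_notMem hlE, ← hsOp_zero]
    simp only [Set.indicator, Set.mem_preimage, hlE, if_false]

theorem spectralCutoff_mem_fieldSpace (hβ : IsAdmissibleBasis β)
    {P : (Fin r → ℝ) → L2R d →L[ℂ] L2R d} {φ : L2N β} (hφ : φ ∈ fieldSpace hβ P)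
    (hE : MeasurableSet E) : spectralCutoff hβ hE φ ∈ fieldSpace hβ P := by
  filter_upwards [mem_fieldSpace.1 hφ, ae_plancherelField_spectralCutoff hβ hE φ] with l hφl hl
  rw [hl]
  by_cases hlE : l ∈ E
  · rw [Set.indicator_of_mem hlE, hφl]
  · rw [Set.indicator_of_notMem hlE, ContinuousLinearMap.zero_comp]

/-- The density of `‖φ̂(λ)‖²_HS dμ(λ)` with respect to Lebesgue measure. -/
def spectralDensity (hβ : IsAdmissibleBasis β) (φ : L2N β) (l : Fin r → ℝ) : ℝ≥0∞ :=
  ENNReal.ofReal |(matB β l).det| * hsNormSq (plancherelField hβ φ l)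

theorem measurable_spectralDensity (hβ : IsAdmissibleBasis β) (φ : L2N β) :
    Measurable (spectralDensity hβ φ) :=
  measurable_abs_det_matB.mul (isMeasurableField_plancherelField hβ φ).measurable_hsNormSq

theorem enorm_spectralCutoff_sq (hβ : IsAdmissibleBasis β) (hE : MeasurableSet E) (φ : L2N β) :
    ‖spectralCutoff hβ hE φ‖ₑ ^ 2 = ∫⁻ l in E, spectralDensity hβ φ l := by
  have hhs : ∀ᵐ l ∂(plancherelMeasure β),
      hsNormSq (plancherelField hβ (spectralCutoff hβ hE φ) l) =
        E.indicator (fun l => hsNormSq (plancherelField hβ φ l)) l := by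
    filter_upwards [ae_plancherelField_spectralCutoff hβ hE φ] with l hl
    rw [hl]
    exact congrFun (Set.indicator_comp_of_zero (g := hsNormSq) hsNormSq_zero).symm l
  rw [← lintegral_hsNormSq_plancherelField hβ, lintegral_congr_ae hhs,
    lintegral_plancherelMeasure
      ((isMeasurableField_plancherelField hβ φ).measurable_hsNormSq.indicator hE),
    ← lintegral_indicator hE]
  refine lintegral_congr fun l => ?_
  exact (Set.indicator_mul_right E (fun l => ENNReal.ofReal |(matB β l).det|) _).symm

theorem ae_spectralDensity_lt_top (hβ : IsAdmissibleBasis β) (φ : L2N β) :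
    ∀ᵐ l, spectralDensity hβ φ l < ∞ := by
  refine ae_lt_top (measurable_spectralDensity hβ φ) ?_
  have h := enorm_spectralCutoff_sq hβ .univ φ
  rw [setLIntegral_univ] at h
  exact h ▸ ENNReal.pow_ne_top enorm_ne_top

theorem ae_integral_star_mul_spectralCutoff (hβ : IsAdmissibleBasis β) (hE : MeasurableSet E)
    (φ : L2N β) : ∀ᵐ l ∂(plancherelMeasure β),
      ∫ p, star (kernelTransform hβ φ (l, p)) *
        kernelTransform hβ (spectralCutoff hβ hE φ) (l, p) =
          E.indicator (fun l => ((hsNormSq (plancherelField hβ φ l)).toReal : ℂ)) l := by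
  filter_upwards [ae_memLp_kernelTransform hβ φ, Measure.ae_ae_of_ae_prod
    (coeFn_kernelTransform_ofKernel hβ ((Lp.memLp (kernelTransform hβ φ)).indicator
      (measurable_fst hE)))] with l hφl hcut
  rw [spectralCutoff, integral_congr_ae (hcut.mono fun p hp => congrArg
    (star (kernelTransform hβ φ (l, p)) * ·) hp)]
  by_cases hlE : l ∈ E
  · have hnorm := integral_eq_lintegral_of_nonneg_ae (μ := volume)
      (f := fun p => ‖kernelTransform hβ φ (l, p)‖ ^ 2) (ae_of_all _ fun p => by positivity)
      (hφl.1.norm.pow 2)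
    simp only [ENNReal.ofReal_pow (norm_nonneg _), ofReal_norm] at hnorm
    rw [Set.indicator_of_mem hlE, plancherelField, hsNormSq_hsOp hφl, ← hnorm,
      ← integral_complex_ofReal]
    refine integral_congr_ae (ae_of_all _ fun p => ?_)
    simp only [Set.indicator, Set.mem_preimage, hlE, if_true, RCLike.star_def, RCLike.conj_mul]
    norm_cast
  · simp [Set.indicator, hlE]

theorem inner_leftRegular_center_eq_integral (hβ : IsAdmissibleBasis β) (φ f : L2N β)
    (z : Fin r → ℝ) :
    inner ℂ (leftRegular (NilGroup.mk z 0 0) φ) f =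
      ∫ l, Complex.exp (-2 * Real.pi * Complex.I * ((z ⬝ᵥ l : ℝ) : ℂ)) *
        (∫ p, star (kernelTransform hβ φ (l, p)) * kernelTransform hβ f (l, p))
          ∂(plancherelMeasure β) := by
  set k := kernelTransform hβ φ
  set k' := kernelTransform hβ f
  set phase : (Fin r → ℝ) → ℂ := fun l =>
    Complex.exp (-2 * Real.pi * Complex.I * ((z ⬝ᵥ l : ℝ) : ℂ)) with hphase
  have hphase_meas : Measurable phase := by
    have := measurable_dotProduct (measurable_const (a := z)) (measurable_id (α := Fin r → ℝ))
    fun_prop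
  have hstar : ∀ l t, star (repPhase (NilGroup.mk z 0 0 : NilGroup β) l t) = phase l :=
    fun l t => (star_repPhase (β := β) z 0 0 (l, t)).trans <| by
      simp [hphase, orbitMap, dotProduct_comm]
  have hint : Integrable (fun p => phase p.1 * (star (k p) * k' p)) (fieldMeasure β) := by
    refine ((Lp.memLp k).star.integrable_mul (Lp.memLp k')).bdd_mul (c := 1)
      (hphase_meas.comp measurable_fst).aestronglyMeasurable (ae_of_all _ fun p => ?_)
    rw [← hstar p.1 0, norm_star, norm_repPhase]
  rw [← (kernelTransform hβ).inner_map_map, kernelTransform_leftRegular, inner_eq_integral]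
  calc ∫ p, star (repOnKernels (NilGroup.mk z 0 0) k p) * k' p ∂(fieldMeasure β)
      = ∫ p, phase p.1 * (star (k p) * k' p) ∂(fieldMeasure β) := by
        refine integral_congr_ae ?_
        filter_upwards [coeFn_repOnKernels (NilGroup.mk z 0 0 : NilGroup β) k] with p hp
        have hfix : translateKernel (NilGroup.mk z 0 0 : NilGroup β).x p = p :=
          Prod.ext rfl (Prod.ext (sub_zero _) rfl)
        rw [hp, hfix, star_mul', hstar, mul_assoc]
    _ = _ := (integral_prod _ hint).trans <| by
        simp only [integral_const_mul]
        rfl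

theorem inner_leftRegular_center_spectralCutoff (hβ : IsAdmissibleBasis β)
    (hE : MeasurableSet E) (φ : L2N β) (z : Fin r → ℝ) :
    inner ℂ (leftRegular (NilGroup.mk z 0 0) φ) (spectralCutoff hβ hE φ) =
      ∫ l in E, Complex.exp (-2 * Real.pi * Complex.I * ((z ⬝ᵥ l : ℝ) : ℂ)) *
        ((spectralDensity hβ φ l).toReal : ℂ) := by
  rw [inner_leftRegular_center_eq_integral hβ, integral_congr_ae
    ((ae_integral_star_mul_spectralCutoff hβ hE φ).mono fun l hl => congrArg (_ * ·) hl),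
    ← setIntegral_univ, setIntegral_mul_indicator hE, Set.univ_inter, plancherelMeasure,
    setIntegral_withDensity_eq_setIntegral_toReal_smul measurable_abs_det_matB
      (ae_of_all _ fun _ => ENNReal.ofReal_lt_top) _ hE]
  refine integral_congr_ae (ae_of_all _ fun l => ?_)
  simp only [spectralDensity, ENNReal.toReal_mul, Complex.real_smul, Complex.ofReal_mul]
  ring

end Kernels

/-! ### The spectral density of the frame generator -/

theorem ae_mul_le_one_of_setLIntegral_sq_le {X : Type*} [MeasurableSpace X] {μ : Measure X}
    [IsFiniteMeasure μ] {F : X → ℝ≥0∞} (hF : Measurable F) (hfin : ∀ᵐ x ∂μ, F x < ∞) {A : ℝ≥0∞}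
    (h : ∀ E, MeasurableSet E → ∀ M : ℕ, (∀ x ∈ E, F x ≤ M) →
      A * ∫⁻ x in E, F x ^ 2 ∂μ ≤ ∫⁻ x in E, F x ∂μ) :
    ∀ᵐ x ∂μ, A * F x ≤ 1 := by
  have hnull : ∀ M : ℕ, μ ({x | F x ≤ M} ∩ {x | 1 < A * F x}) = 0 := fun M => by
    set E := {x | F x ≤ M} ∩ {x | 1 < A * F x}
    have hE : MeasurableSet E := (measurableSet_le hF measurable_const).inter
      (measurableSet_lt measurable_const (hF.const_mul A))
    by_contra hne
    have hint : ∫⁻ x in E, F x ∂μ ≠ ∞ := by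
      refine ((setLIntegral_mono measurable_const fun x (hx : x ∈ E) => hx.1).trans_lt ?_).ne
      rw [setLIntegral_const]
      exact ENNReal.mul_lt_top (ENNReal.natCast_lt_top M) (measure_lt_top μ E)
    have hlt : ∫⁻ x in E, F x ∂μ < ∫⁻ x in E, A * F x ^ 2 ∂μ := by
      refine setLIntegral_strict_mono hE hne ((hF.pow_const 2).const_mul A) hint
        (ae_of_all _ fun x hx => ?_)
      have hgt : 1 < A * F x := hx.2
      have hzero : F x ≠ 0 := fun h => by simp [h] at hgt
      have htop : F x ≠ ∞ := (hx.1.trans_lt (ENNReal.natCast_lt_top M)).ne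
      calc F x = 1 * F x := (one_mul _).symm
        _ < A * F x * F x := (ENNReal.mul_lt_mul_iff_left hzero htop).2 hgt
        _ = A * F x ^ 2 := by ring
    rw [lintegral_const_mul _ (hF.pow_const 2)] at hlt
    exact hlt.not_ge (h E hE M fun x hx => hx.1)
  filter_upwards [hfin, ae_all_iff.2 fun M => measure_eq_zero_iff_ae_notMem.1 (hnull M)]
    with x hx hx'
  by_contra! hgt
  obtain ⟨M, hM⟩ := ENNReal.exists_nat_gt hx.ne
  exact hx' M ⟨hM.le, hgt⟩

section GeneratorBound

variable {r d : ℕ} {𝔫 : Type*} [LieRing 𝔫] [LieAlgebra ℝ 𝔫]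
  {β : Module.Basis (Fin r ⊕ Fin d ⊕ Fin d) ℝ 𝔫} {a : Fin r → ℝ} {q b : Fin d → ℝ}
  {P : (Fin r → ℝ) → L2R d →L[ℂ] L2R d} {φ : L2N β}

theorem tsum_enorm_setIntegral_exp_spectralDensity (hβ : IsAdmissibleBasis β) (φ : L2N β)
    (ha : ∀ k, 0 < a k) (c : Fin r → ℝ) {E : Set (Fin r → ℝ)} (hE : MeasurableSet E)
    (hEc : E ⊆ box c a) {M : ℕ} (hEM : ∀ l ∈ E, spectralDensity hβ φ l ≤ M) :
    ∑' m : Fin r → ℤ, ‖∫ l in E, Complex.exp (-2 * Real.pi * Complex.I *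
      (((fun k => m k / a k) ⬝ᵥ l : ℝ) : ℂ)) * ((spectralDensity hβ φ l).toReal : ℂ)‖ₑ ^ 2 =
      (∏ k, ENNReal.ofReal (a k)) * ∫⁻ l in E, spectralDensity hβ φ l ^ 2 := by
  set F := spectralDensity hβ φ
  have hFm : Measurable F := measurable_spectralDensity hβ φ
  set G : (Fin r → ℝ) → ℂ := E.indicator fun l => ((F l).toReal : ℂ) with hG
  have hGm : Measurable G :=
    (Complex.measurable_ofReal.comp hFm.ennreal_toReal).indicator hE
  have hnorm : ∫⁻ l in box c a, ‖G l‖ₑ ^ 2 = ∫⁻ l in E, F l ^ 2 := by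
    conv_rhs => rw [← Set.inter_eq_left.2 hEc, ← setLIntegral_indicator hE]
    refine lintegral_congr fun l => ?_
    by_cases hl : l ∈ E
    · rw [hG, Set.indicator_of_mem hl, Set.indicator_of_mem hl, ← ofReal_norm,
        Complex.norm_of_nonneg ENNReal.toReal_nonneg,
        ENNReal.ofReal_toReal ((hEM l hl).trans_lt (ENNReal.natCast_lt_top M)).ne]
    · simp [hG, hl]
  have hfin : ∫⁻ l in box c a, ‖G l‖ₑ ^ 2 < ∞ := by
    rw [hnorm]
    refine (setLIntegral_mono measurable_const fun l hl =>
      pow_le_pow_left₀ zero_le (hEM l hl) 2).trans_lt ?_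
    rw [setLIntegral_const]
    refine ENNReal.mul_lt_top (ENNReal.pow_lt_top (ENNReal.natCast_lt_top M))
      ((measure_mono hEc).trans_lt ?_)
    rw [volume_box]
    exact ENNReal.prod_lt_top fun i _ => ENNReal.ofReal_lt_top
  rw [← hnorm, ← tsum_enorm_integral_box c ha hGm hfin]
  refine tsum_congr fun m => ?_
  rw [setIntegral_mul_indicator hE, Set.inter_eq_right.2 hEc]
  rfl

theorem mul_setLIntegral_spectralDensity_sq_le (hβ : IsAdmissibleBasis β)
    (ha : ∀ k, 0 < a k) (hq : ∀ i, 0 < q i) (hb : ∀ i, 0 < b i) (hφ : φ ∈ fieldSpace hβ P)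
    (hframe : IsParsevalFrame (fieldSpace hβ P)
      fun γ : quasiLattice β a q b => leftRegular (γ : NilGroup β) φ) (c : Fin r → ℝ)
    {E : Set (Fin r → ℝ)} (hE : MeasurableSet E) (hEc : E ⊆ box c a) {M : ℕ}
    (hEM : ∀ l ∈ E, spectralDensity hβ φ l ≤ M) :
    (∏ k, ENNReal.ofReal (a k)) * ∫⁻ l in E, spectralDensity hβ φ l ^ 2 ≤
      ∫⁻ l in E, spectralDensity hβ φ l := by
  have hinj : Function.Injective fun m : Fin r → ℤ =>
      (((m, 0), 0) : ((Fin r → ℤ) × (Fin d → ℤ)) × (Fin d → ℤ)) := fun m m' h =>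
    congrArg (fun w => w.1.1) h
  have hcentral : ∀ m : Fin r → ℤ,
      latticePoint β a q b ((m, 0), 0) = NilGroup.mk (fun k => m k / a k) 0 0 := fun m =>
    NilGroup.ext' rfl (funext fun i => by simp [latticePoint])
      (funext fun i => by simp [latticePoint])
  calc (∏ k, ENNReal.ofReal (a k)) * ∫⁻ l in E, spectralDensity hβ φ l ^ 2
      = ∑' m : Fin r → ℤ, ‖inner ℂ (leftRegular (latticePoint β a q b ((m, 0), 0)) φ)
          (spectralCutoff hβ hE φ)‖ₑ ^ 2 := by
        simp only [hcentral, inner_leftRegular_center_spectralCutoff]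
        exact (tsum_enorm_setIntegral_exp_spectralDensity hβ φ ha c hE hEc hEM).symm
    _ ≤ ∑' w, ‖inner ℂ (leftRegular (latticePoint β a q b w) φ)
          (spectralCutoff hβ hE φ)‖ₑ ^ 2 := ENNReal.tsum_comp_le_tsum_of_injective hinj _
    _ = ∫⁻ l in E, spectralDensity hβ φ l := by
        rw [tsum_enorm_inner_latticePoint ha hq hb hframe
          (spectralCutoff_mem_fieldSpace hβ hφ hE), enorm_spectralCutoff_sq]

theorem ae_mul_spectralDensity_le_one (hβ : IsAdmissibleBasis β)
    (ha : ∀ k, 0 < a k) (hq : ∀ i, 0 < q i) (hb : ∀ i, 0 < b i) (hφ : φ ∈ fieldSpace hβ P)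
    (hframe : IsParsevalFrame (fieldSpace hβ P)
      fun γ : quasiLattice β a q b => leftRegular (γ : NilGroup β) φ) :
    ∀ᵐ l, (∏ k, ENNReal.ofReal (a k)) * spectralDensity hβ φ l ≤ 1 := by
  have hbox : ∀ c, ∀ᵐ l ∂(volume.restrict (box c a)),
      (∏ k, ENNReal.ofReal (a k)) * spectralDensity hβ φ l ≤ 1 := fun c => by
    have : IsFiniteMeasure (volume.restrict (box c a)) := isFiniteMeasure_restrict.2 <| by
      rw [volume_box]
      exact ENNReal.prod_ne_top fun k _ => ENNReal.ofReal_ne_top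
    refine ae_mul_le_one_of_setLIntegral_sq_le (measurable_spectralDensity hβ φ)
      (ae_restrict_of_ae (ae_spectralDensity_lt_top hβ φ)) fun E hE M hM => ?_
    rw [Measure.restrict_restrict hE]
    exact mul_setLIntegral_spectralDensity_sq_le hβ ha hq hb hφ hframe c
      (hE.inter (measurableSet_box c a)) Set.inter_subset_right fun l hl => hM l hl.1
  filter_upwards [ae_all_iff.2 fun m : Fin r → ℤ =>
    ae_imp_of_ae_restrict (hbox fun k => m k * a k)] with l hl
  obtain ⟨m, hm, -⟩ := existsUnique_mem_cell ha l
  exact hl m hm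

end GeneratorBound

section Multiplicity

variable {r d : ℕ} {𝔫 : Type*} [LieRing 𝔫] [LieAlgebra ℝ 𝔫]
  {β : Module.Basis (Fin r ⊕ Fin d ⊕ Fin d) ℝ 𝔫}
  {E : Set ((Fin r → ℝ) × (Fin d → ℝ))} {w : (Fin r → ℝ) × (Fin d → ℝ) → ℂ}
  {u : (Fin r → ℝ) → L2R d}

/-! ### Fields of operators of rank one -/

/-- The kernel of the field of operators `v ↦ ⟪u_λ, v⟫ 1_E(λ, ·)`, where `w (λ, ·)` represents the
inverse Fourier transform of `u_λ`. -/
def rankOneKernel (E : Set ((Fin r → ℝ) × (Fin d → ℝ))) (w : (Fin r → ℝ) × (Fin d → ℝ) → ℂ)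
    (p : (Fin r → ℝ) × ((Fin d → ℝ) × (Fin d → ℝ))) : ℂ :=
  E.indicator (fun _ => star (w (p.1, p.2.2))) (p.1, p.2.1)

theorem measurable_rankOneKernel (hE : MeasurableSet E) (hw : Measurable w) :
    Measurable (rankOneKernel E w) := by
  have hstar : Measurable fun p : (Fin r → ℝ) × ((Fin d → ℝ) × (Fin d → ℝ)) =>
      star (w (p.1, p.2.2)) := continuous_star.measurable.comp (hw.comp (by fun_prop))
  have hset : MeasurableSet {p : (Fin r → ℝ) × ((Fin d → ℝ) × (Fin d → ℝ)) |
      (p.1, p.2.1) ∈ E} := hE.preimage (by fun_prop)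
  exact hstar.indicator hset

theorem lintegral_rankOneKernel (hw : Measurable w)
    (hu : ∀ l, (fourierL2 d).symm (u l) =ᵐ[volume] fun σ => w (l, σ)) (hE : MeasurableSet E) :
    ∫⁻ p, ‖rankOneKernel E w p‖ₑ ^ 2 ∂(fieldMeasure β) =
      ∫⁻ p in E, ‖u p.1‖ₑ ^ 2 ∂((plancherelMeasure β).prod volume) := by
  have hnorm : ∀ l, ∫⁻ σ, ‖w (l, σ)‖ₑ ^ 2 = ‖u l‖ₑ ^ 2 := fun l => by
    rw [← ofReal_norm (u l), ← (fourierL2 d).symm.norm_map, ofReal_norm, enorm_sq_eq_lintegral]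
    exact lintegral_congr_ae ((hu l).mono fun σ hσ => congrArg (‖·‖ₑ ^ 2) hσ.symm)
  have hmeas := (measurable_rankOneKernel hE hw).enorm.pow_const 2
  refine ((measurePreserving_prodAssoc (plancherelMeasure β) (volume : Measure (Fin d → ℝ))
    (volume : Measure (Fin d → ℝ))).lintegral_comp hmeas).symm.trans ?_
  have hmeas' : Measurable fun p : ((Fin r → ℝ) × (Fin d → ℝ)) × (Fin d → ℝ) =>
      ‖rankOneKernel E w (MeasurableEquiv.prodAssoc p)‖ₑ ^ 2 :=
    hmeas.comp MeasurableEquiv.prodAssoc.measurable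
  rw [lintegral_prod _ hmeas'.aemeasurable, ← lintegral_indicator hE]
  refine lintegral_congr fun p => ?_
  change ∫⁻ σ, ‖E.indicator (fun _ => star (w (p.1, σ))) p‖ₑ ^ 2 = _
  by_cases hp : p ∈ E <;> simp [hp, hnorm]

theorem memLp_rankOneKernel (hβ : IsAdmissibleBasis β) (hw : Measurable w)
    (hu : ∀ l, (fourierL2 d).symm (u l) =ᵐ[volume] fun σ => w (l, σ)) {C : ℝ≥0∞} (hC : C ≠ ∞)
    (huC : ∀ l, ‖u l‖ₑ ≤ C) {c₁ a : Fin r → ℝ} {c₂ q : Fin d → ℝ} (hE : MeasurableSet E)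
    (hEc : E ⊆ orbitBox β c₁ a c₂ q) : MemLp (rankOneKernel E w) 2 (fieldMeasure β) := by
  rw [memLp_two_iff (measurable_rankOneKernel hE hw).aestronglyMeasurable,
    lintegral_rankOneKernel hw hu hE]
  refine (setLIntegral_mono measurable_const fun p _ =>
    pow_le_pow_left₀ zero_le (huC p.1) 2).trans_lt ?_
  rw [setLIntegral_const]
  exact ENNReal.mul_lt_top (ENNReal.pow_lt_top hC.lt_top)
    ((measure_mono hEc).trans_lt (measure_orbitBox_lt_top hβ c₁ a c₂ q))

theorem coeFn_hsOp_rankOneKernel {l : Fin r → ℝ} {v : L2R d}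
    (hκ : MemLp (fun p => rankOneKernel E w (l, p)) 2 volume)
    (hv : (fourierL2 d).symm v =ᵐ[volume] fun σ => w (l, σ)) (x : L2R d) :
    hsOp (fun p => rankOneKernel E w (l, p)) x =ᵐ[volume]
      fun t => E.indicator (fun _ => inner ℂ v x) (l, t) := by
  filter_upwards [coeFn_hsOp hκ x] with t ht
  rw [ht]
  by_cases hp : (l, t) ∈ E
  · rw [Set.indicator_of_mem hp, ← (fourierL2 d).symm.inner_map_map, inner_eq_integral]
    refine integral_congr_ae ?_
    filter_upwards [hv] with σ hσ
    rw [hσ, rankOneKernel, Set.indicator_of_mem hp]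
  · simp [rankOneKernel, hp]

theorem ofKernel_rankOneKernel_mem_fieldSpace (hβ : IsAdmissibleBasis β)
    {P : (Fin r → ℝ) → L2R d →L[ℂ] L2R d} (hP : ∀ l, IsStarProjection (P l))
    (hPu : ∀ l, P l (u l) = u l)
    (hu : ∀ l, (fourierL2 d).symm (u l) =ᵐ[volume] fun σ => w (l, σ))
    (hκ : MemLp (rankOneKernel E w) 2 (fieldMeasure β)) :
    ofKernel hβ hκ ∈ fieldSpace hβ P := by
  filter_upwards [ae_plancherelField_ofKernel hβ hκ, memLp_two_slice hκ] with l hl hslice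
  rw [hl]
  ext1 x
  refine Lp.ext ?_
  have hinner : inner ℂ (u l) (P l x) = inner ℂ (u l) x := by
    conv_lhs => rw [← hPu l, ← inner_conj_symm, inner_apply_of_isStarProjection (hP l), hPu l,
      inner_conj_symm]
  filter_upwards [coeFn_hsOp_rankOneKernel hslice (hu l) x,
    coeFn_hsOp_rankOneKernel hslice (hu l) (P l x)] with t ht htP
  rw [ht, ContinuousLinearMap.comp_apply, htP, hinner]

/-- The function `(λ, t) ↦ (φ̂(λ) u_λ)(t)`, where `w (λ, ·)` represents the inverse Fourier
transform of `u_λ`. -/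
def kernelApply (hβ : IsAdmissibleBasis β) (φ : L2N β) (w : (Fin r → ℝ) × (Fin d → ℝ) → ℂ)
    (p : (Fin r → ℝ) × (Fin d → ℝ)) : ℂ :=
  ∫ σ, kernelTransform hβ φ (p.1, (p.2, σ)) * w (p.1, σ)

theorem measurable_kernelApply (hβ : IsAdmissibleBasis β) (φ : L2N β) (hw : Measurable w) :
    Measurable (kernelApply hβ φ w) := by
  have hk := (Lp.stronglyMeasurable (kernelTransform hβ φ)).measurable
  refine (StronglyMeasurable.integral_prod_right
    (f := fun (p : (Fin r → ℝ) × (Fin d → ℝ)) (σ : Fin d → ℝ) =>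
      kernelTransform hβ φ (p.1, (p.2, σ)) * w (p.1, σ))
    (Measurable.stronglyMeasurable ?_)).measurable
  exact (hk.comp (by fun_prop : Measurable fun q : ((Fin r → ℝ) × (Fin d → ℝ)) × (Fin d → ℝ) =>
    (q.1.1, (q.1.2, q.2)))).mul (hw.comp (by fun_prop))

theorem ae_lintegral_kernelApply (hβ : IsAdmissibleBasis β) (φ : L2N β)
    (hu : ∀ l, (fourierL2 d).symm (u l) =ᵐ[volume] fun σ => w (l, σ)) :
    ∀ᵐ l ∂(plancherelMeasure β), ∫⁻ t, ‖kernelApply hβ φ w (l, t)‖ₑ ^ 2 =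
      ‖plancherelField hβ φ l (u l)‖ₑ ^ 2 := by
  filter_upwards [ae_memLp_kernelTransform hβ φ] with l hl
  rw [enorm_sq_eq_lintegral]
  refine lintegral_congr_ae ?_
  filter_upwards [coeFn_hsOp hl (u l)] with t ht
  rw [plancherelField, ht, kernelApply]
  congr 2
  refine integral_congr_ae ?_
  filter_upwards [hu l] with σ hσ
  rw [hσ]

theorem lintegral_kernelApply_translate_lt_top (hβ : IsAdmissibleBasis β) (φ : L2N β)
    (hw : Measurable w) (hu : ∀ l, (fourierL2 d).symm (u l) =ᵐ[volume] fun σ => w (l, σ))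
    {C : ℝ≥0∞} (hC : C ≠ ∞) (huC : ∀ l, ‖u l‖ₑ ≤ C) (x : Fin d → ℝ) :
    ∫⁻ p, ‖kernelApply hβ φ w (p.1, p.2 - x)‖ₑ ^ 2 ∂((plancherelMeasure β).prod volume) < ∞ := by
  have hmeas : Measurable fun p : (Fin r → ℝ) × (Fin d → ℝ) =>
      ‖kernelApply hβ φ w (p.1, p.2 - x)‖ₑ ^ 2 :=
    ((measurable_kernelApply hβ φ hw).comp (by fun_prop)).enorm.pow_const 2
  have htranslate : ∀ l, ∫⁻ t, ‖kernelApply hβ φ w (l, t - x)‖ₑ ^ 2 =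
      ∫⁻ t, ‖kernelApply hβ φ w (l, t)‖ₑ ^ 2 := fun l =>
    lintegral_sub_right_eq_self (fun t => ‖kernelApply hβ φ w (l, t)‖ₑ ^ 2) x
  rw [lintegral_prod _ hmeas.aemeasurable]
  simp only [htranslate]
  calc ∫⁻ l, ∫⁻ t, ‖kernelApply hβ φ w (l, t)‖ₑ ^ 2 ∂volume ∂(plancherelMeasure β)
      ≤ ∫⁻ l, hsNormSq (plancherelField hβ φ l) * C ^ 2 ∂(plancherelMeasure β) := by
        refine lintegral_mono_ae ?_
        filter_upwards [ae_lintegral_kernelApply hβ φ hu,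
          ae_enorm_plancherelField_sq_le hβ φ] with l hl hle
        rw [hl]
        exact (hle _).trans (by gcongr; exact huC l)
    _ = ‖φ‖ₑ ^ 2 * C ^ 2 := by
        rw [lintegral_mul_const' _ _ (ENNReal.pow_ne_top hC), lintegral_hsNormSq_plancherelField]
    _ < ∞ := ENNReal.mul_lt_top (ENNReal.pow_lt_top enorm_lt_top) (ENNReal.pow_lt_top hC.lt_top)

theorem inner_leftRegular_ofKernel_rankOneKernel (hβ : IsAdmissibleBasis β) (φ : L2N β)
    (hE : MeasurableSet E) (hκ : MemLp (rankOneKernel E w) 2 (fieldMeasure β)) (g : NilGroup β) :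
    inner ℂ (leftRegular g φ) (ofKernel hβ hκ) =
      ∫ p in E, star (repPhase g p.1 p.2) * star (kernelApply hβ φ w (p.1, p.2 - g.x))
        ∂((plancherelMeasure β).prod volume) := by
  have hkernel := (measurePreserving_prodAssoc (plancherelMeasure β)
    (volume : Measure (Fin d → ℝ)) (volume : Measure (Fin d → ℝ))).quasiMeasurePreserving.ae
      (coeFn_kernelTransform_ofKernel hβ hκ)
  have hindicator := setIntegral_mul_indicator (μ := (plancherelMeasure β).prod volume) hE Set.univ
    (fun p => star (repPhase g p.1 p.2)) fun p => star (kernelApply hβ φ w (p.1, p.2 - g.x))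
  rw [setIntegral_univ, Set.univ_inter] at hindicator
  rw [inner_leftRegular_eq_integral hβ, ← hindicator]
  refine integral_congr_ae ?_
  filter_upwards [Measure.ae_ae_of_ae_prod hkernel] with p hp
  congr 1
  calc correlation hβ φ (ofKernel hβ hκ) g.x p
      = ∫ σ, star (kernelTransform hβ φ (p.1, (p.2 - g.x, σ))) *
          rankOneKernel E w (p.1, (p.2, σ)) := by
        refine integral_congr_ae ?_
        filter_upwards [hp] with σ hσ
        exact congrArg (star (kernelTransform hβ φ (p.1, (p.2 - g.x, σ))) * ·) hσ
    _ = E.indicator (fun p => star (kernelApply hβ φ w (p.1, p.2 - g.x))) p := by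
        by_cases hpE : p ∈ E
        · rw [Set.indicator_of_mem hpE, kernelApply, RCLike.star_def, ← integral_conj]
          simp only [rankOneKernel, Prod.mk.eta, Set.indicator_of_mem hpE, map_mul,
            RCLike.star_def]
        · simp [rankOneKernel, hpE]

/-! ### The frame identity on fields of operators of rank one -/

variable {a : Fin r → ℝ} {q b : Fin d → ℝ}

theorem tsum_enorm_setIntegral_repPhase (hβ : IsAdmissibleBasis β) (ha : ∀ i, 0 < a i)
    (hq : ∀ i, 0 < q i) (b : Fin d → ℝ) (n : Fin d → ℤ) {c₁ : Fin r → ℝ} {c₂ : Fin d → ℝ}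
    (hE : MeasurableSet E) (hEc : E ⊆ orbitBox β c₁ a c₂ q)
    {H : (Fin r → ℝ) × (Fin d → ℝ) → ℂ} (hH : Measurable H)
    (hH2 : ∫⁻ p in E, ‖H p‖ₑ ^ 2 ∂((plancherelMeasure β).prod volume) < ∞) :
    ∑' m : (Fin r → ℤ) × (Fin d → ℤ), ‖∫ p in E,
      star (repPhase (latticePoint β a q b (m, n)) p.1 p.2) * H p
        ∂((plancherelMeasure β).prod volume)‖ₑ ^ 2 =
    (∏ i, ENNReal.ofReal (a i)) * (∏ i, ENNReal.ofReal (q i)) *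
      ∫⁻ p in E, ‖H p‖ₑ ^ 2 ∂((plancherelMeasure β).prod volume) := by
  have hnorm : ∫⁻ p in orbitBox β c₁ a c₂ q, ‖E.indicator H p‖ₑ ^ 2
      ∂((plancherelMeasure β).prod volume) =
        ∫⁻ p in E, ‖H p‖ₑ ^ 2 ∂((plancherelMeasure β).prod volume) := by
    conv_rhs => rw [← Set.inter_eq_left.2 hEc, ← setLIntegral_indicator hE]
    refine lintegral_congr fun p => ?_
    by_cases hp : p ∈ E <;> simp [hp]
  rw [← hnorm, ← tsum_enorm_integral_repPhase hβ ha hq b n c₁ c₂ (hH.indicator hE)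
    (hnorm.symm ▸ hH2)]
  simp only [setIntegral_mul_indicator hE, Set.inter_eq_right.2 hEc]

theorem setLIntegral_enorm_sq_eq_tsum_of_subset_orbitBox (hβ : IsAdmissibleBasis β)
    (ha : ∀ i, 0 < a i) (hq : ∀ i, 0 < q i) (hb : ∀ i, 0 < b i)
    {P : (Fin r → ℝ) → L2R d →L[ℂ] L2R d} (hP : ∀ l, IsStarProjection (P l)) {φ : L2N β}
    (hframe : IsParsevalFrame (fieldSpace hβ P)
      fun γ : quasiLattice β a q b => leftRegular (γ : NilGroup β) φ)
    (hPu : ∀ l, P l (u l) = u l) (hw : Measurable w)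
    (hu : ∀ l, (fourierL2 d).symm (u l) =ᵐ[volume] fun σ => w (l, σ)) {C : ℝ≥0∞} (hC : C ≠ ∞)
    (huC : ∀ l, ‖u l‖ₑ ≤ C) {c₁ : Fin r → ℝ} {c₂ : Fin d → ℝ} (hE : MeasurableSet E)
    (hEc : E ⊆ orbitBox β c₁ a c₂ q) :
    ∫⁻ p in E, ‖u p.1‖ₑ ^ 2 ∂((plancherelMeasure β).prod volume) =
      (∏ i, ENNReal.ofReal (a i)) * (∏ i, ENNReal.ofReal (q i)) *
        ∑' n : Fin d → ℤ, ∫⁻ p in E, ‖kernelApply hβ φ w (p.1, p.2 - fun i => n i / b i)‖ₑ ^ 2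
          ∂((plancherelMeasure β).prod volume) := by
  have hκ := memLp_rankOneKernel hβ hw hu hC huC hE hEc
  have hsum := tsum_enorm_inner_latticePoint ha hq hb hframe
    (ofKernel_rankOneKernel_mem_fieldSpace hβ hP hPu hu hκ)
  rw [enorm_ofKernel_sq, lintegral_rankOneKernel hw hu hE, ENNReal.tsum_prod',
    ENNReal.tsum_comm] at hsum
  simp only [inner_leftRegular_ofKernel_rankOneKernel hβ φ hE hκ] at hsum
  rw [← hsum, ← ENNReal.tsum_mul_left]
  refine tsum_congr fun n => ?_
  have hmeas : Measurable fun p : (Fin r → ℝ) × (Fin d → ℝ) =>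
      star (kernelApply hβ φ w (p.1, p.2 - fun i => n i / b i)) :=
    continuous_star.measurable.comp ((measurable_kernelApply hβ φ hw).comp (by fun_prop))
  have hfin := (setLIntegral_le_lintegral E _).trans_lt
    (lintegral_kernelApply_translate_lt_top hβ φ hw hu hC huC fun i => n i / b i)
  have htranslate : ∀ m, (latticePoint β a q b (m, n)).x = fun i => n i / b i := fun _ => rfl
  simpa only [htranslate, RCLike.star_def, RCLike.enorm_conj] using
    tsum_enorm_setIntegral_repPhase hβ ha hq b n hE hEc hmeas
      (by simpa only [RCLike.star_def, RCLike.enorm_conj] using hfin)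

theorem setLIntegral_eq_tsum_orbitBox (ha : ∀ i, 0 < a i) (hq : ∀ i, 0 < q i)
    (hE : MeasurableSet E) (F : (Fin r → ℝ) × (Fin d → ℝ) → ℝ≥0∞) :
    ∫⁻ p in E, F p ∂((plancherelMeasure β).prod volume) = ∑' c : (Fin r → ℤ) × (Fin d → ℤ),
      ∫⁻ p in E ∩ orbitBox β (fun i => c.1 i * a i) a (fun i => c.2 i * q i) q, F p
        ∂((plancherelMeasure β).prod volume) := by
  have hmem : ∀ (c : (Fin r → ℤ) × (Fin d → ℤ)) p,
      p ∈ orbitBox β (fun i => c.1 i * a i) a (fun i => c.2 i * q i) q ↔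
        (orbitMap β p).1 ∈ cell a c.1 ∧ (orbitMap β p).2 ∈ cell q c.2 := fun c p => Iff.rfl
  rw [← lintegral_iUnion fun c => hE.inter (measurableSet_orbitBox _ _ _ _)]
  · rw [← Set.inter_iUnion, Set.iUnion_eq_univ_iff.2, Set.inter_univ]
    intro p
    obtain ⟨m, hm, -⟩ := existsUnique_mem_cell ha (orbitMap β p).1
    obtain ⟨k, hk, -⟩ := existsUnique_mem_cell hq (orbitMap β p).2
    exact ⟨(m, k), hm, hk⟩
  · intro c c' hne
    refine Set.disjoint_left.2 fun p hp hp' => hne ?_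
    have h := (hmem c p).1 hp.2
    have h' := (hmem c' p).1 hp'.2
    exact Prod.ext ((existsUnique_mem_cell ha _).unique h.1 h'.1)
      ((existsUnique_mem_cell hq _).unique h.2 h'.2)

theorem setLIntegral_enorm_sq_eq_tsum (hβ : IsAdmissibleBasis β)
    (ha : ∀ i, 0 < a i) (hq : ∀ i, 0 < q i) (hb : ∀ i, 0 < b i)
    {P : (Fin r → ℝ) → L2R d →L[ℂ] L2R d} (hP : ∀ l, IsStarProjection (P l)) {φ : L2N β}
    (hframe : IsParsevalFrame (fieldSpace hβ P)
      fun γ : quasiLattice β a q b => leftRegular (γ : NilGroup β) φ)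
    (hPu : ∀ l, P l (u l) = u l) (hw : Measurable w)
    (hu : ∀ l, (fourierL2 d).symm (u l) =ᵐ[volume] fun σ => w (l, σ)) {C : ℝ≥0∞} (hC : C ≠ ∞)
    (huC : ∀ l, ‖u l‖ₑ ≤ C) (hE : MeasurableSet E) :
    ∫⁻ p in E, ‖u p.1‖ₑ ^ 2 ∂((plancherelMeasure β).prod volume) =
      (∏ i, ENNReal.ofReal (a i)) * (∏ i, ENNReal.ofReal (q i)) *
        ∑' n : Fin d → ℤ, ∫⁻ p in E, ‖kernelApply hβ φ w (p.1, p.2 - fun i => n i / b i)‖ₑ ^ 2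
          ∂((plancherelMeasure β).prod volume) := by
  simp only [fun F => setLIntegral_eq_tsum_orbitBox (β := β) ha hq hE F]
  rw [ENNReal.tsum_comm, ← ENNReal.tsum_mul_left]
  exact tsum_congr fun c => setLIntegral_enorm_sq_eq_tsum_of_subset_orbitBox hβ ha hq hb hP hframe
    hPu hw hu hC huC (hE.inter (measurableSet_orbitBox _ _ _ _)) Set.inter_subset_right

theorem mul_setLIntegral_enorm_sq_eq (hβ : IsAdmissibleBasis β)
    (ha : ∀ i, 0 < a i) (hq : ∀ i, 0 < q i) (hb : ∀ i, 0 < b i)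
    {P : (Fin r → ℝ) → L2R d →L[ℂ] L2R d} (hP : ∀ l, IsStarProjection (P l)) {φ : L2N β}
    (hframe : IsParsevalFrame (fieldSpace hβ P)
      fun γ : quasiLattice β a q b => leftRegular (γ : NilGroup β) φ)
    (hPu : ∀ l, P l (u l) = u l) (hum : StronglyMeasurable u) (hw : Measurable w)
    (hu : ∀ l, (fourierL2 d).symm (u l) =ᵐ[volume] fun σ => w (l, σ)) {C : ℝ≥0∞} (hC : C ≠ ∞)
    (huC : ∀ l, ‖u l‖ₑ ≤ C) {S : Set (Fin r → ℝ)} (hS : MeasurableSet S) :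
    (∏ i, ENNReal.ofReal (b i)⁻¹) * ∫⁻ l in S, ‖u l‖ₑ ^ 2 ∂(plancherelMeasure β) =
      (∏ i, ENNReal.ofReal (a i)) * (∏ i, ENNReal.ofReal (q i)) *
        ∫⁻ l in S, (∫⁻ t, ‖kernelApply hβ φ w (l, t)‖ₑ ^ 2) ∂(plancherelMeasure β) := by
  set s : Fin d → ℝ := fun i => (b i)⁻¹
  set W := kernelApply hβ φ w
  have hW : Measurable W := measurable_kernelApply hβ φ hw
  have hW_translate : ∀ n : Fin d → ℤ, Measurable fun p : (Fin r → ℝ) × (Fin d → ℝ) =>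
      ‖W (p.1, p.2 - fun i => n i * s i)‖ₑ ^ 2 := fun n =>
    (hW.comp (by fun_prop)).enorm.pow_const 2
  have hu_sq : Measurable fun p : (Fin r → ℝ) × (Fin d → ℝ) => ‖u p.1‖ₑ ^ 2 :=
    (hum.enorm.pow_const 2).comp measurable_fst
  have hperiod : ∀ l, ∑' n : Fin d → ℤ, ∫⁻ t in cell s 0, ‖W (l, t - fun i => n i * s i)‖ₑ ^ 2 =
      ∫⁻ t, ‖W (l, t)‖ₑ ^ 2 := fun l =>
    tsum_setLIntegral_cell_translate (fun i => inv_pos.2 (hb i)) fun t => ‖W (l, t)‖ₑ ^ 2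
  have hcell : MeasurableSet (cell s 0) := measurableSet_box _ s
  have hvolume : volume (cell s 0) = ∏ i, ENNReal.ofReal (s i) := volume_box _ s
  have hprod := setLIntegral_enorm_sq_eq_tsum hβ ha hq hb hP hframe hPu hw hu hC huC
    (hS.prod hcell)
  simp only [← Measure.prod_restrict, div_eq_mul_inv] at hprod
  rw [lintegral_prod _ hu_sq.aemeasurable,
    tsum_congr fun n => lintegral_prod _ (hW_translate n).aemeasurable,
    ← lintegral_tsum fun n => (hW_translate n).lintegral_prod_right'.aemeasurable] at hprod
  simp only [hperiod, setLIntegral_const, hvolume] at hprod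
  rw [← hprod, lintegral_mul_const _ (hum.enorm.pow_const 2), mul_comm]

theorem ae_enorm_sq_eq_of_isParsevalFrame (hβ : IsAdmissibleBasis β)
    (ha : ∀ i, 0 < a i) (hq : ∀ i, 0 < q i) (hb : ∀ i, 0 < b i)
    {P : (Fin r → ℝ) → L2R d →L[ℂ] L2R d} (hP : ∀ l, IsStarProjection (P l)) {φ : L2N β}
    (hframe : IsParsevalFrame (fieldSpace hβ P)
      fun γ : quasiLattice β a q b => leftRegular (γ : NilGroup β) φ)
    (hPu : ∀ l, P l (u l) = u l) (hum : StronglyMeasurable u) {C : ℝ≥0∞} (hC : C ≠ ∞)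
    (huC : ∀ l, ‖u l‖ₑ ≤ C) :
    ∀ᵐ l ∂(plancherelMeasure β), (∏ i, ENNReal.ofReal (b i)⁻¹) * ‖u l‖ₑ ^ 2 =
      (∏ i, ENNReal.ofReal (a i)) * (∏ i, ENNReal.ofReal (q i)) *
        ‖plancherelField hβ φ l (u l)‖ₑ ^ 2 := by
  obtain ⟨w, hw, hu⟩ := exists_measurable_joint_representative (ν := volume) (by norm_num)
    ((fourierL2 d).symm.continuous.comp_stronglyMeasurable hum)
  have hu_sq : Measurable fun l => ‖u l‖ₑ ^ 2 := hum.enorm.pow_const 2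
  have hW_sq : Measurable fun l => ∫⁻ t, ‖kernelApply hβ φ w (l, t)‖ₑ ^ 2 :=
    ((measurable_kernelApply hβ φ hw.measurable).enorm.pow_const 2).lintegral_prod_right'
  have hae := ae_eq_of_forall_setLIntegral_eq_of_sigmaFinite (μ := plancherelMeasure β)
    (hu_sq.const_mul (∏ i, ENNReal.ofReal (b i)⁻¹))
    (hW_sq.const_mul ((∏ i, ENNReal.ofReal (a i)) * (∏ i, ENNReal.ofReal (q i))))
    fun S hS _ => by
      rw [lintegral_const_mul _ hu_sq, lintegral_const_mul _ hW_sq]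
      exact mul_setLIntegral_enorm_sq_eq hβ ha hq hb hP hframe hPu hum hw.measurable hu hC huC hS
  filter_upwards [hae, ae_lintegral_kernelApply hβ φ hu] with l hl hkernel
  rw [hl, ← hkernel]

theorem ae_mul_hsNormSq_projection_eq (hβ : IsAdmissibleBasis β)
    (ha : ∀ i, 0 < a i) (hq : ∀ i, 0 < q i) (hb : ∀ i, 0 < b i)
    {P : (Fin r → ℝ) → L2R d →L[ℂ] L2R d} (hP : ∀ l, IsStarProjection (P l))
    (hPm : IsMeasurableField P) {φ : L2N β} (hφ : φ ∈ fieldSpace hβ P)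
    (hframe : IsParsevalFrame (fieldSpace hβ P)
      fun γ : quasiLattice β a q b => leftRegular (γ : NilGroup β) φ) :
    ∀ᵐ l, (∏ i, ENNReal.ofReal (b i)⁻¹) * hsNormSq (P l) =
      (∏ i, ENNReal.ofReal (a i)) * (∏ i, ENNReal.ofReal (q i)) *
        hsNormSq (plancherelField hβ φ l) := by
  have hcontract : ∀ l v, ‖P l v‖ₑ ≤ ‖v‖ₑ := fun l v => enorm_le_iff_norm_le.2 <|
    ((P l).le_of_opNorm_le (hP l).norm_le v).trans_eq (one_mul _)
  have hbasis : ∀ᵐ l, ∀ j, (∏ i, ENNReal.ofReal (b i)⁻¹) * ‖P l (stdBasis d j)‖ₑ ^ 2 =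
      (∏ i, ENNReal.ofReal (a i)) * (∏ i, ENNReal.ofReal (q i)) *
        ‖plancherelField hβ φ l (P l (stdBasis d j))‖ₑ ^ 2 :=
    ae_all_iff.2 fun j => hβ.ae_plancherelMeasure_iff.1 <|
      ae_enorm_sq_eq_of_isParsevalFrame hβ ha hq hb hP hframe
        (fun l => DFunLike.congr_fun (hP l).isIdempotentElem (stdBasis d j))
        (hPm.stronglyMeasurable _) enorm_ne_top
        fun l => hcontract l _
  filter_upwards [hbasis, hβ.ae_plancherelMeasure_iff.1 (mem_fieldSpace.1 hφ)] with l hl hφl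
  rw [← hφl, hsNormSq_eq_tsum, hsNormSq_eq_tsum, ← ENNReal.tsum_mul_left, ← ENNReal.tsum_mul_left]
  exact tsum_congr hl

theorem ae_mul_hsNormSq_projection_le (hβ : IsAdmissibleBasis β)
    (ha : ∀ i, 0 < a i) (hq : ∀ i, 0 < q i) (hb : ∀ i, 0 < b i)
    {P : (Fin r → ℝ) → L2R d →L[ℂ] L2R d} (hP : ∀ l, IsStarProjection (P l))
    (hPm : IsMeasurableField P) {φ : L2N β} (hφ : φ ∈ fieldSpace hβ P)
    (hframe : IsParsevalFrame (fieldSpace hβ P)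
      fun γ : quasiLattice β a q b => leftRegular (γ : NilGroup β) φ) :
    ∀ᵐ l, ENNReal.ofReal |(matB β l).det| * hsNormSq (P l) ≤
      ENNReal.ofReal (∏ i, b i * q i) := by
  have hinv : (∏ i, ENNReal.ofReal (b i)) * ∏ i, ENNReal.ofReal (b i)⁻¹ = 1 := by
    rw [← Finset.prod_mul_distrib]
    refine Finset.prod_eq_one fun i _ => ?_
    rw [← ENNReal.ofReal_mul (hb i).le, mul_inv_cancel₀ (hb i).ne', ENNReal.ofReal_one]
  filter_upwards [ae_mul_hsNormSq_projection_eq hβ ha hq hb hP hPm hφ hframe,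
    ae_mul_spectralDensity_le_one hβ ha hq hb hφ hframe] with l hl hdensity
  rw [spectralDensity] at hdensity
  set D := ENNReal.ofReal |(matB β l).det|
  set A := ∏ i, ENNReal.ofReal (a i)
  set B := ∏ i, ENNReal.ofReal (b i)
  set Q := ∏ i, ENNReal.ofReal (q i)
  calc D * hsNormSq (P l) = B * D * ((∏ i, ENNReal.ofReal (b i)⁻¹) * hsNormSq (P l)) := by
        rw [← one_mul (D * hsNormSq (P l)), ← hinv]
        ring
    _ = B * Q * (A * (D * hsNormSq (plancherelField hβ φ l))) := by
        rw [hl]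
        ring
    _ ≤ B * Q * 1 := by gcongr
    _ = ENNReal.ofReal (∏ i, b i * q i) := by
        rw [mul_one, Finset.prod_mul_distrib,
          ENNReal.ofReal_mul (Finset.prod_nonneg fun i _ => (hb i).le),
          ENNReal.ofReal_prod_of_nonneg fun i _ => (hb i).le,
          ENNReal.ofReal_prod_of_nonneg fun i _ => (hq i).le]

end Multiplicity

end NilpotentFrames

end

open NilpotentFrames MeasureTheory in
theorem mainTheorem5_general {r d : ℕ} {𝔫 : Type*} [LieRing 𝔫] [LieAlgebra ℝ 𝔫]
    (β : Module.Basis (Fin r ⊕ Fin d ⊕ Fin d) ℝ 𝔫) (hβ : IsAdmissibleBasis β)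
    (a : Fin r → ℝ) (q b : Fin d → ℝ)
    (ha : ∀ k, 0 < a k) (hq : ∀ i, 0 < q i) (hb : ∀ i, 0 < b i)
    (K : Submodule ℂ (L2N β)) (hK_closed : IsClosed (K : Set (L2N β)))
    (hK_inv : ∀ g : NilGroup β, ∀ f ∈ K, leftRegular g f ∈ K)
    (φ : L2N β) (hφ : φ ∈ K)
    (hframe : IsParsevalFrame K
      (fun γ : quasiLattice β a q b => leftRegular (γ : NilGroup β) φ)) :
    (∃ P, IsProjectionField K P) ∧
      ∀ P, IsProjectionField K P →
        ∀ᵐ l : Fin r → ℝ,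
          ENNReal.ofReal |(matB β l).det| * (multiplicity P l : ENNReal) ≤
            ENNReal.ofReal (∏ i, b i * q i) := by
  have hcyclic : ∀ f ∈ K, (∀ g, inner ℂ f (leftRegular g φ) = 0) → f = 0 := fun f hf h =>
    hframe.eq_zero_of_inner_eq_zero hf fun γ => h γ
  refine ⟨⟨_, isProjectionField_supportProj hβ hK_closed (fun g => hK_inv g φ hφ) hcyclic⟩,
    fun P hP => ?_⟩
  obtain ⟨hP_proj, hP_meas, rfl⟩ := (isProjectionField_iff hβ).1 hP
  filter_upwards [ae_mul_hsNormSq_projection_le hβ ha hq hb hP_proj hP_meas hφ hframe] with l hl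
  calc ENNReal.ofReal |(matB β l).det| * (multiplicity P l : ENNReal)
      ≤ ENNReal.ofReal |(matB β l).det| * hsNormSq (P l) := by
        gcongr
        exact multiplicity_le_hsNormSq (hP_proj l)
    _ ≤ ENNReal.ofReal (∏ i, b i * q i) := hl

open NilpotentFrames MeasureTheory in
theorem mainTheorem5 {r d : ℕ} (hd : 0 < d) {𝔫 : Type*} [LieRing 𝔫] [LieAlgebra ℝ 𝔫]
    (β : Module.Basis (Fin r ⊕ Fin d ⊕ Fin d) ℝ 𝔫) (hβ : IsAdmissibleBasis β)
    (a : Fin r → ℝ) (q b : Fin d → ℝ)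
    (ha : ∀ k, 0 < a k) (hq : ∀ i, 0 < q i) (hb : ∀ i, 0 < b i)
    (I : Set (Fin r → ℝ)) (hI : I ⊆ {l ∈ crossSection β | ∀ k, 0 ≤ l k ∧ l k ≤ a k})
    (K : Submodule ℂ (L2N β)) (hK_closed : IsClosed (K : Set (L2N β)))
    (hK_inv : ∀ g : NilGroup β, ∀ f ∈ K, leftRegular g f ∈ K)
    (φ : L2N β) (hφ : φ ∈ K)
    (hframe : IsParsevalFrame K
      (fun γ : quasiLattice β a q b => leftRegular (γ : NilGroup β) φ)) :
    (∃ P, IsProjectionField K P) ∧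
      ∀ P, IsProjectionField K P →
        ∀ᵐ l : Fin r → ℝ, l ∈ I →
          ENNReal.ofReal |(matB β l).det| * (multiplicity P l : ENNReal) ≤
            ENNReal.ofReal (∏ i, b i * q i) := by
  have h := mainTheorem5_general β hβ a q b ha hq hb K hK_closed hK_inv φ hφ hframe
  exact ⟨h.1, fun P hP => (h.2 P hP).mono fun _ hl _ => hl⟩
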